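/- Convergence of the leave-one-out estimator for $T(f,g)$. Setting. Let $d\ge 1$, let $X\subset\mathbb R^d$ be compact with Lebesgue measure $\mu$, let $s>0$, $L>0$, $B'<B$, and let $\ell$ be the greatest integer strictly smaller than $s$. A function on $\mathbb R^d$ is in $\Sigma(s,L)$ if it is $C^\ell$ and $|D^rf(x)-D^rf(y)|\le L\|x-y\|^{s-\ell}$ for all $x,y\in\mathbb R^d$ and all multi-indices $r$ with $|r|=\ell$. Let $\Sigma(s,L,B',B)$ be the set of probability densities $f\in\Sigma(s,L)$ on $\mathbb R^d$ with $f<B$, and $f>B'$ on $X$. (The density may, but need not, be supported in $X$.) Density estimates. Let $K:\mathbb R^d\to\mathbb R$ be a bounded measurable kernel with $\int|K|<\infty$, $\int\|u\|^s|K(u)|\,du<\infty$, $\int K=1$ and $\int u^rK(u)\,du=0$ for $1\le|r|\le\ell$. The density estimates are kernel density estimates $\hat f(t)=\frac{1}{nh^d}\sum_{i=1}^n K\big(\frac{t-X_i}{h}\big)$ with positive bandwidths $h=h_n\in\Theta(n^{-1/(2s+d)})$, and likewise $\hat g$ with its own bandwidths. Either all of them are used as they are (then put $R=\mathbb R$),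 or all of them are truncated from below at $B'$ and from above at $B$ (then put $R=[B',B]$). Functional. Let $T(p,q)=\phi\left(\int_X\nu(p,q)\,d\mu\right)$, where $\nu$ is Lipschitz and twice differentiable with bounded second derivative on $R^2$, and $\phi$ has the same properties on the interval $\{\mu(X)\,\nu(a,b):a,b\in R\}$, in which the integral takes its values. The influence functions $\psi_f(\cdot;p,q)$, $\psi_g(\cdot;p,q)$, for measurable $p,q$ that on $X$ are bounded and $R$-valued, are functions with $$\tfrac{\partial}{\partial t}T(p+t(p_1-p),q)\big|_{t=0}=\int\psi_f(x;p,q)\,p_1(x)\,dx,\qquad \tfrac{\partial}{\partial t}T(p,q+t(q_1-q))\big|_{t=0}=\int\psi_g(x;p,q)\,q_1(x)\,dx$$ for all bounded probability densities $p_1,q_1$ on $\mathbb R^d$. Estimator. Let $X_1,\dots,X_n\sim f$ and $Y_1,\dots,Y_m\sim g$ be independent samples. Let $\hat f_{-i}$, $\hat g_{-i}$ be the density estimates from all points of the respective sample except $X_i$, respectively $Y_i$. With indices read cyclically in the smaller sample, $$\hat T=\frac1{\max(n,m)}\sum_{i=1}^{\max(n,m)}\Big(T(\hat f_{-i},\hat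 g_{-i})+\psi_f(X_i;\hat f_{-i},\hat g_{-i})+\psi_g(Y_i;\hat f_{-i},\hat g_{-i})\Big).$$ Theorem. Let $f,g\in\Sigma(s,L,B',B)$ and suppose that $$\mathbb E_f\big[(\psi_f(X;f',g')-\psi_f(X;f,g))^2\big]\ \text{ and }\ \mathbb E_g\big[(\psi_g(Y;f',g')-\psi_g(Y;f,g))^2\big]\ \text{ are } O\big(\|f-f'\|^2+\|g-g'\|^2\big)$$ as $\|f-f'\|^2,\|g-g'\|^2\to0$ in $L_2(X)$. Then, as $n,m\to\infty$ with $n$ and $m$ of the same order ($\zeta_l\le n/m\le\zeta_u$ for fixed $0<\zeta_l\le\zeta_u<\infty$), the mean squared error $\mathbb E[(\hat T-T(f,g))^2]$ is $$O\big(n^{-4s/(2s+d)}+m^{-4s/(2s+d)}\big)\ \text{ if } s<d/2,\qquad O\big(n^{-1}+m^{-1}\big)\ \text{ if } s\ge d/2,$$ where the constants do not depend on the choice of $f,g$ in the class. -/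

import Mathlib

open MeasureTheory Filter Topology Asymptotics
open scoped NNReal ENNReal

noncomputable section

/-- `d`-dimensional Euclidean space. -/
abbrev Euc (d : ℕ) : Type := EuclideanSpace ℝ (Fin d)

/-! ### Densities: Hölder classes -/

/-- The greatest integer strictly smaller than `s` (for `s > 0`): the order of the derivatives
that are controlled in the Hölder class of smoothness `s`. -/
def holderOrder (s : ℝ) : ℕ := ⌈s⌉₊ - 1

/-- The Hölder class `Σ(s, L)`: `f` is `ℓ` times continuously differentiable, `ℓ` the greatest
integer `< s`, and every partial derivative of order `ℓ` is Hölder continuous with exponent `s - ℓ`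
and constant `L`. The tuple `v` lists the coordinates in which one differentiates, so that
all `D^r` with `|r| = ℓ` occur. -/
def IsHolder {d : ℕ} (s L : ℝ) (f : Euc d → ℝ) : Prop :=
  ContDiff ℝ (holderOrder s) f ∧
    ∀ (v : Fin (holderOrder s) → Fin d) (x y : Euc d),
      |iteratedFDeriv ℝ (holderOrder s) f x (fun k => EuclideanSpace.single (v k) (1 : ℝ))
        - iteratedFDeriv ℝ (holderOrder s) f y (fun k => EuclideanSpace.single (v k) (1 : ℝ))|
        ≤ L * ‖x - y‖ ^ (s - (holderOrder s : ℝ))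

/-- `f` is a probability density with respect to Lebesgue measure. -/
structure IsDensity {d : ℕ} (f : Euc d → ℝ) : Prop where
  measurable : Measurable f
  nonneg : ∀ x, 0 ≤ f x
  integrable : Integrable f
  integral_eq_one : ∫ x, f x = 1

/-- Probability densities in the bounded Hölder class `Σ(s, L, B', B)`; the lower bound is
required on `X`, the domain of integration of the functional. -/
structure IsBoundedHolderDensity {d : ℕ} (X : Set (Euc d)) (s L B' B : ℝ) (f : Euc d → ℝ) :
    Prop where
  density : IsDensity f
  holder : IsHolder s L f
  lower : ∀ x ∈ X, B' < f x
  upper : ∀ x, f x < B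

/-- The probability measure with density `f`. -/
def lawOf {d : ℕ} (f : Euc d → ℝ) : Measure (Euc d) :=
  volume.withDensity fun x => ENNReal.ofReal (f x)

/-! ### Kernel density estimators -/

/-- A smoothing kernel of order `ℓ`, the greatest integer `< s`: bounded, integrating to one, with
vanishing moments of orders `1, …, ℓ` and a finite absolute moment of order `s`. -/
structure IsSmoothingKernel {d : ℕ} (s : ℝ) (K : Euc d → ℝ) : Prop where
  measurable : Measurable K
  bounded : ∃ M : ℝ, ∀ u, |K u| ≤ M
  integrable : Integrable K
  integral_eq_one : ∫ u, K u = 1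
  moment_integrable : Integrable fun u => ‖u‖ ^ s * |K u|
  moment_eq_zero : ∀ r : Fin d → ℕ, 1 ≤ ∑ k, r k → ∑ k, r k ≤ holderOrder s →
    ∫ u, (∏ k, u k ^ r k) * K u = 0

/-- The kernel density estimator with bandwidth `h` that uses the sample points `x j`, `j ∈ S`. -/
def kde {d n : ℕ} (K : Euc d → ℝ) (h : ℝ) (S : Finset (Fin n)) (x : Fin n → Euc d) (t : Euc d) :
    ℝ :=
  1 / ((S.card : ℝ) * h ^ d) * ∑ j ∈ S, K (h⁻¹ • (t - x j))

/-- Density estimates are either plain kernel density estimates, or kernel density estimates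
truncated from below at `B'` and from above at `B`. -/
inductive EstimatorKind where
  | plain
  | truncated

/-- The truncation that is applied to the values of the kernel density estimate. -/
def EstimatorKind.clip (k : EstimatorKind) (B' B : ℝ) (y : ℝ) : ℝ :=
  match k with
  | .plain => y
  | .truncated => max B' (min B y)

/-- The interval in which the density estimates take their values. -/
def EstimatorKind.range (k : EstimatorKind) (B' B : ℝ) : Set ℝ :=
  match k with
  | .plain => Set.univ
  | .truncated => Set.Icc B' B

/-- The leave-one-out density estimate: the (truncated) kernel density estimate based on all the
points of the sample `x` except `x i`. The bandwidth `h` is a function of the number of points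
used. -/
def looDensity {d n : ℕ} (k : EstimatorKind) (B' B : ℝ) (K : Euc d → ℝ) (h : ℕ → ℝ)
    (x : Fin n → Euc d) (i : Fin n) (t : Euc d) : ℝ :=
  k.clip B' B (kde K (h (n - 1)) (Finset.univ.erase i) x t)

/-! ### Functionals of two densities and their influence functions -/

/-- `F` is Lipschitz on `D` and twice differentiable at every point of `D`, with
second derivative bounded on `D`. -/
structure IsLipschitzTwiceDiffOn {V : Type*} [NormedAddCommGroup V] [NormedSpace ℝ V]
    (F : V → ℝ) (D : Set V) : Prop where
  lipschitz : ∃ C : ℝ≥0, LipschitzOnWith C F D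
  differentiable : ∀ z ∈ D, ∀ᶠ w in 𝓝 z, DifferentiableAt ℝ F w
  twice_differentiable : ∀ z ∈ D, DifferentiableAt ℝ (fderiv ℝ F) z
  second_bounded : ∃ C : ℝ, ∀ z ∈ D, ‖fderiv ℝ (fderiv ℝ F) z‖ ≤ C

/-- The functional `T(p, q) = φ(∫_X ν(p, q) dμ)`, `μ` the Lebesgue measure. -/
def functional {d : ℕ} (X : Set (Euc d)) (φ : ℝ → ℝ) (ν : ℝ × ℝ → ℝ) (p q : Euc d → ℝ) : ℝ :=
  φ (∫ x in X, ν (p x, q x))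

/-- The interval of possible values of `∫_X ν(p, q) dμ` for `R`-valued functions `p, q`, where
`R` is an interval (so that `ν` takes `R × R` to an interval). -/
def integralRange {d : ℕ} (X : Set (Euc d)) (ν : ℝ × ℝ → ℝ) (R : Set ℝ) : Set ℝ :=
  (fun z => volume.real X * ν z) '' (R ×ˢ R)

/-- The functions at which the functional and its influence functions are evaluated: measurable,
and on `X` bounded with values in `R`. -/
structure IsAdmissible {d : ℕ} (X : Set (Euc d)) (R : Set ℝ) (p : Euc d → ℝ) : Prop where
  measurable : Measurable p
  mem : ∀ x ∈ X, p x ∈ R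
  bounded : ∃ M : ℝ, ∀ x ∈ X, |p x| ≤ M

/-- `ψ` is the influence function of `T` with respect to the first argument at `(p, q)`: for all
(bounded) probability densities `p₁`, the Gateaux derivative of `T` in the first argument at
`(p, q)` in the direction `p₁ - p` is `∫ ψ p₁`. -/
def IsInfluenceFst {d : ℕ} (T : (Euc d → ℝ) → (Euc d → ℝ) → ℝ) (p q ψ : Euc d → ℝ) : Prop :=
  ∀ p₁ : Euc d → ℝ, IsDensity p₁ → (∃ M : ℝ, ∀ x, p₁ x ≤ M) →
    Integrable (fun x => ψ x * p₁ x) ∧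
      HasDerivAt (fun t : ℝ => T (fun x => p x + t * (p₁ x - p x)) q) (∫ x, ψ x * p₁ x) 0

/-- `ψ` is the influence function of `T` with respect to the second argument at `(p, q)`. -/
def IsInfluenceSnd {d : ℕ} (T : (Euc d → ℝ) → (Euc d → ℝ) → ℝ) (p q ψ : Euc d → ℝ) : Prop :=
  ∀ q₁ : Euc d → ℝ, IsDensity q₁ → (∃ M : ℝ, ∀ x, q₁ x ≤ M) →
    Integrable (fun x => ψ x * q₁ x) ∧
      HasDerivAt (fun t : ℝ => T p (fun x => q x + t * (q₁ x - q x))) (∫ x, ψ x * q₁ x) 0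

/-- The squared distance in `L₂(X)`. -/
def sqDist {d : ℕ} (X : Set (Euc d)) (p q : Euc d → ℝ) : ℝ :=
  ∫ x in X, (p x - q x) ^ 2

/-- The regularity condition `E_ρ[(ψ(Z; f', g') - ψ(Z; f, g))²] = O(‖f - f'‖² + ‖g - g'‖²)` as
`‖f - f'‖², ‖g - g'‖² → 0`, where `Z` has the density `ρ`. -/
def InfluenceRegular {d : ℕ} (X : Set (Euc d)) (R : Set ℝ)
    (ψ : (Euc d → ℝ) → (Euc d → ℝ) → Euc d → ℝ) (ρ f g : Euc d → ℝ) : Prop :=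
  ∃ C : ℝ, ∃ δ > 0, ∀ f' g' : Euc d → ℝ, IsAdmissible X R f' → IsAdmissible X R g' →
    sqDist X f f' < δ → sqDist X g g' < δ →
      ∫⁻ z, ENNReal.ofReal ((ψ f' g' z - ψ f g z) ^ 2) ∂(lawOf ρ)
        ≤ ENNReal.ofReal (C * (sqDist X f f' + sqDist X g g'))

/-! ### The leave-one-out estimator -/

/-- The leave-one-out estimator
`1 / max(n, m) * ∑ᵢ (T(f̂₋ᵢ, ĝ₋ᵢ) + ψ_f(Xᵢ; f̂₋ᵢ, ĝ₋ᵢ) + ψ_g(Yᵢ; f̂₋ᵢ, ĝ₋ᵢ))`, `0 ≤ i < max(n, m)`, where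
the indices of the `X`-sample are read modulo `n` and those of the `Y`-sample modulo `m`; `fhat`
and `ghat` turn a sample and an index into a leave-one-out density estimate. -/
def looEstimator {d n m : ℕ} [NeZero n] [NeZero m] (T : (Euc d → ℝ) → (Euc d → ℝ) → ℝ)
    (ψf ψg : (Euc d → ℝ) → (Euc d → ℝ) → Euc d → ℝ)
    (fhat : (Fin n → Euc d) → Fin n → Euc d → ℝ) (ghat : (Fin m → Euc d) → Fin m → Euc d → ℝ)
    (x : Fin n → Euc d) (y : Fin m → Euc d) : ℝ :=
  1 / ((max n m : ℕ) : ℝ) * ∑ i ∈ Finset.range (max n m),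
    (T (fhat x (Fin.ofNat n i)) (ghat y (Fin.ofNat m i))
      + ψf (fhat x (Fin.ofNat n i)) (ghat y (Fin.ofNat m i)) (x (Fin.ofNat n i))
      + ψg (fhat x (Fin.ofNat n i)) (ghat y (Fin.ofNat m i)) (y (Fin.ofNat m i)))

/-- The joint law of independent samples, `n` points from the density `f` and `m` points from the
density `g`. -/
def sampleLaw {d : ℕ} (f g : Euc d → ℝ) (n m : ℕ) :
    Measure ((Fin n → Euc d) × (Fin m → Euc d)) :=
  (Measure.pi fun _ : Fin n => lawOf f).prod (Measure.pi fun _ : Fin m => lawOf g)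

end

/-!
The influence property determines `ψ_f(·; p, q)` and `ψ_g(·; p, q)` almost everywhere: testing it
against the uniform densities on sets of finite volume identifies the integrals of `ψ_f` over such
sets, and differentiation under the integral sign gives
`ψ_f(x; p, q) = φ'(V) (1_X(x) ∂₁ν(p x, q x) - ∫_X ∂₁ν(p, q) p)` with `V = ∫_X ν(p, q)`
(`FunctionalData.influenceFst_ae_eq`). The point at which the influence function is evaluated is
independent of the density estimates that are plugged in, and its law is absolutely continuous, so
the leave-one-out estimator agrees almost surely with the one that uses these explicit formulas
(`looEstimator_ae_eq`). The formulas also show that the influence functions are continuous in mean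
square with constants that do not depend on `f` and `g`, which makes the final bound uniform.

*Bias.* Given the other observations, the mean of `ψ_f(X_i; p, q)` is an integral against the true
density, so that the mean of a summand is the first-order expansion of `T` around the density
estimates, evaluated at `(f, g)`. By Taylor's formula its distance to `T(f, g)` is at most a constant
times the mean integrated squared errors of the two estimates (`abs_integral_summand_sub_le`). These
are of order `h ^ (2 s) + 1 / (n h ^ d)`, by the usual analysis of kernel estimates on the Hölder
class (`IsSmoothingKernel.bias_le`, `integral_sqDist_looDensity_le`).

*Variance.* By the Efron–Stein inequality (`efronStein_prod`) it suffices that moving one observation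
changes the estimator by `O(1 / n)` in mean square. Moving `X_i` changes the summands from whose
density estimates it is left out, a fraction `O(1 / n)` of all, by a constant; each other one changes by at most `1 / n` times a constant plus values and integrals of the
rescaled kernels, whose averages over the sample have bounded second moment since `1 / (n h ^ d)` is
bounded (`abs_plugInEstimator_sub_update_le`, `integral_sq_avg_shiftWeight_le`). The functions `ν`,
`φ` and their derivatives extend to Lipschitz functions on the whole space (`exists_plugIn`), so that
these bounds hold for every sample.

With `h` of order `n ^ (-1 / (2 s + d))` the squared bias is of order `n ^ (-4 s / (2 s + d))` and the
variance is of order `1 / n`; the comparison of `4 s / (2 s + d)` with `1` separates the two cases.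
-/

/-! ### Taylor expansion of Hölder functions and the bias of kernel smoothing -/

lemma iteratedDeriv_comp_line {d : ℕ} {N : ℕ} {f : Euc d → ℝ} (hf : ContDiff ℝ N f)
    (x v : Euc d) {k : ℕ} (hk : k ≤ N) (τ : ℝ) :
    iteratedDeriv k (fun t : ℝ => f (x + t • v)) τ
      = iteratedFDeriv ℝ k f (x + τ • v) (fun _ => v) := by
  have h1 : (fun t : ℝ => f (x + t • v))
      = (fun y => f (x + y)) ∘ (ContinuousLinearMap.toSpanSingleton ℝ v) := by
    ext t; simp [ContinuousLinearMap.toSpanSingleton_apply]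
  have h2 : ContDiff ℝ N (fun y => f (x + y)) := by fun_prop
  rw [iteratedDeriv_eq_iteratedFDeriv, h1,
    ContinuousLinearMap.iteratedFDeriv_comp_right _ h2 _ (by exact_mod_cast hk)]
  simp [iteratedFDeriv_comp_add_left, ContinuousLinearMap.toSpanSingleton_apply]

lemma exists_taylor_line {d n : ℕ} {f : Euc d → ℝ} (hf : ContDiff ℝ (n + 1 : ℕ) f)
    (x v : Euc d) :
    ∃ ξ : ℝ, ξ ∈ Set.Ioo (0 : ℝ) 1 ∧
      f (x + v) = ∑ k ∈ Finset.range (n + 1), ((k.factorial : ℝ)⁻¹)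
          * iteratedFDeriv ℝ k f x (fun _ => v)
        + (((n + 1).factorial : ℝ)⁻¹) * iteratedFDeriv ℝ (n + 1) f (x + ξ • v) (fun _ => v) := by
  have hγ : ContDiff ℝ (n + 1 : ℕ) (fun t : ℝ => f (x + t • v)) := by fun_prop
  obtain ⟨ξ, hξ, h⟩ := taylor_mean_remainder_lagrange_iteratedDeriv (f := fun t : ℝ => f (x + t • v))
    (x := 1) (x₀ := 0) (n := n) (by norm_num) (by simpa using hγ.contDiffOn)
  have hI : Set.uIcc (0 : ℝ) 1 = Set.Icc 0 1 := Set.uIcc_of_le zero_le_one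
  have hI' : Set.uIoo (0 : ℝ) 1 = Set.Ioo 0 1 := Set.uIoo_of_le zero_le_one
  refine ⟨ξ, by rwa [hI'] at hξ, ?_⟩
  rw [taylor_within_apply, iteratedDeriv_comp_line hf x v le_rfl] at h
  have h3 : ∀ k ∈ Finset.range (n + 1),
      (((k.factorial : ℝ)⁻¹ * (1 - 0) ^ k) • iteratedDerivWithin k (fun t : ℝ => f (x + t • v))
        (Set.uIcc 0 1) 0) = ((k.factorial : ℝ)⁻¹) * iteratedFDeriv ℝ k f x (fun _ => v) := by
    intro k hk
    have hk' : k ≤ n + 1 := (Finset.mem_range.1 hk).le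
    rw [hI, iteratedDerivWithin_eq_iteratedDeriv (uniqueDiffOn_Icc zero_lt_one)
      ((hγ.of_le (by exact_mod_cast hk')).contDiffAt) (by simp), iteratedDeriv_comp_line hf x v hk']
    simp
  rw [Finset.sum_congr rfl h3] at h
  simp only [one_smul, sub_zero, one_pow, mul_one] at h
  rw [sub_eq_iff_eq_add] at h
  rw [h]; ring

lemma multilinear_diag_eq_sum {d k : ℕ} (A : ContinuousMultilinearMap ℝ (fun _ : Fin k => Euc d) ℝ)
    (u : Euc d) :
    A (fun _ => u) = ∑ v : Fin k → Fin d,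
      (∏ i, u (v i)) * A (fun i => EuclideanSpace.single (v i) (1 : ℝ)) := by
  classical
  have hu : u = ∑ j : Fin d, u j • EuclideanSpace.single j (1 : ℝ) := by
    have := (EuclideanSpace.basisFun (Fin d) ℝ).sum_repr u
    simpa using this.symm
  conv_lhs => rw [hu]
  have := A.toMultilinearMap.map_sum (fun (_ : Fin k) (j : Fin d) => u j • EuclideanSpace.single j (1 : ℝ))
  have h2 : A (fun _ => ∑ j : Fin d, u j • EuclideanSpace.single j (1 : ℝ)) = _ := this
  rw [h2]
  refine Finset.sum_congr rfl fun v _ => ?_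
  have := A.toMultilinearMap.map_smul_univ (fun i => u (v i)) (fun i => EuclideanSpace.single (v i) (1 : ℝ))
  simpa using this

lemma abs_prod_coord_le {d k : ℕ} (u : Euc d) (v : Fin k → Fin d) :
    |∏ i, u (v i)| ≤ ‖u‖ ^ k := by
  rw [Finset.abs_prod]
  calc ∏ i, |u (v i)| ≤ ∏ _i : Fin k, ‖u‖ :=
        Finset.prod_le_prod (fun _ _ => abs_nonneg _) (fun i _ => PiLp.norm_apply_le u (v i))
    _ = ‖u‖ ^ k := by simp

lemma holderOrder_lt {s : ℝ} (hs : 0 < s) : (holderOrder s : ℝ) < s := by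
  unfold holderOrder
  have h1 : 1 ≤ ⌈s⌉₊ := Nat.one_le_iff_ne_zero.2 (Nat.ceil_pos.2 hs).ne'
  rw [Nat.cast_sub h1]
  have := Nat.ceil_lt_add_one hs.le
  push_cast; linarith

/-- Taylor's formula in a Hölder class, with the degree-`ℓ` Taylor polynomial: the difference of
the `ℓ`-th derivatives at an intermediate point and at `x` is controlled by the Hölder condition. -/
lemma IsHolder.taylor {d : ℕ} {s L : ℝ} (hs : 0 < s) (hL : 0 ≤ L) {f : Euc d → ℝ}
    (hf : IsHolder s L f)
    (x v : Euc d) :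
    |f (x + v) - ∑ k ∈ Finset.range (holderOrder s + 1), ((k.factorial : ℝ)⁻¹)
          * iteratedFDeriv ℝ k f x (fun _ => v)| ≤ (d : ℝ) ^ holderOrder s * L * ‖v‖ ^ s := by
  obtain ⟨hC, hH⟩ := hf
  have hlt := holderOrder_lt hs
  generalize holderOrder s = l at *
  -- the difference of the top derivatives, applied to `(v, …, v)`
  have key : ∀ ξ : ℝ, 0 ≤ ξ → ξ ≤ 1 →
      |iteratedFDeriv ℝ l f (x + ξ • v) (fun _ => v) - iteratedFDeriv ℝ l f x (fun _ => v)|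
        ≤ (d : ℝ) ^ l * L * ‖v‖ ^ s := by
    intro ξ h0 h1
    rw [multilinear_diag_eq_sum, multilinear_diag_eq_sum, ← Finset.sum_sub_distrib]
    calc _ ≤ ∑ w : Fin l → Fin d, ‖v‖ ^ l * (L * ‖v‖ ^ (s - l)) := by
          refine (Finset.abs_sum_le_sum_abs _ _).trans (Finset.sum_le_sum fun w _ => ?_)
          rw [← mul_sub, abs_mul]
          refine mul_le_mul (abs_prod_coord_le v w) ((hH w _ _).trans ?_) (abs_nonneg _)
            (by positivity)
          refine mul_le_mul_of_nonneg_left ?_ hL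
          refine Real.rpow_le_rpow (norm_nonneg _) ?_ (by linarith)
          rw [add_sub_cancel_left, norm_smul, Real.norm_of_nonneg h0]
          exact mul_le_of_le_one_left (norm_nonneg _) h1
      _ = (d : ℝ) ^ l * L * ‖v‖ ^ s := by
          simp only [Finset.sum_const, Finset.card_univ, Fintype.card_fun, Fintype.card_fin,
            nsmul_eq_mul, Nat.cast_pow]
          have : ‖v‖ ^ s = ‖v‖ ^ l * ‖v‖ ^ (s - l) := by
            rw [← Real.rpow_natCast, ← Real.rpow_add_of_nonneg (norm_nonneg _) (by positivity)
              (by linarith)]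
            congr 1; ring
          rw [this]; ring
  rcases l with _ | n
  · have := key 1 zero_le_one le_rfl
    simpa using this
  · obtain ⟨ξ, hξ, h⟩ := exists_taylor_line hC x v
    rw [Finset.sum_range_succ, h, add_sub_add_left_eq_sub, ← mul_sub, abs_mul]
    refine (mul_le_of_le_one_left (abs_nonneg _) ?_).trans (key ξ hξ.1.le hξ.2.le)
    rw [abs_of_nonneg (by positivity)]
    exact inv_le_one_of_one_le₀ (by exact_mod_cast Nat.one_le_iff_ne_zero.2 (Nat.factorial_ne_zero _))

namespace IsSmoothingKernel
variable {d : ℕ} {s : ℝ} {K : Euc d → ℝ}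

lemma integrable_monomial (hK : IsSmoothingKernel s K) {k : ℕ} (hk : k ≤ holderOrder s)
    (hs : 0 < s) (v : Fin k → Fin d) : Integrable fun u => (∏ i, u (v i)) * K u := by
  have hm := hK.measurable
  refine (hK.moment_integrable.add hK.integrable.abs).mono' (by fun_prop) (ae_of_all _ fun u => ?_)
  rw [Real.norm_eq_abs, abs_mul]
  have h1 : ‖u‖ ^ k ≤ ‖u‖ ^ s + 1 := by
    have hks : (k : ℝ) ≤ s := (Nat.cast_le.2 hk).trans (holderOrder_lt hs).le
    rcases le_total ‖u‖ 1 with h | h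
    · exact (pow_le_one₀ (norm_nonneg _) h).trans
        (le_add_of_nonneg_left (Real.rpow_nonneg (norm_nonneg _) _))
    · rw [← Real.rpow_natCast]
      exact (Real.rpow_le_rpow_of_exponent_le h hks).trans (by linarith)
  calc |∏ i, u (v i)| * |K u| ≤ (‖u‖ ^ s + 1) * |K u| :=
        mul_le_mul_of_nonneg_right ((abs_prod_coord_le u v).trans h1) (abs_nonneg _)
    _ = _ := by simp [add_mul]

lemma integral_monomial (hK : IsSmoothingKernel s K) {k : ℕ} (h1 : 1 ≤ k) (hk : k ≤ holderOrder s)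
    (v : Fin k → Fin d) : ∫ u : Euc d, (∏ i, u (v i)) * K u = 0 := by
  classical
  have h := hK.moment_eq_zero (fun j => (Finset.univ.filter fun i => v i = j).card)
  have hc : ∑ j, (Finset.univ.filter fun i => v i = j).card = k := by
    rw [← Finset.card_eq_sum_card_fiberwise (f := v) (s := Finset.univ) (t := Finset.univ) (by simp)]
    simp
  rw [hc] at h
  rw [← h h1 hk]
  congr 1 with u
  congr 1
  rw [← Finset.prod_fiberwise Finset.univ v]
  refine Finset.prod_congr rfl fun j _ => ?_
  rw [Finset.prod_congr rfl (g := fun _ => u j) (by simp +contextual)]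
  simp

lemma integrable_diag (hK : IsSmoothingKernel s K) (hs : 0 < s) {k : ℕ} (hk : k ≤ holderOrder s)
    (A : ContinuousMultilinearMap ℝ (fun _ : Fin k => Euc d) ℝ) :
    Integrable fun u => A (fun _ => u) * K u := by
  simp_rw [multilinear_diag_eq_sum A, Finset.sum_mul]
  refine integrable_finsetSum _ fun v _ => ?_
  refine ((hK.integrable_monomial hk hs v).mul_const
    (A fun i => EuclideanSpace.single (v i) 1)).congr (ae_of_all _ fun u => ?_)
  simp only; ring

lemma integral_diag (hK : IsSmoothingKernel s K) (hs : 0 < s) {k : ℕ} (h1 : 1 ≤ k)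
    (hk : k ≤ holderOrder s) (A : ContinuousMultilinearMap ℝ (fun _ : Fin k => Euc d) ℝ) :
    ∫ u, A (fun _ => u) * K u = 0 := by
  have : ∀ u, A (fun _ => u) * K u = ∑ v : Fin k → Fin d, (∏ i, u (v i)) * K u
      * A (fun i => EuclideanSpace.single (v i) (1 : ℝ)) := fun u => by
    rw [multilinear_diag_eq_sum A, Finset.sum_mul]
    exact Finset.sum_congr rfl fun v _ => by ring
  simp_rw [this]
  rw [integral_finsetSum _ fun v _ => (hK.integrable_monomial hk hs v).mul_const _]
  exact Finset.sum_eq_zero fun v _ => by rw [integral_mul_const, hK.integral_monomial h1 hk v, zero_mul]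

/-- The bias of kernel smoothing in the Hölder class: the moment conditions cancel all terms of
the Taylor polynomial but the constant one. -/
lemma bias_le (hK : IsSmoothingKernel s K) (hs : 0 < s) {L : ℝ} (hL : 0 ≤ L) {f : Euc d → ℝ}
    (hf : IsHolder s L f) (hfm : Measurable f) {B : ℝ} (hfB : ∀ x, |f x| ≤ B) {h : ℝ} (hh : 0 ≤ h)
    (t : Euc d) :
    |(∫ u, K u * f (t - h • u)) - f t|
      ≤ ((d : ℝ) ^ holderOrder s * L * ∫ u, ‖u‖ ^ s * |K u|) * h ^ s := by
  have hKm := hK.measurable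
  set Q : Euc d → ℝ := fun v => ∑ k ∈ Finset.range (holderOrder s + 1), ((k.factorial : ℝ)⁻¹)
          * iteratedFDeriv ℝ k f t (fun _ => v) with hQ
  have hdiag : ∀ k (u : Euc d), iteratedFDeriv ℝ k f t (fun _ => (-h) • u)
      = (-h) ^ k * iteratedFDeriv ℝ k f t (fun _ => u) := by
    intro k u
    have := (iteratedFDeriv ℝ k f t).toMultilinearMap.map_smul_univ (fun _ => -h) (fun _ => u)
    simpa using this
  have hint : ∀ k ∈ Finset.range (holderOrder s + 1), Integrable fun u : Euc d =>
      ((k.factorial : ℝ)⁻¹ * (-h) ^ k) * (iteratedFDeriv ℝ k f t (fun _ => u) * K u) := fun k hk =>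
    (hK.integrable_diag hs (Nat.lt_succ_iff.1 (Finset.mem_range.1 hk)) _).const_mul _
  have hQK : ∀ u, Q ((-h) • u) * K u = ∑ k ∈ Finset.range (holderOrder s + 1),
      ((k.factorial : ℝ)⁻¹ * (-h) ^ k) * (iteratedFDeriv ℝ k f t (fun _ => u) * K u) := fun u => by
    rw [hQ, Finset.sum_mul]
    exact Finset.sum_congr rfl fun k _ => by rw [hdiag]; ring
  have hQint : Integrable fun u => Q ((-h) • u) * K u := by
    simp_rw [hQK]; exact integrable_finsetSum _ hint
  have hQval : ∫ u, Q ((-h) • u) * K u = f t := by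
    simp_rw [hQK]
    rw [integral_finsetSum _ hint, Finset.sum_range_succ', Finset.sum_eq_zero]
    · simp [hK.integral_eq_one, integral_const_mul]
    · intro k hk
      rw [integral_const_mul, hK.integral_diag hs (by omega)
        (by have := Finset.mem_range.1 hk; omega), mul_zero]
  have hfint : Integrable fun u => K u * f (t - h • u) := by
    exact hK.integrable.mul_bdd (c := B)
      (hfm.comp (by fun_prop : Measurable fun u : Euc d => t - h • u)).aestronglyMeasurable
      (ae_of_all _ fun u => hfB _)
  rw [← hQval, ← integral_sub hfint hQint, ← integral_const_mul, ← integral_mul_const]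
  refine (abs_integral_le_integral_abs).trans (integral_mono ?_ ?_ fun u => ?_)
  · exact (hfint.sub hQint).abs
  · exact (hK.moment_integrable.const_mul _).mul_const _
  · have h3 := hf.taylor hs hL t ((-h) • u)
    have h4 : t + (-h) • u = t - h • u := by rw [neg_smul, sub_eq_add_neg]
    rw [h4, norm_smul, norm_neg, Real.norm_of_nonneg hh, Real.mul_rpow hh (norm_nonneg _)] at h3
    simp only
    rw [mul_comm (K u), ← sub_mul, abs_mul]
    refine (mul_le_mul_of_nonneg_right h3 (abs_nonneg _)).trans (le_of_eq ?_)
    ring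

end IsSmoothingKernel

/-! ### Resampling one coordinate of a sample -/

section Probability

variable {α β Ω Ω' : Type*} [MeasurableSpace α] [MeasurableSpace β] [MeasurableSpace Ω]
  [MeasurableSpace Ω']

lemma integrable_of_abs_le {μ : Measure Ω} [IsFiniteMeasure μ] {F : Ω → ℝ} (hF : Measurable F)
    {M : ℝ} (hM : ∀ x, |F x| ≤ M) : Integrable F μ :=
  Integrable.of_bound hF.aestronglyMeasurable M (ae_of_all _ hM)

lemma measurable_update_prod {n : ℕ} (i : Fin n) :
    Measurable fun p : (Fin n → α) × α => Function.update p.1 i p.2 := by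
  rw [measurable_pi_iff]
  intro j
  by_cases h : j = i
  · subst h; simpa using measurable_snd
  · simp only [Function.update_of_ne h]; fun_prop

/-- Replacing one coordinate by an independent copy preserves a product of identical laws. -/
lemma measurePreserving_update {n : ℕ} (μ : Measure α) [IsProbabilityMeasure μ] (i : Fin n) :
    MeasurePreserving (fun p : (Fin n → α) × α => Function.update p.1 i p.2)
      ((Measure.pi fun _ => μ).prod μ) (Measure.pi fun _ => μ) := by
  refine ⟨measurable_update_prod i, (Measure.pi_eq fun s hs => ?_).symm⟩
  rw [Measure.map_apply (measurable_update_prod i) (MeasurableSet.univ_pi hs)]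
  have : (fun p : (Fin n → α) × α => Function.update p.1 i p.2) ⁻¹' (Set.univ.pi s)
      = (Set.univ.pi fun j => if j = i then Set.univ else s j) ×ˢ s i := by
    ext ⟨x, z⟩
    simp only [Set.mem_preimage, Set.mem_pi, Set.mem_univ, true_implies, Set.mem_prod]
    constructor
    · intro h
      refine ⟨fun j => ?_, by simpa using h i⟩
      by_cases hj : j = i
      · simp [hj]
      · simpa [hj] using h j
    · rintro ⟨h1, h2⟩ j
      by_cases hj : j = i
      · subst hj; simpa using h2
      · simpa [hj] using h1 j
  rw [this, Measure.prod_prod, Measure.pi_pi, ← Finset.mul_prod_erase _ _ (Finset.mem_univ i),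
    ← Finset.mul_prod_erase _ (fun j => μ (s j)) (Finset.mem_univ i)]
  simp only [if_true, measure_univ, one_mul]
  rw [mul_comm]
  congr 1
  exact Finset.prod_congr rfl fun j hj => by simp [Finset.ne_of_mem_erase hj]

/-- In a pair of independent samples, a coordinate of the first one may be replaced by an
independent copy. -/
lemma measurePreserving_update_fst {n : ℕ} (μ : Measure α) [IsProbabilityMeasure μ]
    (ρ : Measure Ω) [IsProbabilityMeasure ρ] (i : Fin n) :
    MeasurePreserving (fun p : ((Fin n → α) × Ω) × α => (Function.update p.1.1 i p.2, p.1.2))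
      (((Measure.pi fun _ => μ).prod ρ).prod μ) ((Measure.pi fun _ => μ).prod ρ) := by
  have h1 := (measurePreserving_update μ i).prod (MeasurePreserving.id ρ)
  -- rearrange `((x, y), z)` to `((x, z), y)`
  have e1 := measurePreserving_prodAssoc (Measure.pi fun _ : Fin n => μ) ρ μ
  have e2 := (MeasurePreserving.id (Measure.pi fun _ : Fin n => μ)).prod
    (Measure.measurePreserving_swap (μ := ρ) (ν := μ))
  have e3 := (measurePreserving_prodAssoc (Measure.pi fun _ : Fin n => μ) μ ρ).symm
  exact h1.comp (e3.comp (e2.comp e1))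

lemma integral_update_fst {n : ℕ} (μ : Measure α) [IsProbabilityMeasure μ]
    (ρ : Measure Ω) [IsProbabilityMeasure ρ] (i : Fin n) {F : (Fin n → α) × Ω → ℝ}
    (hF : Measurable F) {M : ℝ} (hM : ∀ p, |F p| ≤ M) :
    ∫ p, F p ∂((Measure.pi fun _ => μ).prod ρ)
      = ∫ z, ∫ p, F (Function.update p.1 i z, p.2) ∂((Measure.pi fun _ => μ).prod ρ) ∂μ := by
  have h := measurePreserving_update_fst μ ρ i
  rw [← h.map_eq, integral_map h.measurable.aemeasurable hF.aestronglyMeasurable, h.map_eq]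
  rw [integral_prod_symm]
  exact integrable_of_abs_le (hF.comp h.measurable) fun _ => hM _

lemma integral_update_fst' {n : ℕ} (μ : Measure α) [IsProbabilityMeasure μ]
    (ρ : Measure Ω) [IsProbabilityMeasure ρ] (i : Fin n) {F : (Fin n → α) × Ω → ℝ}
    (hF : Measurable F) {M : ℝ} (hM : ∀ p, |F p| ≤ M) :
    ∫ p, F p ∂((Measure.pi fun _ => μ).prod ρ)
      = ∫ p, ∫ z, F (Function.update p.1 i z, p.2) ∂μ ∂((Measure.pi fun _ => μ).prod ρ) := by
  have h := measurePreserving_update_fst μ ρ i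
  rw [← h.map_eq, integral_map h.measurable.aemeasurable hF.aestronglyMeasurable, h.map_eq]
  rw [integral_prod]
  exact integrable_of_abs_le (hF.comp h.measurable) fun _ => hM _

/-- A property that holds for almost every value of one coordinate, the other ones being fixed,
holds almost surely. -/
lemma ae_of_forall_ae_update_fst {n : ℕ} (μ : Measure α) [IsProbabilityMeasure μ]
    (ρ : Measure Ω) [IsProbabilityMeasure ρ] (i : Fin n) {P : (Fin n → α) × Ω → Prop}
    (hP : MeasurableSet {p | P p})
    (h : ∀ p : (Fin n → α) × Ω, ∀ᵐ z ∂μ, P (Function.update p.1 i z, p.2)) :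
    ∀ᵐ p ∂((Measure.pi fun _ => μ).prod ρ), P p := by
  have hmp := measurePreserving_update_fst μ ρ i
  rw [← hmp.map_eq, ae_map_iff hmp.measurable.aemeasurable hP]
  refine Measure.ae_prod_iff_ae_ae (hmp.measurable hP) |>.2 (ae_of_all _ fun p => h p)

/-! ### The Efron–Stein inequality -/

lemma variance_eq_sq_sub {μ : Measure Ω} [IsProbabilityMeasure μ] {F : Ω → ℝ}
    (hF : Measurable F) {M : ℝ} (hM : ∀ x, |F x| ≤ M) (c : ℝ) :
    ∫ x, (F x - c) ^ 2 ∂μ = (∫ x, F x ^ 2 ∂μ) - 2 * c * (∫ x, F x ∂μ) + c ^ 2 := by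
  have h1 : Integrable F μ := integrable_of_abs_le hF hM
  have h2 : Integrable (fun x => F x ^ 2) μ := integrable_of_abs_le (hF.pow_const 2) (M := M ^ 2)
    fun x => by rw [abs_pow]; exact pow_le_pow_left₀ (abs_nonneg _) (hM x) 2
  have : ∀ x, (F x - c) ^ 2 = F x ^ 2 - 2 * c * F x + c ^ 2 := fun x => by ring
  simp_rw [this]
  have h3 : Integrable (fun x => F x ^ 2 - 2 * c * F x) μ := h2.sub (h1.const_mul _)
  rw [integral_add h3 (integrable_const _), integral_sub h2 (h1.const_mul _), integral_const_mul]
  simp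

lemma sq_bound {F M : ℝ} (h : |F| ≤ M) : |F ^ 2| ≤ M ^ 2 := by
  rw [abs_pow]; exact pow_le_pow_left₀ (abs_nonneg _) h 2

lemma abs_integral_le_of_abs_le {μ : Measure Ω} [IsProbabilityMeasure μ] {F : Ω → ℝ}
    {M : ℝ} (hM : ∀ x, |F x| ≤ M) : |∫ x, F x ∂μ| ≤ M := by
  simpa using norm_integral_le_of_norm_le_const (μ := μ) (f := F) (ae_of_all _ hM)

/-- Subadditivity of the variance over the two factors of a product of probability spaces. With
`F₁, F₂` the partial integrals and `c` the mean, Jensen's inequality bounds the variance of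
`F₁ - c = ∫ (F - F₂) dρ` by the second term. -/
lemma variance_prod_le (μ : Measure Ω) [IsProbabilityMeasure μ] (ρ : Measure Ω')
    [IsProbabilityMeasure ρ] {F : Ω × Ω' → ℝ} (hF : Measurable F) {M : ℝ} (hM : ∀ x, |F x| ≤ M) :
    ∫ p, (F p - ∫ q, F q ∂(μ.prod ρ)) ^ 2 ∂(μ.prod ρ)
      ≤ (∫ x, ∫ y, (F (x, y) - ∫ y', F (x, y') ∂ρ) ^ 2 ∂ρ ∂μ)
        + ∫ y, ∫ x, (F (x, y) - ∫ x', F (x', y) ∂μ) ^ 2 ∂μ ∂ρ := by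
  set c := ∫ q, F q ∂(μ.prod ρ) with hc
  set F1 : Ω → ℝ := fun x => ∫ y, F (x, y) ∂ρ with hF1
  set F2 : Ω' → ℝ := fun y => ∫ x, F (x, y) ∂μ with hF2
  have mF1 : Measurable F1 := (hF.stronglyMeasurable.integral_prod_right' (ν := ρ)).measurable
  have mF2 : Measurable F2 := (hF.stronglyMeasurable.integral_prod_left' (μ := μ)).measurable
  have bF1 : ∀ x, |F1 x| ≤ M := fun x => abs_integral_le_of_abs_le fun y => hM _
  have bF2 : ∀ y, |F2 y| ≤ M := fun x => abs_integral_le_of_abs_le fun y => hM _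
  have iF : Integrable F (μ.prod ρ) := integrable_of_abs_le hF hM
  have iFsq : Integrable (fun p => F p ^ 2) (μ.prod ρ) :=
    integrable_of_abs_le (hF.pow_const 2) fun p => sq_bound (hM p)
  have iF1sq : Integrable (fun x => F1 x ^ 2) μ :=
    integrable_of_abs_le (mF1.pow_const 2) fun p => sq_bound (bF1 p)
  have iF2sq : Integrable (fun x => F2 x ^ 2) ρ :=
    integrable_of_abs_le (mF2.pow_const 2) fun p => sq_bound (bF2 p)
  have c1 : ∫ x, F1 x ∂μ = c := (integral_prod _ iF).symm
  have c2 : ∫ y, F2 y ∂ρ = c := (integral_prod_symm _ iF).symm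
  have s1 : ∫ x, ∫ y, (F (x, y) - F1 x) ^ 2 ∂ρ ∂μ
      = (∫ p, F p ^ 2 ∂(μ.prod ρ)) - ∫ x, F1 x ^ 2 ∂μ := by
    rw [integral_prod _ iFsq, ← integral_sub iFsq.integral_prod_left iF1sq]
    congr 1 with x
    rw [variance_eq_sq_sub (F := fun y => F (x, y)) (hF.comp measurable_prodMk_left) (fun y => hM _)]
    simp only [hF1]; ring
  have s2 : ∫ y, ∫ x, (F (x, y) - F2 y) ^ 2 ∂μ ∂ρ
      = (∫ p, F p ^ 2 ∂(μ.prod ρ)) - ∫ x, F2 x ^ 2 ∂ρ := by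
    rw [integral_prod_symm _ iFsq, ← integral_sub iFsq.integral_prod_right iF2sq]
    congr 1 with y
    rw [variance_eq_sq_sub (F := fun x => F (x, y)) (hF.comp measurable_prodMk_right) (fun y => hM _)]
    simp only [hF2]; ring
  rw [s1, s2, variance_eq_sq_sub hF hM, ← hc]
  rw [← s2]
  have iG : Integrable (fun p : Ω × Ω' => (F p - F2 p.2) ^ 2) (μ.prod ρ) :=
    integrable_of_abs_le (by fun_prop)
      fun p => sq_bound ((abs_sub _ _).trans (add_le_add (hM p) (bF2 p.2)))
  have h1 : ∫ x, (F1 x - c) ^ 2 ∂μ ≤ ∫ y, ∫ x, (F (x, y) - F2 y) ^ 2 ∂μ ∂ρ := by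
    rw [← integral_prod_symm _ iG, integral_prod _ iG]
    refine integral_mono_of_nonneg (ae_of_all _ fun x => sq_nonneg _) iG.integral_prod_left
      (ae_of_all _ fun x => ?_)
    have hGm : Measurable fun y => F (x, y) - F2 y :=
      (hF.comp measurable_prodMk_left).sub mF2
    have := variance_eq_sq_sub (μ := ρ) hGm (M := M + M)
      (fun y => (abs_sub _ _).trans (add_le_add (hM _) (bF2 y))) (F1 x - c)
    have hmean : ∫ y, (F (x, y) - F2 y) ∂ρ = F1 x - c := by
      rw [integral_sub (integrable_of_abs_le (F := fun y => F (x, y))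
        (hF.comp measurable_prodMk_left) fun y => hM _)
        (integrable_of_abs_le mF2 bF2), c2]
    rw [hmean] at this
    have h0 : 0 ≤ ∫ y, (F (x, y) - F2 y - (F1 x - c)) ^ 2 ∂ρ := integral_nonneg fun y => sq_nonneg _
    simp only
    nlinarith
  rw [variance_eq_sq_sub mF1 bF1, c1] at h1
  nlinarith

/-- The mean is the best constant approximation in mean square. -/
lemma variance_le_sq_sub {μ : Measure Ω} [IsProbabilityMeasure μ] {F : Ω → ℝ}
    (hF : Measurable F) {M : ℝ} (hM : ∀ x, |F x| ≤ M) (c : ℝ) :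
    ∫ x, (F x - ∫ y, F y ∂μ) ^ 2 ∂μ ≤ ∫ x, (F x - c) ^ 2 ∂μ := by
  rw [variance_eq_sq_sub hF hM, variance_eq_sq_sub hF hM]
  nlinarith [sq_nonneg ((∫ y, F y ∂μ) - c)]

lemma measurePreserving_cons (μ : Measure α) [IsProbabilityMeasure μ] (n : ℕ) :
    MeasurePreserving (fun p : α × (Fin n → α) => (Fin.cons p.1 p.2 : Fin (n + 1) → α))
      (μ.prod (Measure.pi fun _ => μ)) (Measure.pi fun _ => μ) := by
  have h := (measurePreserving_piFinSuccAbove (fun _ : Fin (n + 1) => μ) 0).symm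
  have e : (fun p : α × (Fin n → α) => (Fin.cons p.1 p.2 : Fin (n + 1) → α))
      = (MeasurableEquiv.piFinSuccAbove (fun _ : Fin (n + 1) => α) 0).symm := by
    ext p j
    simp [MeasurableEquiv.piFinSuccAbove]
  rw [e]; exact h

/-- The **Efron–Stein inequality** for a bounded function of independent identically distributed
points: in place of an independent copy, each point is replaced by a fixed point `x₀`. -/
lemma efronStein_pi (μ : Measure α) [IsProbabilityMeasure μ] (x₀ : α) (n : ℕ)
    {F : (Fin n → α) → ℝ} (hF : Measurable F) {M : ℝ} (hM : ∀ x, |F x| ≤ M) :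
    ∫ x, (F x - ∫ y, F y ∂(Measure.pi fun _ => μ)) ^ 2 ∂(Measure.pi fun _ => μ)
      ≤ ∑ i, ∫ x, (F x - F (Function.update x i x₀)) ^ 2 ∂(Measure.pi fun _ => μ) := by
  induction n with
  | zero =>
    have : ∀ x, F x = ∫ y, F y ∂(Measure.pi fun _ : Fin 0 => μ) := fun x => by
      rw [show F = fun _ => F x from funext fun y => congrArg F (Subsingleton.elim _ _)]; simp
    have h0 : ∀ x, F x - ∫ y, F y ∂(Measure.pi fun _ : Fin 0 => μ) = 0 :=
      fun x => sub_eq_zero.2 (this x)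
    simp [h0]
  | succ n ih =>
    have hmp := measurePreserving_cons μ n
    have hint : ∀ {G : (Fin (n + 1) → α) → ℝ}, Measurable G →
        ∫ x, G x ∂(Measure.pi fun _ => μ)
          = ∫ p, G (Fin.cons p.1 p.2) ∂(μ.prod (Measure.pi fun _ => μ)) := fun {G} hG => by
      conv_lhs => rw [← hmp.map_eq]
      rw [integral_map hmp.measurable.aemeasurable hG.aestronglyMeasurable]
    have hFm : Measurable fun p : α × (Fin n → α) => F (Fin.cons p.1 p.2) := hF.comp hmp.measurable
    have hu : ∀ i : Fin (n + 1), Measurable fun x : Fin (n + 1) → α =>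
        (F x - F (Function.update x i x₀)) ^ 2 := fun i => by
      have : Measurable fun x : Fin (n + 1) → α => Function.update x i x₀ :=
        measurable_update_left
      exact (hF.sub (hF.comp this)).pow_const 2
    have hb : ∀ i x, |(F x - F (Function.update x i x₀)) ^ 2| ≤ (M + M) ^ 2 := fun i x =>
      sq_bound ((abs_sub _ _).trans (add_le_add (hM _) (hM _)))
    rw [hint hF, hint ((hF.sub_const _).pow_const 2)]
    refine (variance_prod_le μ (Measure.pi fun _ => μ) hFm fun p => hM _).trans ?_
    rw [Fin.sum_univ_succ, add_comm]
    refine add_le_add ?_ ?_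
    · rw [hint (hu 0), integral_prod_symm]
      · refine integral_mono_of_nonneg (ae_of_all _ fun y => integral_nonneg fun x => sq_nonneg _) ?_
          (ae_of_all _ fun y => ?_)
        · refine Integrable.integral_prod_right (f := fun p : α × (Fin n → α) =>
            (F (Fin.cons p.1 p.2) - F (Function.update (Fin.cons p.1 p.2 : Fin (n + 1) → α) 0 x₀)) ^ 2) ?_
          exact integrable_of_abs_le ((hu 0).comp hmp.measurable) fun p => hb 0 _
        · simp only [Fin.update_cons_zero]
          exact variance_le_sq_sub (hFm.comp measurable_prodMk_right) (fun p => hM _) _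
      · exact integrable_of_abs_le ((hu 0).comp hmp.measurable) fun p => hb 0 _
    · have : ∀ i : Fin n, ∫ x, (F x - F (Function.update x i.succ x₀)) ^ 2 ∂(Measure.pi fun _ => μ)
          = ∫ a, ∫ y, (F (Fin.cons a y) - F (Fin.cons a (Function.update y i x₀))) ^ 2
              ∂(Measure.pi fun _ => μ) ∂μ := fun i => by
        rw [hint (hu i.succ), integral_prod]
        · simp only [Fin.cons_update]
        · exact integrable_of_abs_le ((hu i.succ).comp hmp.measurable) fun p => hb _ _
      simp_rw [this]
      have hi : ∀ i : Fin n, Integrable (fun a => ∫ y,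
          (F (Fin.cons a y) - F (Fin.cons a (Function.update y i x₀))) ^ 2
            ∂(Measure.pi fun _ => μ)) μ := fun i => by
        refine Integrable.integral_prod_left (f := fun p : α × (Fin n → α) =>
            (F (Fin.cons p.1 p.2) - F (Fin.cons p.1 (Function.update p.2 i x₀))) ^ 2) ?_
        refine integrable_of_abs_le (M := (M + M) ^ 2) ?_ fun p => ?_
        · simp only [Fin.cons_update]; exact (hu i.succ).comp hmp.measurable
        · simp only [Fin.cons_update]; exact hb _ _
      rw [← integral_finsetSum _ fun i _ => hi i]
      refine integral_mono_of_nonneg (ae_of_all _ fun y => integral_nonneg fun x => sq_nonneg _)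
        (integrable_finsetSum _ fun i _ => hi i) (ae_of_all _ fun a => ?_)
      exact ih (hFm.comp measurable_prodMk_left) fun p => hM _

/-- The Efron–Stein inequality for a bounded function of two independent samples. -/
lemma efronStein_prod (μ : Measure α) [IsProbabilityMeasure μ] (ρ : Measure β)
    [IsProbabilityMeasure ρ] (x₀ : α) (y₀ : β) (n m : ℕ)
    {F : (Fin n → α) × (Fin m → β) → ℝ} (hF : Measurable F) {M : ℝ} (hM : ∀ p, |F p| ≤ M) :
    ∫ p, (F p - ∫ q, F q ∂((Measure.pi fun _ => μ).prod (Measure.pi fun _ => ρ))) ^ 2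
        ∂((Measure.pi fun _ => μ).prod (Measure.pi fun _ => ρ))
      ≤ (∑ i, ∫ p, (F p - F (Function.update p.1 i x₀, p.2)) ^ 2
          ∂((Measure.pi fun _ => μ).prod (Measure.pi fun _ => ρ)))
        + ∑ j, ∫ p, (F p - F (p.1, Function.update p.2 j y₀)) ^ 2
          ∂((Measure.pi fun _ => μ).prod (Measure.pi fun _ => ρ)) := by
  have i1 : ∀ i, Integrable (fun p => (F p - F (Function.update p.1 i x₀, p.2)) ^ 2)
      ((Measure.pi fun _ => μ).prod (Measure.pi fun _ => ρ)) := fun i => by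
    have hu : Measurable fun p : (Fin n → α) × (Fin m → β) => (Function.update p.1 i x₀, p.2) :=
      (measurable_update_left.comp measurable_fst).prodMk measurable_snd
    exact integrable_of_abs_le ((hF.sub (hF.comp hu)).pow_const 2)
      fun p => sq_bound ((abs_sub _ _).trans (add_le_add (hM _) (hM _)))
  have i2 : ∀ j, Integrable (fun p => (F p - F (p.1, Function.update p.2 j y₀)) ^ 2)
      ((Measure.pi fun _ => μ).prod (Measure.pi fun _ => ρ)) := fun i => by
    have hu : Measurable fun p : (Fin n → α) × (Fin m → β) => (p.1, Function.update p.2 i y₀) :=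
      measurable_fst.prodMk (measurable_update_left.comp measurable_snd)
    exact integrable_of_abs_le ((hF.sub (hF.comp hu)).pow_const 2)
      fun p => sq_bound ((abs_sub _ _).trans (add_le_add (hM _) (hM _)))
  refine (variance_prod_le _ _ hF hM).trans ?_
  rw [add_comm]
  refine add_le_add ?_ ?_
  · simp_rw [fun i => integral_prod_symm _ (i1 i)]
    rw [← integral_finsetSum _ fun i _ => (i1 i).integral_prod_right]
    refine integral_mono_of_nonneg (ae_of_all _ fun y => integral_nonneg fun x => sq_nonneg _)
      (integrable_finsetSum _ fun i _ => (i1 i).integral_prod_right) (ae_of_all _ fun y => ?_)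
    exact efronStein_pi μ x₀ n (hF.comp measurable_prodMk_right) fun p => hM _
  · simp_rw [fun i => integral_prod _ (i2 i)]
    rw [← integral_finsetSum _ fun i _ => (i2 i).integral_prod_left]
    refine integral_mono_of_nonneg (ae_of_all _ fun y => integral_nonneg fun x => sq_nonneg _)
      (integrable_finsetSum _ fun i _ => (i2 i).integral_prod_left) (ae_of_all _ fun y => ?_)
    exact efronStein_pi ρ y₀ m (hF.comp measurable_prodMk_left) fun p => hM _

/-! ### Sums over a sample -/

lemma integral_sum_sample (μ : Measure α) [IsProbabilityMeasure μ] {n : ℕ} (S : Finset (Fin n))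
    {k : α → ℝ} (hk : Measurable k) {M : ℝ} (hM : ∀ x, |k x| ≤ M) :
    ∫ x : Fin n → α, ∑ j ∈ S, k (x j) ∂(Measure.pi fun _ => μ) = S.card * ∫ z, k z ∂μ := by
  rw [integral_finsetSum _ fun j _ => integrable_of_abs_le (by fun_prop) fun x => hM _]
  have : ∀ j : Fin n, ∫ x : Fin n → α, k (x j) ∂(Measure.pi fun _ => μ) = ∫ z, k z ∂μ := fun j => by
    rw [← (measurePreserving_eval (fun _ : Fin n => μ) j).map_eq,
      integral_map (measurable_pi_apply j).aemeasurable hk.aestronglyMeasurable,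
      (measurePreserving_eval (fun _ : Fin n => μ) j).map_eq]
  simp [this]

open ProbabilityTheory in
/-- The variance of a sum over a sample is at most the sum of the second moments. -/
lemma integral_sum_sub_sq_le (μ : Measure α) [IsProbabilityMeasure μ] {n : ℕ} (S : Finset (Fin n))
    {k : α → ℝ} (hk : Measurable k) {M : ℝ} (hM : ∀ x, |k x| ≤ M) :
    ∫ x : Fin n → α, ((∑ j ∈ S, k (x j)) - S.card * ∫ z, k z ∂μ) ^ 2 ∂(Measure.pi fun _ => μ)
      ≤ S.card * ∫ z, k z ^ 2 ∂μ := by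
  classical
  have hX : ∀ j : Fin n, MemLp (fun z => if j ∈ S then k z else 0) 2 μ := fun j =>
    MemLp.of_bound (by split_ifs <;> fun_prop) (max M 0) (ae_of_all _ fun z => by
      split_ifs
      · exact (hM z).trans (le_max_left _ _)
      · simp)
  have hmean := integral_sum_sample μ S hk hM
  have hv := variance_sum_pi (μ := fun _ : Fin n => μ) hX
  have he : (∑ j : Fin n, fun x : Fin n → α => if j ∈ S then k (x j) else 0)
      = fun x => ∑ j ∈ S, k (x j) := by
    ext x; simp
  have hm : Measurable fun x : Fin n → α => ∑ j ∈ S, k (x j) := by fun_prop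
  rw [he, variance_eq_integral hm.aemeasurable, hmean] at hv
  rw [hv]
  calc ∑ j, Var[fun z => if j ∈ S then k z else 0; μ]
      ≤ ∑ j, if j ∈ S then ∫ z, k z ^ 2 ∂μ else 0 := by
        refine Finset.sum_le_sum fun j _ => ?_
        by_cases hj : j ∈ S
        · simp only [hj, if_true]
          exact variance_le_expectation_sq hk.aestronglyMeasurable
        · simp only [hj, if_false]
          exact (variance_zero μ).le
    _ = _ := by simp

lemma integral_sum_sq_le (μ : Measure α) [IsProbabilityMeasure μ] {n : ℕ} (S : Finset (Fin n))
    {k : α → ℝ} (hk : Measurable k) {M : ℝ} (hM : ∀ x, |k x| ≤ M) :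
    ∫ x : Fin n → α, (∑ j ∈ S, k (x j)) ^ 2 ∂(Measure.pi fun _ => μ)
      ≤ S.card * (∫ z, k z ^ 2 ∂μ) + (S.card * ∫ z, k z ∂μ) ^ 2 := by
  have h := integral_sum_sub_sq_le μ S hk hM
  have hm : Measurable fun x : Fin n → α => ∑ j ∈ S, k (x j) := by fun_prop
  have hb : ∀ x : Fin n → α, |∑ j ∈ S, k (x j)| ≤ S.card * M := fun x =>
    (Finset.abs_sum_le_sum_abs _ _).trans ((Finset.sum_le_sum fun j _ => hM (x j)).trans (by simp))
  have hmean := integral_sum_sample μ S hk hM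
  rw [variance_eq_sq_sub hm hb, hmean] at h
  nlinarith

end Probability

/-! ### Mean integrated squared error of the density estimates -/

/-- The kernel rescaled to the bandwidth `h`. -/
noncomputable def scaledKernel {d : ℕ} (K : Euc d → ℝ) (h : ℝ) (u : Euc d) : ℝ :=
  (h ^ d)⁻¹ * K (h⁻¹ • u)

section ScaledKernel
variable {d : ℕ} {K : Euc d → ℝ} {h : ℝ}

lemma kde_eq_scaledKernel {n : ℕ} (S : Finset (Fin n)) (x : Fin n → Euc d) (t : Euc d) :
    kde K h S x t = (S.card : ℝ)⁻¹ * ∑ j ∈ S, scaledKernel K h (t - x j) := by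
  simp only [kde, scaledKernel, ← Finset.mul_sum]
  rw [one_div, mul_inv, mul_assoc]

@[fun_prop]
lemma measurable_scaledKernel (hK : Measurable K) : Measurable (scaledKernel K h) := by
  unfold scaledKernel; fun_prop

lemma abs_scaledKernel_le {M : ℝ} (hM : ∀ u, |K u| ≤ M) (hh : 0 < h) (u : Euc d) :
    |scaledKernel K h u| ≤ M / h ^ d := by
  rw [scaledKernel, abs_mul, abs_of_pos (by positivity), div_eq_inv_mul]
  exact mul_le_mul_of_nonneg_left (hM _) (by positivity)

lemma integral_comp_scaled {E : Type*} [NormedAddCommGroup E] [NormedSpace ℝ E] (G : Euc d → E)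
    (hh : 0 < h) : ∫ u, (h ^ d)⁻¹ • G (h⁻¹ • u) = ∫ u, G u := by
  rw [integral_smul, Measure.integral_comp_inv_smul, finrank_euclideanSpace, Fintype.card_fin,
    abs_of_pos (by positivity), smul_smul, inv_mul_cancel₀ (by positivity), one_smul]

lemma integrable_scaledKernel (hK : Integrable K) (hh : 0 < h) : Integrable (scaledKernel K h) :=
  (hK.comp_smul (inv_ne_zero hh.ne')).const_mul _

lemma integral_abs_scaledKernel (hh : 0 < h) :
    ∫ u, |scaledKernel K h u| = ∫ u, |K u| := by
  rw [← integral_comp_scaled (fun u => |K u|) hh]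
  congr 1 with u
  rw [scaledKernel, abs_mul, abs_of_pos (by positivity), smul_eq_mul]

lemma integral_abs_scaledKernel_sub_right (hh : 0 < h) (x : Euc d) :
    ∫ t, |scaledKernel K h (t - x)| = ∫ u, |K u| := by
  rw [integral_sub_right_eq_self (fun t => |scaledKernel K h t|), integral_abs_scaledKernel hh]

lemma integral_abs_scaledKernel_sub_left (hh : 0 < h) (t : Euc d) :
    ∫ x, |scaledKernel K h (t - x)| = ∫ u, |K u| := by
  rw [integral_sub_left_eq_self (fun t => |scaledKernel K h t|), integral_abs_scaledKernel hh]

lemma integrable_scaledKernel_sub_right (hK : Integrable K) (hh : 0 < h) (x : Euc d) :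
    Integrable fun t => scaledKernel K h (t - x) :=
  (integrable_scaledKernel hK hh).comp_sub_right x

lemma integrable_scaledKernel_sub_left (hK : Integrable K) (hh : 0 < h) (t : Euc d) :
    Integrable fun x => scaledKernel K h (t - x) :=
  (integrable_scaledKernel hK hh).comp_sub_left t

lemma integral_scaledKernel_mul (hh : 0 < h) (f : Euc d → ℝ) (t : Euc d) :
    ∫ x, scaledKernel K h (t - x) * f x = ∫ u, K u * f (t - h • u) := by
  rw [← integral_comp_scaled (fun u => K u * f (t - h • u)) hh,
    ← integral_sub_left_eq_self (fun u => (h ^ d)⁻¹ • (K (h⁻¹ • u) * f (t - h • h⁻¹ • u))) _ t]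
  congr 1 with x
  rw [scaledKernel, smul_inv_smul₀ hh.ne', sub_sub_cancel, smul_eq_mul, mul_assoc]

end ScaledKernel

section Law
variable {d : ℕ} {f : Euc d → ℝ}

lemma IsDensity.isProbabilityMeasure (hf : IsDensity f) : IsProbabilityMeasure (lawOf f) := by
  refine ⟨?_⟩
  rw [lawOf, withDensity_apply _ MeasurableSet.univ, Measure.restrict_univ,
    ← ofReal_integral_eq_lintegral_ofReal hf.integrable (ae_of_all _ hf.nonneg),
    hf.integral_eq_one, ENNReal.ofReal_one]

lemma IsDensity.integral_lawOf (hf : IsDensity f) (k : Euc d → ℝ) :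
    ∫ z, k z ∂(lawOf f) = ∫ z, k z * f z := by
  have h : lawOf f = volume.withDensity fun x => ((f x).toNNReal : ℝ≥0∞) := rfl
  rw [h, integral_withDensity_eq_integral_smul hf.measurable.real_toNNReal]
  congr 1 with z
  rw [NNReal.smul_def, Real.coe_toNNReal _ (hf.nonneg z), smul_eq_mul, mul_comm]

lemma lawOf_absolutelyContinuous : lawOf f ≪ volume := withDensity_absolutelyContinuous _ _

lemma IsDensity.integral_lawOf_le (hf : IsDensity f) {B : ℝ} (hB : ∀ x, f x ≤ B) {k : Euc d → ℝ}
    (hk0 : ∀ x, 0 ≤ k x) (hk : Integrable k) : ∫ z, k z ∂(lawOf f) ≤ B * ∫ z, k z := by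
  rw [hf.integral_lawOf, ← integral_const_mul]
  refine integral_mono_of_nonneg (ae_of_all _ fun z => mul_nonneg (hk0 z) (hf.nonneg z))
    (hk.const_mul B) (ae_of_all _ fun z => ?_)
  simp only
  rw [mul_comm]
  exact mul_le_mul_of_nonneg_right (hB z) (hk0 z)

/-- A sum over a sample of a nonnegative function with small integral and not too large values:
its second moment is bounded in terms of the integral and the supremum. -/
lemma IsDensity.integral_sum_sq_le (hf : IsDensity f) {B : ℝ} (hB : ∀ x, f x ≤ B)
    (hB0 : 0 ≤ B) {k : Euc d → ℝ} (hk : Measurable k)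
    (hk0 : ∀ x, 0 ≤ k x) {M I : ℝ} (hM : ∀ x, k x ≤ M) (hki : Integrable k) (hI : ∫ z, k z ≤ I)
    {n : ℕ} (S : Finset (Fin n)) :
    ∫ x : Fin n → Euc d, (∑ j ∈ S, k (x j)) ^ 2 ∂(Measure.pi fun _ => lawOf f)
      ≤ n * (M * (B * I)) + (n * (B * I)) ^ 2 := by
  have := hf.isProbabilityMeasure
  have hab : ∀ x, |k x| ≤ M := fun x => by rw [abs_of_nonneg (hk0 x)]; exact hM x
  have hM0 : 0 ≤ M := (hk0 0).trans (hM 0)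
  have hcard : (S.card : ℝ) ≤ n := by
    exact_mod_cast (Finset.card_le_univ S).trans (by simp)
  have h1 : ∫ z, k z ∂(lawOf f) ≤ B * I :=
    (hf.integral_lawOf_le hB hk0 hki).trans (mul_le_mul_of_nonneg_left hI hB0)
  have h10 : 0 ≤ ∫ z, k z ∂(lawOf f) := integral_nonneg hk0
  have h2 : ∫ z, k z ^ 2 ∂(lawOf f) ≤ M * (B * I) := by
    refine le_trans ?_ (mul_le_mul_of_nonneg_left h1 hM0)
    rw [← integral_const_mul]
    refine integral_mono (integrable_of_abs_le (hk.pow_const 2) fun x => sq_bound (hab x))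
      ((integrable_of_abs_le hk hab).const_mul _) fun z => ?_
    simp only [pow_two]
    exact mul_le_mul_of_nonneg_right (hM z) (hk0 z)
  have h20 : 0 ≤ ∫ z, k z ^ 2 ∂(lawOf f) := integral_nonneg fun z => sq_nonneg _
  refine (_root_.integral_sum_sq_le (lawOf f) S hk hab).trans ?_
  gcongr

end Law

section KDE
variable {d : ℕ} {s : ℝ} {K : Euc d → ℝ} {f : Euc d → ℝ}

/-- Bias and variance of a kernel density estimate at a point. -/
lemma integral_kde_sub_sq_le (hK : IsSmoothingKernel s K) (hs : 0 < s) {L : ℝ} (hL : 0 ≤ L)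
    (hf : IsDensity f) (hfH : IsHolder s L f) {B : ℝ} (hB : ∀ x, f x ≤ B)
    {M : ℝ} (hM : ∀ u, |K u| ≤ M) {h : ℝ} (hh : 0 < h) {n : ℕ} (S : Finset (Fin n))
    (hS : 0 < S.card) (t : Euc d) :
    ∫ x : Fin n → Euc d, (kde K h S x t - f t) ^ 2 ∂(Measure.pi fun _ => lawOf f)
      ≤ 2 * ((M * (B * ∫ u, |K u|)) / (S.card * h ^ d))
        + 2 * (((d : ℝ) ^ holderOrder s * L * ∫ u, ‖u‖ ^ s * |K u|) * h ^ s) ^ 2 := by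
  have := hf.isProbabilityMeasure
  have hKm := hK.measurable
  have hfB : ∀ x, |f x| ≤ B := fun x => by rw [abs_of_nonneg (hf.nonneg x)]; exact hB x
  set k : Euc d → ℝ := fun z => scaledKernel K h (t - z) with hk
  have hkm : Measurable k := by
    have := measurable_scaledKernel (h := h) hKm
    fun_prop
  have hkM : ∀ z, |k z| ≤ M / h ^ d := fun z => abs_scaledKernel_le hM hh _
  have hki : Integrable k := integrable_scaledKernel_sub_left hK.integrable hh t
  set m := ∫ z, k z ∂(lawOf f) with hm
  have hmb : |m - f t| ≤ ((d : ℝ) ^ holderOrder s * L * ∫ u, ‖u‖ ^ s * |K u|) * h ^ s := by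
    rw [hm, hf.integral_lawOf, integral_scaledKernel_mul hh]
    exact hK.bias_le hs hL hfH hf.measurable hfB hh.le t
  have hS' : (0 : ℝ) < S.card := by exact_mod_cast hS
  have hM0 : 0 ≤ M := (abs_nonneg _).trans (hM 0)
  have hk2 : ∫ z, k z ^ 2 ∂(lawOf f) ≤ M / h ^ d * (B * ∫ u, |K u|) := by
    calc ∫ z, k z ^ 2 ∂(lawOf f) ≤ ∫ z, M / h ^ d * |k z| ∂(lawOf f) := by
          refine integral_mono (integrable_of_abs_le (hkm.pow_const 2) fun x => sq_bound (hkM x))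
            ((integrable_of_abs_le hkm hkM).abs.const_mul _) fun z => ?_
          simp only
          rw [← sq_abs, pow_two]
          exact mul_le_mul_of_nonneg_right (hkM z) (abs_nonneg _)
      _ ≤ M / h ^ d * (B * ∫ u, |K u|) := by
          rw [integral_const_mul]
          refine mul_le_mul_of_nonneg_left ?_ (by positivity)
          refine (hf.integral_lawOf_le hB (fun _ => abs_nonneg _) hki.abs).trans (le_of_eq ?_)
          rw [hk, integral_abs_scaledKernel_sub_left hh t]
  have hv := integral_sum_sub_sq_le (lawOf f) S hkm hkM
  have hsm : Measurable fun x : Fin n → Euc d => ∑ j ∈ S, k (x j) := by fun_prop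
  have hsb : ∀ x : Fin n → Euc d, |∑ j ∈ S, k (x j)| ≤ S.card * (M / h ^ d) := fun x =>
    (Finset.abs_sum_le_sum_abs _ _).trans ((Finset.sum_le_sum fun j _ => hkM (x j)).trans (by simp))
  have hi1 : Integrable (fun x : Fin n → Euc d => ((∑ j ∈ S, k (x j)) - S.card * m) ^ 2)
      (Measure.pi fun _ => lawOf f) :=
    integrable_of_abs_le ((hsm.sub_const _).pow_const 2)
      fun x => sq_bound ((abs_sub _ _).trans (add_le_add (hsb x) le_rfl))
  calc ∫ x : Fin n → Euc d, (kde K h S x t - f t) ^ 2 ∂(Measure.pi fun _ => lawOf f)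
      ≤ ∫ x : Fin n → Euc d, (2 * ((S.card : ℝ) ^ 2)⁻¹ * ((∑ j ∈ S, k (x j)) - S.card * m) ^ 2
          + 2 * (m - f t) ^ 2) ∂(Measure.pi fun _ => lawOf f) := by
        refine integral_mono_of_nonneg (ae_of_all _ fun x => sq_nonneg _)
          ((hi1.const_mul _).add (integrable_const _)) (ae_of_all _ fun x => ?_)
        simp only
        have : kde K h S x t - f t = (S.card : ℝ)⁻¹ * ((∑ j ∈ S, k (x j)) - S.card * m)
            + (m - f t) := by
          rw [kde_eq_scaledKernel]; field_simp; ring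
        rw [this]
        refine (add_sq_le).trans (le_of_eq ?_)
        rw [mul_pow, inv_pow]; ring
    _ = 2 * ((S.card : ℝ) ^ 2)⁻¹ * (∫ x : Fin n → Euc d, ((∑ j ∈ S, k (x j)) - S.card * m) ^ 2
          ∂(Measure.pi fun _ => lawOf f)) + 2 * (m - f t) ^ 2 := by
        rw [integral_add (hi1.const_mul _) (integrable_const _), integral_const_mul]
        simp
    _ ≤ 2 * ((S.card : ℝ) ^ 2)⁻¹ * (S.card * (M / h ^ d * (B * ∫ u, |K u|)))
        + 2 * (((d : ℝ) ^ holderOrder s * L * ∫ u, ‖u‖ ^ s * |K u|) * h ^ s) ^ 2 := by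
        refine add_le_add ?_ ?_
        · refine mul_le_mul_of_nonneg_left (hv.trans ?_) (by positivity)
          exact mul_le_mul_of_nonneg_left hk2 hS'.le
        · refine mul_le_mul_of_nonneg_left ?_ (by norm_num)
          exact sq_le_sq' (by linarith [(abs_le.1 hmb).1]) ((abs_le.1 hmb).2)
    _ = _ := by
        congr 1
        field_simp

lemma measurable_kde {n : ℕ} (hK : Measurable K) (h : ℝ) (S : Finset (Fin n)) :
    Measurable fun p : (Fin n → Euc d) × Euc d => kde K h S p.1 p.2 := by
  unfold kde; fun_prop

lemma abs_kde_le {n : ℕ} {M : ℝ} (hM : ∀ u, |K u| ≤ M) {h : ℝ} (hh : 0 < h) (S : Finset (Fin n))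
    (x : Fin n → Euc d) (t : Euc d) : |kde K h S x t| ≤ M / h ^ d := by
  have hM0 : 0 ≤ M / h ^ d := (abs_nonneg _).trans (abs_scaledKernel_le hM hh 0)
  rw [kde_eq_scaledKernel, abs_mul, abs_of_nonneg (by positivity)]
  rcases S.eq_empty_or_nonempty with rfl | hS
  · simpa using hM0
  · have hc : (0 : ℝ) < S.card := by exact_mod_cast hS.card_pos
    rw [inv_mul_le_iff₀ hc]
    refine (Finset.abs_sum_le_sum_abs _ _).trans
      ((Finset.sum_le_sum fun j _ => abs_scaledKernel_le hM hh _).trans (by simp))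

end KDE

section Clip
variable (k : EstimatorKind) {B' B : ℝ}

lemma EstimatorKind.clip_mem (hB : B' ≤ B) (y : ℝ) : k.clip B' B y ∈ k.range B' B := by
  cases k
  · trivial
  · exact ⟨le_max_left _ _, max_le hB (min_le_left _ _)⟩

lemma EstimatorKind.clip_of_mem {y : ℝ} (hy : y ∈ k.range B' B) : k.clip B' B y = y := by
  cases k
  · rfl
  · simp only [clip, min_eq_right hy.2, max_eq_right hy.1]

lemma EstimatorKind.abs_clip_sub_le (y z : ℝ) : |k.clip B' B y - k.clip B' B z| ≤ |y - z| := by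
  cases k
  · exact le_rfl
  · simp only [clip]
    refine (abs_max_sub_max_le_max _ _ _ _).trans (max_le (by simp) ?_)
    exact (abs_min_sub_min_le_max B y B z).trans (max_le (by simp) le_rfl)

lemma EstimatorKind.abs_clip_le (y : ℝ) : |k.clip B' B y| ≤ |B'| + |B| + |y| := by
  cases k
  · simp only [clip]; linarith [abs_nonneg B, abs_nonneg B']
  · simp only [clip]
    rcases max_choice B' (min B y) with h | h <;> rw [h]
    · linarith [abs_nonneg B, abs_nonneg y]
    · rcases min_choice B y with h | h <;> rw [h] <;>
      linarith [abs_nonneg B, abs_nonneg y, abs_nonneg B']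

@[fun_prop]
lemma EstimatorKind.continuous_clip : Continuous (k.clip B' B) := by
  cases k
  · exact continuous_id
  · unfold clip; fun_prop

lemma EstimatorKind.convex_range : Convex ℝ (k.range B' B) := by
  cases k
  · exact convex_univ
  · exact convex_Icc _ _

end Clip

section LooDensity
variable {d n : ℕ} {s : ℝ} {K : Euc d → ℝ} {f : Euc d → ℝ} (k : EstimatorKind) {B' B : ℝ}
  {h : ℕ → ℝ}

lemma measurable_looDensity (hK : Measurable K) (i : Fin n) :
    Measurable fun p : (Fin n → Euc d) × Euc d => looDensity k B' B K h p.1 i p.2 :=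
  k.continuous_clip.measurable.comp (measurable_kde hK _ _)

lemma abs_looDensity_le {M : ℝ} (hM : ∀ u, |K u| ≤ M) (hh : ∀ n, 0 < h n) (x : Fin n → Euc d)
    (i : Fin n) (t : Euc d) :
    |looDensity k B' B K h x i t| ≤ |B'| + |B| + M / h (n - 1) ^ d :=
  (k.abs_clip_le _).trans (add_le_add le_rfl (abs_kde_le hM (hh _) _ _ _))

lemma isAdmissible_looDensity (hB : B' ≤ B) (X : Set (Euc d)) (hK : Measurable K) {M : ℝ}
    (hM : ∀ u, |K u| ≤ M) (hh : ∀ n, 0 < h n) (x : Fin n → Euc d) (i : Fin n) :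
    IsAdmissible X (k.range B' B) (looDensity k B' B K h x i) where
  measurable := by
    have := measurable_looDensity (n := n) (h := h) (B' := B') (B := B) k hK i
    exact this.comp (g := fun p : (Fin n → Euc d) × Euc d => looDensity k B' B K h p.1 i p.2)
      (f := fun t => (x, t)) (by fun_prop)
  mem := fun _ _ => k.clip_mem hB _
  bounded := ⟨_, fun t _ => abs_looDensity_le k hM hh x i t⟩

lemma IsBoundedHolderDensity.mem_range {X : Set (Euc d)} {L : ℝ}
    (hf : IsBoundedHolderDensity X s L B' B f) {x : Euc d} (hx : x ∈ X) : f x ∈ k.range B' B := by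
  cases k
  · trivial
  · exact ⟨(hf.lower x hx).le, (hf.upper x).le⟩

lemma IsBoundedHolderDensity.isAdmissible {X : Set (Euc d)} {L : ℝ}
    (hf : IsBoundedHolderDensity X s L B' B f) : IsAdmissible X (k.range B' B) f where
  measurable := hf.density.measurable
  mem := fun _ hx => hf.mem_range k hx
  bounded := ⟨B, fun x _ => by rw [abs_of_nonneg (hf.density.nonneg x)]; exact (hf.upper x).le⟩

lemma IsBoundedHolderDensity.pos {X : Set (Euc d)} {L : ℝ}
    (hf : IsBoundedHolderDensity X s L B' B f) : 0 < B :=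
  (hf.density.nonneg 0).trans_lt (hf.upper 0)

lemma integrable_sq_looDensity_sub {X : Set (Euc d)} {L : ℝ} (hX : IsCompact X)
    (hf : IsBoundedHolderDensity X s L B' B f) (hK : Measurable K) {M : ℝ}
    (hM : ∀ u, |K u| ≤ M) (hh : ∀ n, 0 < h n) (i : Fin n) :
    Integrable (fun p : (Fin n → Euc d) × Euc d => (looDensity k B' B K h p.1 i p.2 - f p.2) ^ 2)
      ((Measure.pi fun _ => lawOf f).prod (volume.restrict X)) := by
  have := hf.density.isProbabilityMeasure
  have : IsFiniteMeasure ((volume : Measure (Euc d)).restrict X) :=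
    isFiniteMeasure_restrict.2 hX.measure_ne_top
  have hm := measurable_looDensity (h := h) (B' := B') (B := B) k hK i
  have hfm := hf.density.measurable
  refine integrable_of_abs_le (by fun_prop) fun p => sq_bound ((abs_sub _ _).trans
    (add_le_add (abs_looDensity_le k hM hh p.1 i p.2) (?_ : _ ≤ B)))
  rw [abs_of_nonneg (hf.density.nonneg _)]
  exact (hf.upper _).le

lemma integrable_sqDist_looDensity {X : Set (Euc d)} {L : ℝ} (hX : IsCompact X)
    (hf : IsBoundedHolderDensity X s L B' B f) (hK : Measurable K) {M : ℝ}
    (hM : ∀ u, |K u| ≤ M) (hh : ∀ n, 0 < h n) (i : Fin n) :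
    Integrable (fun x : Fin n → Euc d => sqDist X (looDensity k B' B K h x i) f)
      (Measure.pi fun _ => lawOf f) := by
  have := hf.density.isProbabilityMeasure
  have : IsFiniteMeasure ((volume : Measure (Euc d)).restrict X) :=
    isFiniteMeasure_restrict.2 hX.measure_ne_top
  exact (integrable_sq_looDensity_sub k hX hf hK hM hh i).integral_prod_left

/-- The mean integrated squared error on `X` of a leave-one-out density estimate. Truncation does
not increase the error, as the values of `f` on `X` are in the range of the truncation. -/
lemma integral_sqDist_looDensity_le {X : Set (Euc d)} {L : ℝ} (hX : IsCompact X)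
    (hK : IsSmoothingKernel s K) (hs : 0 < s) (hL : 0 ≤ L)
    (hf : IsBoundedHolderDensity X s L B' B f) {M : ℝ}
    (hM : ∀ u, |K u| ≤ M) (hh : ∀ n, 0 < h n) (hn : 2 ≤ n) (i : Fin n) :
    ∫ x : Fin n → Euc d, sqDist X (looDensity k B' B K h x i) f ∂(Measure.pi fun _ => lawOf f)
      ≤ (2 * ((M * (B * ∫ u, |K u|)) / ((n - 1 : ℕ) * h (n - 1) ^ d))
        + 2 * (((d : ℝ) ^ holderOrder s * L * ∫ u, ‖u‖ ^ s * |K u|) * h (n - 1) ^ s) ^ 2)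
        * volume.real X := by
  have := hf.density.isProbabilityMeasure
  have : IsFiniteMeasure ((volume : Measure (Euc d)).restrict X) :=
    isFiniteMeasure_restrict.2 hX.measure_ne_top
  have hi := integrable_sq_looDensity_sub k hX hf hK.measurable hM hh i
  have hcard : (Finset.univ.erase i).card = n - 1 := by simp
  unfold sqDist
  rw [← integral_prod _ hi, integral_prod_symm _ hi, mul_comm, ← smul_eq_mul,
    ← setIntegral_const]
  refine setIntegral_mono_on hi.integral_prod_right (integrable_const _) hX.measurableSet
    fun t ht => ?_
  refine le_trans ?_ ((integral_kde_sub_sq_le hK hs hL hf.density hf.holder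
    (fun x => (hf.upper x).le) hM (hh (n - 1)) (Finset.univ.erase i) (by omega) t).trans
    (le_of_eq (by rw [hcard])))
  have hm := (measurable_kde hK.measurable (h (n - 1)) (Finset.univ.erase i)).comp
    (measurable_prodMk_right (y := t))
  refine integral_mono_of_nonneg (ae_of_all _ fun x => sq_nonneg _) ?_ (ae_of_all _ fun x => ?_)
  · exact integrable_of_abs_le ((hm.sub_const _).pow_const 2) fun x => sq_bound ((abs_sub _ _).trans
      (add_le_add (abs_kde_le hM (hh _) _ _ _) le_rfl))
  · have := k.abs_clip_sub_le (B' := B') (B := B) (kde K (h (n - 1)) (Finset.univ.erase i) x t) (f t)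
    rw [k.clip_of_mem (hf.mem_range k ht)] at this
    exact sq_le_sq.2 this

end LooDensity

/-! ### Lipschitz extensions of the integrand, of the outer function and of their derivatives -/

section Smooth
variable {V : Type*} [NormedAddCommGroup V] [NormedSpace ℝ V] {F : V → ℝ} {D : Set V}

/-- A bounded second derivative makes the derivative Lipschitz and the first-order Taylor remainder
quadratic. -/
lemma IsLipschitzTwiceDiffOn.taylor (hF : IsLipschitzTwiceDiffOn F D) (hD : Convex ℝ D) :
    ∃ C : ℝ, 0 ≤ C ∧ ∀ z ∈ D, ∀ w ∈ D, ‖fderiv ℝ F w - fderiv ℝ F z‖ ≤ C * ‖w - z‖ ∧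
      |F w - F z - fderiv ℝ F z (w - z)| ≤ C * ‖w - z‖ ^ 2 := by
  obtain ⟨C, hC⟩ := hF.second_bounded
  have hC' : ∀ z ∈ D, ‖fderiv ℝ (fderiv ℝ F) z‖ ≤ max C 0 := fun z hz =>
    (hC z hz).trans (le_max_left _ _)
  have hlip : ∀ z ∈ D, ∀ w ∈ D, ‖fderiv ℝ F w - fderiv ℝ F z‖ ≤ max C 0 * ‖w - z‖ :=
    fun z hz w hw => hD.norm_image_sub_le_of_norm_hasFDerivWithin_le
      (fun x hx => (hF.twice_differentiable x hx).hasFDerivAt.hasFDerivWithinAt) hC' hz hw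
  refine ⟨max C 0, le_max_right _ _, fun z hz w hw => ⟨hlip z hz w hw, ?_⟩⟩
  have hseg : segment ℝ z w ⊆ D := hD.segment_subset hz hw
  have := (convex_segment z w).norm_image_sub_le_of_norm_hasFDerivWithin_le'
    (f := F) (f' := fderiv ℝ F) (φ := fderiv ℝ F z) (C := max C 0 * ‖w - z‖)
    (fun x hx => ((hF.differentiable x (hseg hx)).self_of_nhds).hasFDerivAt.hasFDerivWithinAt)
    (fun x hx => (hlip z hz x (hseg hx)).trans
      (mul_le_mul_of_nonneg_left (by
        rw [← dist_eq_norm, ← dist_eq_norm, dist_comm x, dist_comm w]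
        obtain ⟨θ, hθ, rfl⟩ := (segment_eq_image_lineMap ℝ z w) ▸ hx
        rw [dist_left_lineMap, Real.norm_of_nonneg hθ.1]
        exact mul_le_of_le_one_left dist_nonneg hθ.2) (le_max_right _ _)))
    (left_mem_segment ℝ z w) (right_mem_segment ℝ z w)
  rw [Real.norm_eq_abs] at this
  refine this.trans (le_of_eq (by ring))

/-- The Lipschitz constant bounds the derivative in the interior, hence on the whole convex set, in
whose closure the interior is dense. -/
lemma IsLipschitzTwiceDiffOn.fderiv_bounded (hF : IsLipschitzTwiceDiffOn F D) (hD : Convex ℝ D)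
    (hne : (interior D).Nonempty) : ∃ A : ℝ, ∀ z ∈ D, ‖fderiv ℝ F z‖ ≤ A := by
  obtain ⟨C, hC⟩ := hF.lipschitz
  refine ⟨C, fun z hz => ?_⟩
  have hz' : z ∈ closure (interior D) := by
    rw [hD.closure_interior_eq_closure_of_nonempty_interior hne]; exact subset_closure hz
  exact ContinuousWithinAt.closure_le hz'
    (hF.twice_differentiable z hz).continuousAt.continuousWithinAt.norm
    continuousWithinAt_const
    fun y hy => norm_fderiv_le_of_lipschitzOn ℝ (mem_interior_iff_mem_nhds.1 hy) hC

/-- Near a compact set on which it is twice differentiable, a function is differentiable with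
bounded derivative. -/
lemma IsLipschitzTwiceDiffOn.exists_thickening (hF : IsLipschitzTwiceDiffOn F D)
    (hD : IsCompact D) : ∃ ε > 0, ∃ C : ℝ, ∀ z ∈ D, ∀ w ∈ Metric.ball z ε,
      DifferentiableAt ℝ F w ∧ ‖fderiv ℝ F w‖ ≤ C := by
  have hloc : ∀ z ∈ D, ∀ᶠ w in 𝓝 z, DifferentiableAt ℝ F w ∧ ‖fderiv ℝ F w‖ ≤ ‖fderiv ℝ F z‖ + 1 := by
    intro z hz
    have := (hF.twice_differentiable z hz).continuousAt.norm
    exact (hF.differentiable z hz).and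
      ((this.eventually_lt_const (lt_add_one _)).mono fun w hw => hw.le)
  choose! r hr hr' using fun z hz => Metric.eventually_nhds_iff_ball.1 (hloc z hz)
  obtain ⟨T, hTD, hT⟩ := hD.elim_nhds_subcover (fun z => Metric.ball z (r z))
    (fun z hz => Metric.ball_mem_nhds z (hr z hz))
  obtain ⟨ε, hε, hεT⟩ := lebesgue_number_lemma_of_metric (c := fun z : T => Metric.ball (z : V) (r z)) hD
    (fun _ => Metric.isOpen_ball) (by
      intro x hx
      obtain ⟨z, hz, hxz⟩ := Set.mem_iUnion₂.1 (hT hx)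
      exact Set.mem_iUnion.2 ⟨⟨z, hz⟩, hxz⟩)
  refine ⟨ε, hε, ∑ z ∈ T, (‖fderiv ℝ F z‖ + 1), fun z hz w hw => ?_⟩
  obtain ⟨y, hy⟩ := hεT z hz
  obtain ⟨h1, h2⟩ := hr' y (hTD y y.2) w (hy hw)
  refine ⟨h1, h2.trans ?_⟩
  exact Finset.single_le_sum (f := fun z => ‖fderiv ℝ F z‖ + 1) (fun _ _ => by positivity) y.2

/-- A bounded Lipschitz function extends with the same bound and the same constant. -/
lemma exists_lipschitz_extension {α : Type*} [PseudoMetricSpace α] {f : α → ℝ} {D : Set α}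
    {C : ℝ≥0} (hf : LipschitzOnWith C f D) {A : ℝ} (hA : 0 ≤ A) (hfA : ∀ z ∈ D, |f z| ≤ A) :
    ∃ g : α → ℝ, LipschitzWith C g ∧ Set.EqOn f g D ∧ ∀ z, |g z| ≤ A := by
  obtain ⟨g, hg, hfg⟩ := hf.extend_real
  refine ⟨fun z => max (-A) (min A (g z)), ?_, fun z hz => ?_, fun z => abs_le.2
    ⟨le_max_left _ _, max_le (by linarith) (min_le_left _ _)⟩⟩
  · exact (hg.const_min A).const_max (-A)
  · have := abs_le.1 (hfA z hz)
    simp only [← hfg hz, min_eq_right this.2, max_eq_right this.1]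

end Smooth

/-- The functions from which `T(p, q)` and its influence functions are computed: the integrand `v`
with its partial derivatives `a`, `b`, and the outer function `ph` with its derivative `dph`. All of
them are defined and Lipschitz everywhere, with constant `A`, and the derivatives are bounded by `A`;
that `a`, `b`, `dph` are the derivatives is required separately, and only where it is true. -/
structure PlugIn (A : ℝ) where
  v : ℝ × ℝ → ℝ
  a : ℝ × ℝ → ℝ
  b : ℝ × ℝ → ℝ
  ph : ℝ → ℝ
  dph : ℝ → ℝ
  v_lip : ∀ z w, |v z - v w| ≤ A * (|z.1 - w.1| + |z.2 - w.2|)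
  a_lip : ∀ z w, |a z - a w| ≤ A * (|z.1 - w.1| + |z.2 - w.2|)
  b_lip : ∀ z w, |b z - b w| ≤ A * (|z.1 - w.1| + |z.2 - w.2|)
  a_le : ∀ z, |a z| ≤ A
  b_le : ∀ z, |b z| ≤ A
  ph_lip : ∀ r t, |ph r - ph t| ≤ A * |r - t|
  dph_lip : ∀ r t, |dph r - dph t| ≤ A * |r - t|
  dph_le : ∀ r, |dph r| ≤ A

/-- The second-order Taylor estimates for `v` on `R × R` and for `ph` on `J`. -/
structure PlugIn.HasTaylor {A : ℝ} (P : PlugIn A) (R J : Set ℝ) : Prop where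
  v_taylor : ∀ z ∈ R ×ˢ R, ∀ w ∈ R ×ˢ R,
    |P.v w - P.v z - P.a z * (w.1 - z.1) - P.b z * (w.2 - z.2)|
      ≤ A * (|w.1 - z.1| ^ 2 + |w.2 - z.2| ^ 2)
  ph_taylor : ∀ r ∈ J, ∀ t ∈ J, |P.ph t - P.ph r - P.dph r * (t - r)| ≤ A * |t - r| ^ 2

/-- `P` consists of `ν`, `φ` and their derivatives, restricted to `R × R` and to `J`. -/
structure PlugIn.Represents {A : ℝ} (P : PlugIn A) (ν : ℝ × ℝ → ℝ) (φ : ℝ → ℝ) (R J : Set ℝ) :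
    Prop where
  v_eq : ∀ z ∈ R ×ˢ R, P.v z = ν z
  a_eq : ∀ z ∈ R ×ˢ R, P.a z = fderiv ℝ ν z (1, 0)
  b_eq : ∀ z ∈ R ×ˢ R, P.b z = fderiv ℝ ν z (0, 1)
  ph_eq : ∀ r ∈ J, P.ph r = φ r
  dph_eq : ∀ r ∈ J, P.dph r = deriv φ r

/-- Interchanging the roles of the two arguments. -/
def PlugIn.swap {A : ℝ} (P : PlugIn A) : PlugIn A where
  v := P.v ∘ Prod.swap
  a := P.b ∘ Prod.swap
  b := P.a ∘ Prod.swap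
  ph := P.ph
  dph := P.dph
  v_lip z w := (P.v_lip _ _).trans (le_of_eq (by simp [add_comm]))
  a_lip z w := (P.b_lip _ _).trans (le_of_eq (by simp [add_comm]))
  b_lip z w := (P.a_lip _ _).trans (le_of_eq (by simp [add_comm]))
  a_le z := P.b_le _
  b_le z := P.a_le _
  ph_lip := P.ph_lip
  dph_lip := P.dph_lip
  dph_le := P.dph_le

lemma PlugIn.nonneg {A : ℝ} (P : PlugIn A) : 0 ≤ A := (abs_nonneg _).trans (P.dph_le 0)

section Range
variable {d : ℕ} {X : Set (Euc d)} {ν : ℝ × ℝ → ℝ} {φ : ℝ → ℝ} {R : Set ℝ}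

lemma ordConnected_integralRange (hR : Convex ℝ R) (hν : IsLipschitzTwiceDiffOn ν (R ×ˢ R)) :
    (integralRange X ν R).OrdConnected := by
  have hc : ContinuousOn (fun z => volume.real X * ν z) (R ×ˢ R) :=
    continuousOn_const.mul (hν.lipschitz.choose_spec.continuousOn)
  exact ((hR.prod hR).isPreconnected.image _ hc).ordConnected

/-- The mean of `ν(p, q)` over `X` lies between two of its values. If `X` is a null set, the integral
is zero, and so are all elements of `integralRange X ν R`. -/
lemma setIntegral_mem_integralRange (hX : IsCompact X) (hR : Convex ℝ R) (hRne : R.Nonempty)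
    (hν : IsLipschitzTwiceDiffOn ν (R ×ˢ R)) {p q : Euc d → ℝ}
    (hp : ∀ x ∈ X, p x ∈ R) (hq : ∀ x ∈ X, q x ∈ R)
    (hint : IntegrableOn (fun x => ν (p x, q x)) X) :
    ∫ x in X, ν (p x, q x) ∈ integralRange X ν R := by
  obtain ⟨r, hr⟩ := hRne
  rcases eq_or_ne (volume X) 0 with h0 | h0
  · refine ⟨(r, r), ⟨hr, hr⟩, ?_⟩
    simp only
    rw [setIntegral_measure_zero _ h0, measureReal_def, h0]; simp
  · have hpos : 0 < volume.real X := ENNReal.toReal_pos h0 hX.measure_ne_top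
    obtain ⟨x, hx, hx'⟩ := exists_le_setAverage h0 hX.measure_ne_top hint
    obtain ⟨y, hy, hy'⟩ := exists_setAverage_le h0 hX.measure_ne_top hint
    rw [setAverage_eq, smul_eq_mul, le_inv_mul_iff₀ hpos] at hx'
    rw [setAverage_eq, smul_eq_mul, inv_mul_le_iff₀ hpos] at hy'
    exact (ordConnected_integralRange (X := X) hR hν).out
      ⟨_, ⟨hp x hx, hq x hx⟩, rfl⟩ ⟨_, ⟨hp y hy, hq y hy⟩, rfl⟩ ⟨hx', hy'⟩

/-- On an interval, the derivative of a Lipschitz function is bounded, also if the interval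
consists of one point. -/
lemma IsLipschitzTwiceDiffOn.fderiv_bounded_real {J : Set ℝ} (hJ : J.OrdConnected)
    (hφ : IsLipschitzTwiceDiffOn φ J) : ∃ A : ℝ, ∀ r ∈ J, ‖fderiv ℝ φ r‖ ≤ A := by
  by_cases h : J.Subsingleton
  · rcases J.eq_empty_or_nonempty with rfl | ⟨r, hr⟩
    · exact ⟨0, fun r hr => hr.elim⟩
    · exact ⟨‖fderiv ℝ φ r‖, fun t ht => by rw [h ht hr]⟩
  · obtain ⟨r, hr, t, ht, hrt⟩ := Set.not_subsingleton_iff.1 h |>.exists_lt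
    refine hφ.fderiv_bounded hJ.convex ?_
    have : Set.Ioo r t ⊆ interior J :=
      interior_maximal (Set.Ioo_subset_Icc_self.trans (hJ.out hr ht)) isOpen_Ioo
    exact (Set.nonempty_Ioo.2 hrt).mono this

/-- The functions `ν` and `φ` and their derivatives extend from `R × R` and `J` to Lipschitz
functions. -/
lemma exists_plugIn {J : Set ℝ} (hR : Convex ℝ R) (hRi : (interior R).Nonempty)
    (hν : IsLipschitzTwiceDiffOn ν (R ×ˢ R)) (hJ : J.OrdConnected)
    (hφ : IsLipschitzTwiceDiffOn φ J) :
    ∃ (A : ℝ) (P : PlugIn A), P.HasTaylor R J ∧ P.Represents ν φ R J := by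
  obtain ⟨C1, hC1, h1⟩ := hν.taylor (hR.prod hR)
  obtain ⟨C2, hC2, h2⟩ := hφ.taylor hJ.convex
  obtain ⟨A1, hA1⟩ := hν.fderiv_bounded (hR.prod hR) (by
    rw [interior_prod_eq]; exact hRi.prod hRi)
  obtain ⟨A2, hA2⟩ := hφ.fderiv_bounded_real hJ
  obtain ⟨L1, hL1⟩ := hν.lipschitz
  obtain ⟨L2, hL2⟩ := hφ.lipschitz
  -- the partial derivatives are Lipschitz and bounded
  have hpart : ∀ e : ℝ × ℝ, ‖e‖ ≤ 1 → ∃ g : ℝ × ℝ → ℝ, LipschitzWith ⟨C1, hC1⟩ g ∧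
      Set.EqOn (fun z => fderiv ℝ ν z e) g (R ×ˢ R) ∧ ∀ z, |g z| ≤ |A1| := by
    intro e he
    refine exists_lipschitz_extension (LipschitzOnWith.of_dist_le_mul fun z hz w hw => ?_)
      (abs_nonneg _) fun z hz => ?_
    · rw [dist_eq_norm, dist_eq_norm, ← sub_apply]
      refine ((fderiv ℝ ν z - fderiv ℝ ν w).le_opNorm e).trans ?_
      exact (mul_le_of_le_one_right (norm_nonneg _) he).trans (h1 w hw z hz).1
    · refine ((fderiv ℝ ν z).le_opNorm e).trans ((mul_le_of_le_one_right (norm_nonneg _) he).trans ?_)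
      exact (hA1 z hz).trans (le_abs_self _)
  obtain ⟨a, ha, haE, haA⟩ := hpart (1, 0) (by simp [Prod.norm_def])
  obtain ⟨b, hb, hbE, hbA⟩ := hpart (0, 1) (by simp [Prod.norm_def])
  obtain ⟨v, hv, hvE⟩ := hL1.extend_real
  obtain ⟨ph, hph, hphE⟩ := hL2.extend_real
  obtain ⟨dph, hdph, hdphE, hdphA⟩ : ∃ g : ℝ → ℝ, LipschitzWith ⟨C2, hC2⟩ g ∧
      Set.EqOn (fun z => fderiv ℝ φ z 1) g J ∧ ∀ z, |g z| ≤ |A2| := by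
    refine exists_lipschitz_extension (LipschitzOnWith.of_dist_le_mul fun z hz w hw => ?_)
      (abs_nonneg _) fun z hz => ?_
    · rw [dist_eq_norm, dist_eq_norm, ← sub_apply]
      refine ((fderiv ℝ φ z - fderiv ℝ φ w).le_opNorm 1).trans ?_
      exact (mul_le_of_le_one_right (norm_nonneg _) (by simp)).trans (h2 w hw z hz).1
    · refine ((fderiv ℝ φ z).le_opNorm 1).trans
        ((mul_le_of_le_one_right (norm_nonneg _) (by simp)).trans ?_)
      exact (hA2 z hz).trans (le_abs_self _)
  set A : ℝ := C1 + C2 + |A1| + |A2| + L1 + L2 with hA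
  have hL10 : (0 : ℝ) ≤ L1 := L1.2
  have hL20 : (0 : ℝ) ≤ L2 := L2.2
  have e1 : C1 ≤ A := by linarith [abs_nonneg A1, abs_nonneg A2]
  have e2 : C2 ≤ A := by linarith [abs_nonneg A1, abs_nonneg A2]
  have e3 : |A1| ≤ A := by linarith [abs_nonneg A1, abs_nonneg A2]
  have e4 : |A2| ≤ A := by linarith [abs_nonneg A1, abs_nonneg A2]
  have e5 : (L1 : ℝ) ≤ A := by linarith [abs_nonneg A1, abs_nonneg A2]
  have e6 : (L2 : ℝ) ≤ A := by linarith [abs_nonneg A1, abs_nonneg A2]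
  have hdist : ∀ z w : ℝ × ℝ, dist z w ≤ |z.1 - w.1| + |z.2 - w.2| := fun z w => by
    rw [Prod.dist_eq, Real.dist_eq, Real.dist_eq]
    exact max_le (by linarith [abs_nonneg (z.2 - w.2)]) (by linarith [abs_nonneg (z.1 - w.1)])
  have hlip : ∀ {C : ℝ≥0} {g : ℝ × ℝ → ℝ}, LipschitzWith C g → (C : ℝ) ≤ A →
      ∀ z w, |g z - g w| ≤ A * (|z.1 - w.1| + |z.2 - w.2|) := fun {C g} hg hC z w => by
    rw [← Real.dist_eq]
    exact (hg.dist_le_mul z w).trans (mul_le_mul hC (hdist z w) dist_nonneg (C.2.trans hC))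
  have hlip1 : ∀ {C : ℝ≥0} {g : ℝ → ℝ}, LipschitzWith C g → (C : ℝ) ≤ A →
      ∀ z w, |g z - g w| ≤ A * |z - w| := fun {C g} hg hC z w => by
    rw [← Real.dist_eq, ← Real.dist_eq]
    exact (hg.dist_le_mul z w).trans (mul_le_mul_of_nonneg_right hC dist_nonneg)
  refine ⟨A, ⟨v, a, b, ph, dph, hlip hv e5, hlip ha e1, hlip hb e1, fun z => (haA z).trans e3,
    fun z => (hbA z).trans e3, hlip1 hph e6, hlip1 hdph e2, fun z => (hdphA z).trans e4⟩,
    ⟨fun z hz w hw => ?_, fun r hr t ht => ?_⟩,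
    ⟨fun z hz => (hvE hz).symm, fun z hz => (haE hz).symm, fun z hz => (hbE hz).symm,
    fun r hr => (hphE hr).symm, fun r hr => ?_⟩⟩
  · simp only [← hvE hz, ← hvE hw, ← haE hz, ← hbE hz]
    have hlin : fderiv ℝ ν z (w - z) = fderiv ℝ ν z (1, 0) * (w.1 - z.1)
        + fderiv ℝ ν z (0, 1) * (w.2 - z.2) := by
      have : w - z = (w.1 - z.1) • ((1, 0) : ℝ × ℝ) + (w.2 - z.2) • ((0, 1) : ℝ × ℝ) := by
        ext <;> simp
      conv_lhs => rw [this]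
      rw [map_add, map_smul, map_smul, smul_eq_mul, smul_eq_mul]; ring
    have h := (h1 z hz w hw).2
    rw [hlin, ← sub_sub] at h
    refine h.trans (mul_le_mul e1 ?_ (by positivity) (hC1.trans e1))
    rw [Prod.norm_def, Real.norm_eq_abs, Real.norm_eq_abs, Prod.fst_sub, Prod.snd_sub]
    rcases max_choice |w.1 - z.1| |w.2 - z.2| with h | h <;> rw [h] <;> simp <;> positivity
  · simp only [← hphE hr, ← hphE ht, ← hdphE hr]
    have h := (h2 r hr t ht).2
    have hlin : fderiv ℝ φ r (t - r) = fderiv ℝ φ r 1 * (t - r) := by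
      conv_lhs => rw [show t - r = (t - r) • (1 : ℝ) by simp]
      rw [map_smul, smul_eq_mul]; ring
    rw [hlin, Real.norm_eq_abs] at h
    exact h.trans (mul_le_mul_of_nonneg_right e2 (by positivity))
  · simp only [← hdphE hr, fderiv_apply_one_eq_deriv]

end Range

/-! ### The influence functions are determined almost everywhere -/

namespace PlugIn
variable {A : ℝ} (P : PlugIn A)

lemma continuous_of_lip {g : ℝ × ℝ → ℝ} (hA : 0 ≤ A)
    (hg : ∀ z w, |g z - g w| ≤ A * (|z.1 - w.1| + |z.2 - w.2|)) : Continuous g := by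
  refine (LipschitzWith.of_dist_le_mul (K := (A * 2).toNNReal) fun z w => ?_).continuous
  rw [Real.dist_eq, Real.coe_toNNReal _ (by positivity)]
  refine (hg z w).trans ?_
  have h1 : |z.1 - w.1| ≤ dist z w := by rw [Prod.dist_eq]; exact le_max_left _ _
  have h2 : |z.2 - w.2| ≤ dist z w := by rw [Prod.dist_eq]; exact le_max_right _ _
  nlinarith

lemma continuous_real_of_lip {g : ℝ → ℝ} (hA : 0 ≤ A)
    (hg : ∀ z w, |g z - g w| ≤ A * |z - w|) : Continuous g :=
  (LipschitzWith.of_dist_le_mul (K := A.toNNReal) fun z w => by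
    rw [Real.dist_eq, Real.dist_eq, Real.coe_toNNReal _ hA]; exact hg z w).continuous

@[fun_prop] lemma measurable_v : Measurable P.v := (continuous_of_lip P.nonneg P.v_lip).measurable
@[fun_prop] lemma measurable_a : Measurable P.a := (continuous_of_lip P.nonneg P.a_lip).measurable
@[fun_prop] lemma measurable_b : Measurable P.b := (continuous_of_lip P.nonneg P.b_lip).measurable
@[fun_prop] lemma measurable_ph : Measurable P.ph :=
  (continuous_real_of_lip P.nonneg P.ph_lip).measurable
@[fun_prop] lemma measurable_dph : Measurable P.dph :=
  (continuous_real_of_lip P.nonneg P.dph_lip).measurable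

/-- The value `∫_X v(p, q)` of the inner integral. -/
noncomputable def inner {d : ℕ} (X : Set (Euc d)) (p q : Euc d → ℝ) : ℝ :=
  ∫ x in X, P.v (p x, q x)

/-- The influence function of `φ(∫_X v(p, q))` with respect to `p`. -/
noncomputable def influenceFst {d : ℕ} (X : Set (Euc d)) (p q : Euc d → ℝ) (x : Euc d) : ℝ :=
  P.dph (P.inner X p q) * (X.indicator (fun t => P.a (p t, q t)) x - ∫ t in X, P.a (p t, q t) * p t)

/-- The influence function of `φ(∫_X v(p, q))` with respect to `q`. -/
noncomputable def influenceSnd {d : ℕ} (X : Set (Euc d)) (p q : Euc d → ℝ) (y : Euc d) : ℝ :=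
  P.dph (P.inner X p q) * (X.indicator (fun t => P.b (p t, q t)) y - ∫ t in X, P.b (p t, q t) * q t)

end PlugIn

section Derivative
variable {d : ℕ} {X : Set (Euc d)} {ν : ℝ × ℝ → ℝ} {φ : ℝ → ℝ} {R J : Set ℝ} {A : ℝ}

/-- Differentiation under the integral sign for the inner integral. -/
lemma hasDerivAt_setIntegral (hX : IsCompact X)
    {ε : ℝ} (hε : 0 < ε) {C : ℝ}
    (hC : ∀ z ∈ R ×ˢ R, ∀ w ∈ Metric.ball z ε, DifferentiableAt ℝ ν w ∧ ‖fderiv ℝ ν w‖ ≤ C)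
    {P : PlugIn A} (hP : P.Represents ν φ R J) {p q u w : Euc d → ℝ}
    (hp : Measurable p) (hq : Measurable q) (hu : Measurable u) (hw : Measurable w)
    (hpR : ∀ x ∈ X, p x ∈ R) (hqR : ∀ x ∈ X, q x ∈ R) {M : ℝ}
    (hpM : ∀ x ∈ X, |p x| ≤ M) (hqM : ∀ x ∈ X, |q x| ≤ M)
    (huM : ∀ x ∈ X, |u x| ≤ M) (hwM : ∀ x ∈ X, |w x| ≤ M) :
    HasDerivAt (fun t : ℝ => ∫ x in X, ν (p x + t * u x, q x + t * w x))
      (∫ x in X, (P.a (p x, q x) * u x + P.b (p x, q x) * w x)) 0 := by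
  classical
  have hfin : IsFiniteMeasure ((volume : Measure (Euc d)).restrict X) :=
    isFiniteMeasure_restrict.2 hX.measure_ne_top
  set δ : ℝ := ε / (|M| + 1) with hδ
  have hδ0 : 0 < δ := by positivity
  have hball : ∀ x ∈ X, ∀ t ∈ Metric.ball (0 : ℝ) δ,
      (p x + t * u x, q x + t * w x) ∈ Metric.ball (p x, q x) ε := by
    intro x hx t ht
    have ht' : |t| < δ := by simpa using ht
    have hs : ∀ {y : ℝ}, |y| ≤ M → |t * y| < ε := fun {y} hy => by
      rw [abs_mul]
      have h1 : |y| < |M| + 1 := (hy.trans (le_abs_self M)).trans_lt (lt_add_one _)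
      calc |t| * |y| ≤ |t| * (|M| + 1) := mul_le_mul_of_nonneg_left h1.le (abs_nonneg _)
        _ < δ * (|M| + 1) := mul_lt_mul_of_pos_right ht' (by positivity)
        _ = ε := by rw [hδ]; field_simp
    rw [Metric.mem_ball, Prod.dist_eq, Real.dist_eq, Real.dist_eq]
    simpa using ⟨by simpa [abs_mul] using hs (huM x hx), by simpa [abs_mul] using hs (hwM x hx)⟩
  -- the integrand is continuous on a neighbourhood of the values of `(p, q)`
  set U := Metric.thickening ε (R ×ˢ R) with hU
  have hνU : ContinuousOn ν U := fun y hy => by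
    obtain ⟨z, hz, hyz⟩ := Metric.mem_thickening_iff.1 hy
    exact (hC z hz y hyz).1.continuousAt.continuousWithinAt
  have hνm : Measurable (U.piecewise ν 0) :=
    hνU.measurable_piecewise continuousOn_const Metric.isOpen_thickening.measurableSet
  have hae : ∀ {Q : Euc d → Prop}, (∀ x ∈ X, Q x) → ∀ᵐ x ∂((volume : Measure (Euc d)).restrict X), Q x :=
    fun h => (ae_restrict_iff' hX.measurableSet).2 (ae_of_all _ h)
  have hmeas : ∀ t ∈ Metric.ball (0 : ℝ) δ, AEStronglyMeasurable
      (fun x => ν (p x + t * u x, q x + t * w x)) (volume.restrict X) := by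
    intro t ht
    have h1 : Measurable fun x => U.piecewise ν 0 (p x + t * u x, q x + t * w x) :=
      hνm.comp (by fun_prop)
    refine h1.aestronglyMeasurable.congr (hae fun x hx => ?_)
    exact Set.piecewise_eq_of_mem _ _ _
      (Metric.mem_thickening_iff.2 ⟨_, ⟨hpR x hx, hqR x hx⟩, hball x hx t ht⟩)
  have hF'eq : ∀ x ∈ X, fderiv ℝ ν (p x + 0 * u x, q x + 0 * w x) (u x, w x)
      = P.a (p x, q x) * u x + P.b (p x, q x) * w x := by
    intro x hx
    have hz : (p x, q x) ∈ R ×ˢ R := ⟨hpR x hx, hqR x hx⟩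
    rw [hP.a_eq _ hz, hP.b_eq _ hz]
    have : ((u x, w x) : ℝ × ℝ) = u x • ((1, 0) : ℝ × ℝ) + w x • ((0, 1) : ℝ × ℝ) := by
      ext <;> simp
    rw [this, map_add, map_smul, map_smul]
    simp only [zero_mul, add_zero, smul_eq_mul]
    ring
  have hvint : Integrable (fun x => P.v (p x, q x)) (volume.restrict X) := by
    refine Integrable.of_bound (Measurable.aestronglyMeasurable (by fun_prop))
      (|P.v (0, 0)| + A * (M + M)) (hae fun x hx => ?_)
    have h1 := P.v_lip (p x, q x) (0, 0)
    simp only [sub_zero] at h1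
    have h2 : |P.v (p x, q x)| ≤ |P.v (0, 0)| + |P.v (p x, q x) - P.v (0, 0)| := by
      have := abs_add_le (P.v (0, 0)) (P.v (p x, q x) - P.v (0, 0)); simpa using this
    refine h2.trans (add_le_add le_rfl (h1.trans ?_))
    exact mul_le_mul_of_nonneg_left (add_le_add (hpM x hx) (hqM x hx)) P.nonneg
  have key := hasDerivAt_integral_of_dominated_loc_of_deriv_le (μ := volume.restrict X)
    (F := fun t x => ν (p x + t * u x, q x + t * w x))
    (F' := fun t x => fderiv ℝ ν (p x + t * u x, q x + t * w x) (u x, w x))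
    (x₀ := 0) (s := Metric.ball 0 δ) (bound := fun _ => |C| * |M|)
    (Metric.ball_mem_nhds 0 hδ0)
    (eventually_of_mem (Metric.ball_mem_nhds 0 hδ0) hmeas)
    (hvint.congr (hae fun x hx => by
      simp only [zero_mul, add_zero]; exact hP.v_eq _ ⟨hpR x hx, hqR x hx⟩))
    ((Measurable.aestronglyMeasurable (by fun_prop)).congr (hae fun x hx => (hF'eq x hx).symm))
    (hae fun x hx t ht => by
      refine ((fderiv ℝ ν _).le_opNorm _).trans ?_
      refine mul_le_mul (((hC _ ⟨hpR x hx, hqR x hx⟩ _ (hball x hx t ht)).2).trans (le_abs_self _)) ?_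
        (norm_nonneg _) (abs_nonneg _)
      rw [Prod.norm_def]
      exact max_le ((huM x hx).trans (le_abs_self _)) ((hwM x hx).trans (le_abs_self _)))
    (integrable_const _)
    (hae fun x hx t ht => by
      have h1 := (hC _ ⟨hpR x hx, hqR x hx⟩ _ (hball x hx t ht)).1.hasFDerivAt
      have h2 : HasDerivAt (fun t : ℝ => (p x + t * u x, q x + t * w x)) (u x, w x) t := by
        refine HasDerivAt.prodMk ?_ ?_
        · simpa using ((hasDerivAt_id t).mul_const (u x)).const_add (p x)
        · simpa using ((hasDerivAt_id t).mul_const (w x)).const_add (q x)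
      exact h1.comp_hasDerivAt t h2)
  refine key.2.congr_deriv (integral_congr_ae (hae hF'eq))

/-- Integrals against all bounded probability densities determine a function almost everywhere. -/
lemma ae_eq_of_forall_integral_density_eq {ψ χ : Euc d → ℝ}
    (hχ : ∀ S : Set (Euc d), MeasurableSet S → volume S < ∞ → IntegrableOn χ S)
    (h : ∀ p₁ : Euc d → ℝ, IsDensity p₁ → (∃ M : ℝ, ∀ x, p₁ x ≤ M) →
      Integrable (fun x => ψ x * p₁ x) ∧ ∫ x, ψ x * p₁ x = ∫ x, χ x * p₁ x) :
    ψ =ᵐ[volume] χ := by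
  have key : ∀ S : Set (Euc d), MeasurableSet S → volume S < ∞ →
      IntegrableOn ψ S ∧ ∫ x in S, ψ x = ∫ x in S, χ x := by
    intro S hS hfin
    rcases eq_or_ne (volume S) 0 with h0 | h0
    · refine ⟨?_, by rw [setIntegral_measure_zero _ h0, setIntegral_measure_zero _ h0]⟩
      rw [IntegrableOn, Measure.restrict_eq_zero.2 h0]; exact integrable_zero_measure
    · have hpos : 0 < volume.real S := ENNReal.toReal_pos h0 hfin.ne
      set p₁ : Euc d → ℝ := S.indicator fun _ => (volume.real S)⁻¹ with hp₁
      have hmul : ∀ ξ : Euc d → ℝ, (fun x => ξ x * p₁ x)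
          = S.indicator fun x => ξ x * (volume.real S)⁻¹ := fun ξ => by
        ext x
        by_cases hx : x ∈ S <;> simp [hp₁, hx]
      have hd : IsDensity p₁ := by
        refine ⟨measurable_const.indicator hS, fun x => Set.indicator_nonneg
          (fun _ _ => by positivity) x, ?_, ?_⟩
        · exact (integrable_indicator_iff hS).2 (integrableOn_const hfin.ne)
        · rw [hp₁, integral_indicator hS, setIntegral_const, smul_eq_mul,
            mul_inv_cancel₀ hpos.ne']
      obtain ⟨hi, he⟩ := h p₁ hd ⟨(volume.real S)⁻¹, fun x =>
        Set.indicator_le_self' (fun _ _ => by positivity) x⟩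
      rw [hmul, integrable_indicator_iff hS] at hi
      rw [hmul, hmul, integral_indicator hS, integral_indicator hS, integral_mul_const,
        integral_mul_const] at he
      refine ⟨?_, mul_right_cancel₀ (inv_ne_zero hpos.ne') he⟩
      refine (hi.mul_const (volume.real S)).congr (ae_of_all _ fun x => ?_)
      simp only
      rw [inv_mul_cancel_right₀ hpos.ne']
  exact ae_eq_of_forall_setIntegral_eq_of_sigmaFinite (fun S hS hf => (key S hS hf).1) hχ
    fun S hS hf => (key S hS hf).2

/-- The data of the functional: a convex range, a neighbourhood of `R × R` in which `ν`
is differentiable with bounded derivative, and the extensions of `ν`, `φ`. -/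
structure FunctionalData (X : Set (Euc d)) (ν : ℝ × ℝ → ℝ) (φ : ℝ → ℝ) (R : Set ℝ) {A : ℝ}
    (P : PlugIn A) : Prop where
  compact : IsCompact X
  convex : Convex ℝ R
  nonempty : R.Nonempty
  smooth_inner : IsLipschitzTwiceDiffOn ν (R ×ˢ R)
  smooth_outer : IsLipschitzTwiceDiffOn φ (integralRange X ν R)
  near : ∃ ε > 0, ∃ C : ℝ, ∀ z ∈ R ×ˢ R, ∀ w ∈ Metric.ball z ε,
    DifferentiableAt ℝ ν w ∧ ‖fderiv ℝ ν w‖ ≤ C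
  taylor : P.HasTaylor R (integralRange X ν R)
  represents : P.Represents ν φ R (integralRange X ν R)

variable {P : PlugIn A}

lemma PlugIn.integrableOn_comp (hX : IsCompact X) {g : ℝ × ℝ → ℝ} (hg : Measurable g)
    (hgl : ∀ z w, |g z - g w| ≤ A * (|z.1 - w.1| + |z.2 - w.2|)) {p q : Euc d → ℝ}
    (hp : Measurable p) (hq : Measurable q) (hpi : IntegrableOn p X) (hqi : IntegrableOn q X) :
    IntegrableOn (fun x => g (p x, q x)) X := by
  have hfin : IsFiniteMeasure ((volume : Measure (Euc d)).restrict X) :=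
    isFiniteMeasure_restrict.2 hX.measure_ne_top
  refine Integrable.mono' (g := fun x => |g (0, 0)| + A * (|p x| + |q x|)) ?_
    (Measurable.aestronglyMeasurable (by fun_prop)) (ae_of_all _ fun x => ?_)
  · exact (integrable_const _).add ((hpi.abs.add hqi.abs).const_mul A)
  · have h1 := hgl (p x, q x) (0, 0)
    simp only [sub_zero] at h1
    have h2 : |g (p x, q x)| ≤ |g (0, 0)| + |g (p x, q x) - g (0, 0)| := by
      have := abs_add_le (g (0, 0)) (g (p x, q x) - g (0, 0)); simpa using this
    exact h2.trans (add_le_add le_rfl h1)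

lemma IsAdmissible.integrableOn (hX : IsCompact X) {p : Euc d → ℝ} (hp : IsAdmissible X R p) :
    IntegrableOn p X := by
  obtain ⟨M, hM⟩ := hp.bounded
  have hfin : IsFiniteMeasure ((volume : Measure (Euc d)).restrict X) :=
    isFiniteMeasure_restrict.2 hX.measure_ne_top
  exact Integrable.of_bound hp.measurable.aestronglyMeasurable M
    ((ae_restrict_iff' hX.measurableSet).2 (ae_of_all _ hM))

namespace FunctionalData

lemma inner_eq (D : FunctionalData X ν φ R P) {p q : Euc d → ℝ} (hp : IsAdmissible X R p)
    (hq : IsAdmissible X R q) : ∫ x in X, ν (p x, q x) = P.inner X p q :=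
  setIntegral_congr_fun D.compact.measurableSet fun x hx =>
    (D.represents.v_eq _ ⟨hp.mem x hx, hq.mem x hx⟩).symm

lemma inner_mem (D : FunctionalData X ν φ R P) {p q : Euc d → ℝ} (hp : IsAdmissible X R p)
    (hq : IsAdmissible X R q) : P.inner X p q ∈ integralRange X ν R := by
  rw [← D.inner_eq hp hq]
  refine setIntegral_mem_integralRange D.compact D.convex D.nonempty D.smooth_inner hp.mem hq.mem ?_
  refine (PlugIn.integrableOn_comp D.compact P.measurable_v P.v_lip hp.measurable
    hq.measurable (hp.integrableOn D.compact) (hq.integrableOn D.compact)).congr_fun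
    (fun x hx => ?_) D.compact.measurableSet
  exact D.represents.v_eq _ ⟨hp.mem x hx, hq.mem x hx⟩

lemma functional_eq (D : FunctionalData X ν φ R P) {p q : Euc d → ℝ} (hp : IsAdmissible X R p)
    (hq : IsAdmissible X R q) : functional X φ ν p q = P.ph (P.inner X p q) := by
  rw [functional, D.inner_eq hp hq, D.represents.ph_eq _ (D.inner_mem hp hq)]

/-- The derivative of the functional along a bounded direction. -/
lemma hasDerivAt_functional (D : FunctionalData X ν φ R P) {p q u w : Euc d → ℝ}
    (hp : IsAdmissible X R p) (hq : IsAdmissible X R q) (hu : Measurable u) (hw : Measurable w)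
    {M : ℝ} (huM : ∀ x ∈ X, |u x| ≤ M) (hwM : ∀ x ∈ X, |w x| ≤ M) :
    HasDerivAt (fun t : ℝ => φ (∫ x in X, ν (p x + t * u x, q x + t * w x)))
      (P.dph (P.inner X p q) * ∫ x in X, (P.a (p x, q x) * u x + P.b (p x, q x) * w x)) 0 := by
  obtain ⟨ε, hε, C, hC⟩ := D.near
  obtain ⟨Mp, hMp⟩ := hp.bounded
  obtain ⟨Mq, hMq⟩ := hq.bounded
  have h1 := hasDerivAt_setIntegral D.compact hε hC D.represents hp.measurable hq.measurable hu hw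
    hp.mem hq.mem (M := max M (max Mp Mq))
    (fun x hx => (hMp x hx).trans ((le_max_left _ _).trans (le_max_right _ _)))
    (fun x hx => (hMq x hx).trans ((le_max_right _ _).trans (le_max_right _ _)))
    (fun x hx => (huM x hx).trans (le_max_left _ _))
    (fun x hx => (hwM x hx).trans (le_max_left _ _))
  have hmem := D.inner_mem hp hq
  have h2 : HasDerivAt φ (P.dph (P.inner X p q)) (P.inner X p q) := by
    rw [D.represents.dph_eq _ hmem]
    exact ((D.smooth_outer.differentiable _ hmem).self_of_nhds).hasDerivAt
  have h0 : ∫ x in X, ν (p x + 0 * u x, q x + 0 * w x) = P.inner X p q := by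
    simp only [zero_mul, add_zero]; exact D.inner_eq hp hq
  rw [← h0] at h2
  have := HasDerivAt.comp (0 : ℝ) h2 h1
  rw [h0] at this
  exact this

/-- The integral of the explicit influence function against a density. -/
lemma integral_mul_indicator_sub (hX : MeasurableSet X) {g : Euc d → ℝ}
    {M : ℝ} (hgM : ∀ x, |g x| ≤ M) (hgm : Measurable g) (c e : ℝ) {p₁ : Euc d → ℝ}
    (hp₁ : IsDensity p₁) :
    ∫ x, (e * (X.indicator g x - c)) * p₁ x = e * ((∫ x in X, g x * p₁ x) - c) := by
  have h1 : ∀ x, (e * (X.indicator g x - c)) * p₁ x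
      = e * (X.indicator (fun x => g x * p₁ x) x - c * p₁ x) := fun x => by
    by_cases hx : x ∈ X <;> simp [hx] <;> ring
  simp_rw [h1]
  have hi : Integrable fun x => g x * p₁ x :=
    hp₁.integrable.bdd_mul hgm.aestronglyMeasurable (ae_of_all _ hgM)
  rw [integral_const_mul, integral_sub (hi.indicator hX) (hp₁.integrable.const_mul c),
    integral_indicator hX, integral_const_mul, hp₁.integral_eq_one, mul_one]

/-- The influence function is determined almost everywhere by its defining property. -/
lemma influenceFst_ae_eq (D : FunctionalData X ν φ R P) {p q ψ : Euc d → ℝ}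
    (hp : IsAdmissible X R p) (hq : IsAdmissible X R q)
    (hψ : IsInfluenceFst (functional X φ ν) p q ψ) :
    ψ =ᵐ[volume] P.influenceFst X p q := by
  have hpm := hp.measurable
  have hqm := hq.measurable
  have ham : Measurable fun t => P.a (p t, q t) := by fun_prop
  have hfin : IsFiniteMeasure ((volume : Measure (Euc d)).restrict X) :=
    isFiniteMeasure_restrict.2 D.compact.measure_ne_top
  refine ae_eq_of_forall_integral_density_eq (fun S hS hSf => ?_) fun p₁ hp₁ hp₁M => ?_
  · have : IsFiniteMeasure ((volume : Measure (Euc d)).restrict S) :=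
      isFiniteMeasure_restrict.2 hSf.ne
    refine Integrable.const_mul (Integrable.sub ?_ (integrable_const _)) _
    exact ((Integrable.of_bound ham.aestronglyMeasurable A
      (ae_of_all _ fun x => P.a_le _)).indicator D.compact.measurableSet)
  · obtain ⟨hi, hder⟩ := hψ p₁ hp₁ hp₁M
    refine ⟨hi, ?_⟩
    obtain ⟨M₁, hM₁⟩ := hp₁M
    obtain ⟨Mp, hMp⟩ := hp.bounded
    have hder' := D.hasDerivAt_functional hp hq (u := fun x => p₁ x - p x) (w := fun _ => 0)
      (M := M₁ + Mp) (hp₁.measurable.sub hpm) measurable_const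
      (fun x hx => (abs_sub _ _).trans (add_le_add (by
        rw [abs_of_nonneg (hp₁.nonneg x)]; exact hM₁ x) (hMp x hx)))
      (fun x hx => by
        rw [abs_zero]
        exact add_nonneg ((hp₁.nonneg x).trans (hM₁ x)) ((abs_nonneg _).trans (hMp x hx)))
    have heq := hder.unique (by simpa only [functional, mul_zero, add_zero] using hder')
    rw [heq]
    unfold PlugIn.influenceFst
    rw [integral_mul_indicator_sub D.compact.measurableSet (fun x => P.a_le _) ham _ _ hp₁]
    congr 1
    rw [← integral_sub]
    · refine integral_congr_ae (ae_of_all _ fun x => ?_)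
      simp only; ring
    · exact (hp₁.integrable.bdd_mul ham.aestronglyMeasurable (ae_of_all _ fun x => P.a_le _)).integrableOn
    · exact (hp.integrableOn D.compact).bdd_mul ham.aestronglyMeasurable
        (ae_of_all _ fun x => P.a_le _)

lemma influenceSnd_ae_eq (D : FunctionalData X ν φ R P) {p q ψ : Euc d → ℝ}
    (hp : IsAdmissible X R p) (hq : IsAdmissible X R q)
    (hψ : IsInfluenceSnd (functional X φ ν) p q ψ) :
    ψ =ᵐ[volume] P.influenceSnd X p q := by
  have hpm := hp.measurable
  have hqm := hq.measurable
  have ham : Measurable fun t => P.b (p t, q t) := by fun_prop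
  have hfin : IsFiniteMeasure ((volume : Measure (Euc d)).restrict X) :=
    isFiniteMeasure_restrict.2 D.compact.measure_ne_top
  refine ae_eq_of_forall_integral_density_eq (fun S hS hSf => ?_) fun p₁ hp₁ hp₁M => ?_
  · have : IsFiniteMeasure ((volume : Measure (Euc d)).restrict S) :=
      isFiniteMeasure_restrict.2 hSf.ne
    refine Integrable.const_mul (Integrable.sub ?_ (integrable_const _)) _
    exact ((Integrable.of_bound ham.aestronglyMeasurable A
      (ae_of_all _ fun x => P.b_le _)).indicator D.compact.measurableSet)
  · obtain ⟨hi, hder⟩ := hψ p₁ hp₁ hp₁M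
    refine ⟨hi, ?_⟩
    obtain ⟨M₁, hM₁⟩ := hp₁M
    obtain ⟨Mp, hMp⟩ := hq.bounded
    have hder' := D.hasDerivAt_functional hp hq (w := fun x => p₁ x - q x) (u := fun _ => 0)
      (M := M₁ + Mp) measurable_const (hp₁.measurable.sub hqm)
      (fun x hx => by
        rw [abs_zero]
        exact add_nonneg ((hp₁.nonneg x).trans (hM₁ x)) ((abs_nonneg _).trans (hMp x hx)))
      (fun x hx => (abs_sub _ _).trans (add_le_add (by
        rw [abs_of_nonneg (hp₁.nonneg x)]; exact hM₁ x) (hMp x hx)))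
    have heq := hder.unique (by simpa only [functional, mul_zero, add_zero] using hder')
    rw [heq]
    unfold PlugIn.influenceSnd
    rw [integral_mul_indicator_sub D.compact.measurableSet (fun x => P.b_le _) ham _ _ hp₁]
    congr 1
    rw [← integral_sub]
    · refine integral_congr_ae (ae_of_all _ fun x => ?_)
      simp only; ring
    · exact (hp₁.integrable.bdd_mul ham.aestronglyMeasurable (ae_of_all _ fun x => P.b_le _)).integrableOn
    · exact (hq.integrableOn D.compact).bdd_mul ham.aestronglyMeasurable
        (ae_of_all _ fun x => P.b_le _)

end FunctionalData
end Derivative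

/-! ### First-order expansions of the functional: boundedness, stability, remainder -/

section Pointwise
variable {d : ℕ} {X : Set (Euc d)} {A : ℝ}

/-- A measurable function with a uniform bound. -/
structure IsBoundedMeasurable (p : Euc d → ℝ) : Prop where
  measurable : Measurable p
  bounded : ∃ M : ℝ, ∀ x, |p x| ≤ M

namespace IsBoundedMeasurable
variable {p q : Euc d → ℝ}

lemma integrableOn (hp : IsBoundedMeasurable p) (hX : IsCompact X) : IntegrableOn p X := by
  have hfin : IsFiniteMeasure ((volume : Measure (Euc d)).restrict X) :=
    isFiniteMeasure_restrict.2 hX.measure_ne_top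
  obtain ⟨M, hM⟩ := hp.bounded
  exact integrable_of_abs_le hp.measurable hM

lemma mul (hp : IsBoundedMeasurable p) (hq : IsBoundedMeasurable q) :
    IsBoundedMeasurable fun x => p x * q x := by
  obtain ⟨M, hM⟩ := hp.bounded
  obtain ⟨N, hN⟩ := hq.bounded
  refine ⟨hp.measurable.mul hq.measurable, M * N, fun x => ?_⟩
  rw [abs_mul]
  exact mul_le_mul (hM x) (hN x) (abs_nonneg _) ((abs_nonneg _).trans (hM x))

lemma add (hp : IsBoundedMeasurable p) (hq : IsBoundedMeasurable q) :
    IsBoundedMeasurable fun x => p x + q x := by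
  obtain ⟨M, hM⟩ := hp.bounded
  obtain ⟨N, hN⟩ := hq.bounded
  exact ⟨hp.measurable.add hq.measurable, M + N, fun x => (abs_add_le _ _).trans
    (add_le_add (hM x) (hN x))⟩

lemma sub (hp : IsBoundedMeasurable p) (hq : IsBoundedMeasurable q) :
    IsBoundedMeasurable fun x => p x - q x := by
  obtain ⟨M, hM⟩ := hp.bounded
  obtain ⟨N, hN⟩ := hq.bounded
  exact ⟨hp.measurable.sub hq.measurable, M + N, fun x => (abs_sub _ _).trans
    (add_le_add (hM x) (hN x))⟩

lemma abs (hp : IsBoundedMeasurable p) : IsBoundedMeasurable fun x => |p x| :=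
  ⟨hp.measurable.abs, hp.bounded.imp fun M hM x => by rw [abs_abs]; exact hM x⟩

lemma comp_of_le {g : ℝ × ℝ → ℝ} (hg : Measurable g) (hgA : ∀ z, |g z| ≤ A)
    (hp : IsBoundedMeasurable p) (hq : IsBoundedMeasurable q) :
    IsBoundedMeasurable fun x => g (p x, q x) :=
  ⟨hg.comp (hp.measurable.prodMk hq.measurable), A, fun _ => hgA _⟩

lemma comp_of_lip (hA : 0 ≤ A) {g : ℝ × ℝ → ℝ} (hg : Measurable g)
    (hgl : ∀ z w, |g z - g w| ≤ A * (|z.1 - w.1| + |z.2 - w.2|))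
    (hp : IsBoundedMeasurable p) (hq : IsBoundedMeasurable q) :
    IsBoundedMeasurable fun x => g (p x, q x) := by
  obtain ⟨M, hM⟩ := hp.bounded
  obtain ⟨N, hN⟩ := hq.bounded
  refine ⟨hg.comp (hp.measurable.prodMk hq.measurable), |g (0, 0)| + A * (M + N), fun x => ?_⟩
  have h1 := hgl (p x, q x) (0, 0)
  simp only [sub_zero] at h1
  have h2 : |g (p x, q x)| ≤ |g (0, 0)| + |g (p x, q x) - g (0, 0)| := by
    have := abs_add_le (g (0, 0)) (g (p x, q x) - g (0, 0)); simpa using this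
  exact h2.trans (add_le_add le_rfl (h1.trans
    (mul_le_mul_of_nonneg_left (add_le_add (hM x) (hN x)) hA)))

end IsBoundedMeasurable

lemma abs_setIntegral_le {g u : Euc d → ℝ} (hu : IntegrableOn u X) (h : ∀ x, |g x| ≤ u x) :
    |∫ x in X, g x| ≤ ∫ x in X, u x :=
  norm_integral_le_of_norm_le (f := g) hu (ae_of_all _ h)

lemma abs_mul_sub_mul_le {e e' G G' ε b γ E : ℝ} (h1 : |e - e'| ≤ ε) (h2 : |G| ≤ b)
    (h3 : |e'| ≤ E) (h4 : |G - G'| ≤ γ) : |e * G - e' * G'| ≤ ε * b + E * γ := by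
  have : e * G - e' * G' = (e - e') * G + e' * (G - G') := by ring
  rw [this]
  refine (abs_add_le _ _).trans ?_
  rw [abs_mul, abs_mul]
  exact add_le_add (mul_le_mul h1 h2 (abs_nonneg _) ((abs_nonneg _).trans h1))
    (mul_le_mul h3 h4 (abs_nonneg _) ((abs_nonneg _).trans h3))

namespace PlugIn
variable (P : PlugIn A) {p p' q : Euc d → ℝ}

lemma inner_swap (p q : Euc d → ℝ) : P.swap.inner X q p = P.inner X p q := rfl

lemma influenceFst_swap (p q : Euc d → ℝ) (y : Euc d) :
    P.swap.influenceFst X q p y = P.influenceSnd X p q y := rfl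

lemma influenceSnd_swap (p q : Euc d → ℝ) (x : Euc d) :
    P.swap.influenceSnd X q p x = P.influenceFst X p q x := rfl

lemma abs_inner_sub_le (hX : IsCompact X) (hp : IsBoundedMeasurable p)
    (hp' : IsBoundedMeasurable p') (hq : IsBoundedMeasurable q) {q' : Euc d → ℝ}
    (hq' : IsBoundedMeasurable q') :
    |P.inner X p q - P.inner X p' q'| ≤ A * ∫ x in X, (|p x - p' x| + |q x - q' x|) := by
  unfold inner
  rw [← integral_sub ((hp.comp_of_lip P.nonneg P.measurable_v P.v_lip hq).integrableOn hX)
    ((hp'.comp_of_lip P.nonneg P.measurable_v P.v_lip hq').integrableOn hX),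
    ← integral_const_mul]
  exact abs_setIntegral_le ((((hp.sub hp').abs.add (hq.sub hq').abs).integrableOn hX).const_mul A)
    fun x => P.v_lip _ _

lemma abs_indicator_le {g : Euc d → ℝ} {M : ℝ} (hM0 : 0 ≤ M) (hg : ∀ x, |g x| ≤ M) (x : Euc d) :
    |X.indicator g x| ≤ M := by
  by_cases hx : x ∈ X
  · simpa [hx] using hg x
  · simpa [hx] using hM0

lemma abs_setIntegral_mul_le (hX : IsCompact X) {g : Euc d → ℝ} (hg : ∀ x, |g x| ≤ A)
    (hp : IsBoundedMeasurable p) {I : ℝ} (hI : ∫ x in X, |p x| ≤ I) (hA : 0 ≤ A) :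
    |∫ x in X, g x * p x| ≤ A * I := by
  refine (abs_setIntegral_le ((hp.abs.integrableOn hX).const_mul A) fun x => ?_).trans ?_
  · rw [abs_mul]; exact mul_le_mul_of_nonneg_right (hg x) (abs_nonneg _)
  · rw [integral_const_mul]; exact mul_le_mul_of_nonneg_left hI hA

lemma abs_influenceFst_le (hX : IsCompact X) (hp : IsBoundedMeasurable p)
    {I : ℝ} (hI : ∫ x in X, |p x| ≤ I) (x : Euc d) :
    |P.influenceFst X p q x| ≤ A * (A + A * I) := by
  rw [influenceFst, abs_mul]
  refine mul_le_mul (P.dph_le _) ((abs_sub _ _).trans (add_le_add ?_ ?_)) (abs_nonneg _) P.nonneg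
  · exact abs_indicator_le P.nonneg (fun _ => P.a_le _) x
  · exact abs_setIntegral_mul_le hX (fun _ => P.a_le _) hp hI P.nonneg

lemma abs_influenceSnd_le (hX : IsCompact X) (hq : IsBoundedMeasurable q)
    {I : ℝ} (hI : ∫ x in X, |q x| ≤ I) (y : Euc d) :
    |P.influenceSnd X p q y| ≤ A * (A + A * I) :=
  P.swap.abs_influenceFst_le hX hq hI y

lemma abs_influenceFst_sub_point_le (x x' : Euc d) :
    |P.influenceFst X p q x - P.influenceFst X p q x'| ≤ A * (A + A) := by
  rw [influenceFst, influenceFst, ← mul_sub, abs_mul, sub_sub_sub_cancel_right]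
  exact mul_le_mul (P.dph_le _) ((abs_sub _ _).trans
    (add_le_add (abs_indicator_le P.nonneg (fun _ => P.a_le _) x)
    (abs_indicator_le P.nonneg (fun _ => P.a_le _) x'))) (abs_nonneg _) P.nonneg

lemma abs_indicator_sub_le {g g' u : Euc d → ℝ} {x : Euc d} (h : |g x - g' x| ≤ u x)
    : |X.indicator g x - X.indicator g' x| ≤ u x := by
  by_cases hx : x ∈ X
  · simpa [hx] using h
  · simpa [hx] using (abs_nonneg _).trans h

variable {I : ℝ}

lemma abs_dph_sub_le (hX : IsCompact X) (hp : IsBoundedMeasurable p)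
    (hp' : IsBoundedMeasurable p') (hq : IsBoundedMeasurable q) :
    |P.dph (P.inner X p q) - P.dph (P.inner X p' q)| ≤ A * (A * ∫ x in X, |p x - p' x|) := by
  refine (P.dph_lip _ _).trans (mul_le_mul_of_nonneg_left ?_ P.nonneg)
  simpa using P.abs_inner_sub_le hX hp hp' hq hq

lemma abs_influenceFst_sub_le (hX : IsCompact X) (hp : IsBoundedMeasurable p)
    (hp' : IsBoundedMeasurable p') (hq : IsBoundedMeasurable q) (hI : ∫ x in X, |p x| ≤ I)
    (x : Euc d) :
    |P.influenceFst X p q x - P.influenceFst X p' q x|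
      ≤ A * (A * ∫ t in X, |p t - p' t|) * (A + A * I)
        + A * (A * |p x - p' x| + A * ((∫ t in X, |p t - p' t| * |p t|) + ∫ t in X, |p t - p' t|)) := by
  refine abs_mul_sub_mul_le (P.abs_dph_sub_le hX hp hp' hq) ?_ (P.dph_le _) ?_
  · exact (abs_sub _ _).trans (add_le_add (abs_indicator_le P.nonneg (fun _ => P.a_le _) x)
      (abs_setIntegral_mul_le hX (fun _ => P.a_le _) hp hI P.nonneg))
  · rw [sub_sub_sub_comm]
    refine (abs_sub _ _).trans (add_le_add ?_ ?_)
    · refine abs_indicator_sub_le (u := fun x => A * |p x - p' x|) ((P.a_lip _ _).trans (le_of_eq ?_))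
      simp
    · have ha := (hp.comp_of_le P.measurable_a P.a_le hq)
      have ha' := (hp'.comp_of_le P.measurable_a P.a_le hq)
      rw [← integral_sub ((ha.mul hp).integrableOn hX) ((ha'.mul hp').integrableOn hX),
        ← integral_add (((hp.sub hp').abs.mul hp.abs).integrableOn hX)
          ((hp.sub hp').abs.integrableOn hX), ← integral_const_mul]
      refine abs_setIntegral_le (((((hp.sub hp').abs.mul hp.abs).integrableOn hX).add
          ((hp.sub hp').abs.integrableOn hX)).const_mul A) fun t => ?_
      have h1 : |P.a (p t, q t) - P.a (p' t, q t)| ≤ A * |p t - p' t| := by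
        simpa using P.a_lip (p t, q t) (p' t, q t)
      have h2 := abs_mul_sub_mul_le h1 (le_refl |p t|) (P.a_le (p' t, q t)) (le_refl |p t - p' t|)
      refine h2.trans (le_of_eq ?_)
      ring

lemma abs_influenceSnd_sub_le (hX : IsCompact X) (hp : IsBoundedMeasurable p)
    (hp' : IsBoundedMeasurable p') (hq : IsBoundedMeasurable q) (hI : ∫ x in X, |q x| ≤ I)
    (y : Euc d) :
    |P.influenceSnd X p q y - P.influenceSnd X p' q y|
      ≤ A * (A * ∫ t in X, |p t - p' t|) * (A + A * I)
        + A * (A * |p y - p' y| + A * ∫ t in X, |p t - p' t| * |q t|) := by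
  refine abs_mul_sub_mul_le (P.abs_dph_sub_le hX hp hp' hq) ?_ (P.dph_le _) ?_
  · exact (abs_sub _ _).trans (add_le_add (abs_indicator_le P.nonneg (fun _ => P.b_le _) y)
      (abs_setIntegral_mul_le hX (fun _ => P.b_le _) hq hI P.nonneg))
  · rw [sub_sub_sub_comm]
    refine (abs_sub _ _).trans (add_le_add ?_ ?_)
    · refine abs_indicator_sub_le (u := fun x => A * |p x - p' x|) ((P.b_lip _ _).trans (le_of_eq ?_))
      simp
    · have ha := (hp.comp_of_le P.measurable_b P.b_le hq)
      have ha' := (hp'.comp_of_le P.measurable_b P.b_le hq)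
      rw [← integral_sub ((ha.mul hq).integrableOn hX) ((ha'.mul hq).integrableOn hX),
        ← integral_const_mul]
      refine abs_setIntegral_le ((((hp.sub hp').abs.mul hq.abs).integrableOn hX).const_mul A)
        fun t => ?_
      rw [← sub_mul, abs_mul, ← mul_assoc]
      refine mul_le_mul_of_nonneg_right ?_ (abs_nonneg _)
      simpa using P.b_lip (p t, q t) (p' t, q t)

/-- The first-order expansion of the functional at `(p, q)`, evaluated at observations `x`, `y`:
the summand of the leave-one-out estimator. -/
noncomputable def summand (X : Set (Euc d)) (p q : Euc d → ℝ) (x y : Euc d) : ℝ :=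
  P.ph (P.inner X p q) + P.influenceFst X p q x + P.influenceSnd X p q y

lemma summand_swap (p q : Euc d → ℝ) (x y : Euc d) :
    P.swap.summand X q p y x = P.summand X p q x y := by
  simp only [summand, influenceFst_swap, influenceSnd_swap, inner_swap]
  simp only [swap]; ring

lemma abs_summand_sub_point_le (x x' y : Euc d) :
    |P.summand X p q x y - P.summand X p q x' y| ≤ 2 * A ^ 2 := by
  have := P.abs_influenceFst_sub_point_le (X := X) (p := p) (q := q) x x'
  have h : P.summand X p q x y - P.summand X p q x' y
    = P.influenceFst X p q x - P.influenceFst X p q x' := by unfold summand; ring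
  rw [h]; linarith

/-- Stability of the summands under a change of the first density. -/
lemma abs_summand_sub_le (hX : IsCompact X) (hp : IsBoundedMeasurable p)
    (hp' : IsBoundedMeasurable p') (hq : IsBoundedMeasurable q) (hI0 : 0 ≤ I)
    (hpI : ∫ x in X, |p x| ≤ I) (hqI : ∫ x in X, |q x| ≤ I) (x y : Euc d) :
    |P.summand X p q x y - P.summand X p' q x y|
      ≤ A ^ 2 * (2 + 2 * A * (1 + I)) * ((∫ t in X, |p t - p' t|) + |p x - p' x| + |p y - p' y|
        + ∫ t in X, |p t - p' t| * (|p t| + |q t|)) := by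
  have hA := P.nonneg
  have h1 := P.abs_influenceFst_sub_le hX hp hp' hq hpI x
  have h2 := P.abs_influenceSnd_sub_le hX hp hp' hq hqI y
  have h3 : |P.ph (P.inner X p q) - P.ph (P.inner X p' q)| ≤ A * (A * ∫ x in X, |p x - p' x|) := by
    refine (P.ph_lip _ _).trans (mul_le_mul_of_nonneg_left ?_ P.nonneg)
    simpa using P.abs_inner_sub_le hX hp hp' hq hq
  have h4 : P.summand X p q x y - P.summand X p' q x y
      = (P.ph (P.inner X p q) - P.ph (P.inner X p' q))
        + (P.influenceFst X p q x - P.influenceFst X p' q x)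
        + (P.influenceSnd X p q y - P.influenceSnd X p' q y) := by unfold summand; ring
  have h5 : ∫ t in X, |p t - p' t| * (|p t| + |q t|)
      = (∫ t in X, |p t - p' t| * |p t|) + ∫ t in X, |p t - p' t| * |q t| := by
    simp_rw [mul_add]
    exact integral_add (((hp.sub hp').abs.mul hp.abs).integrableOn hX)
      (((hp.sub hp').abs.mul hq.abs).integrableOn hX)
  rw [h4, h5]
  refine (abs_add_three _ _ _).trans ((add_le_add_three h3 h1 h2).trans ?_)
  set u := ∫ x in X, |p x - p' x|
  set v := ∫ t in X, |p t - p' t| * |p t|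
  set w := ∫ t in X, |p t - p' t| * |q t|
  have hu : 0 ≤ u := integral_nonneg fun _ => abs_nonneg _
  have hv : 0 ≤ v := integral_nonneg fun _ => mul_nonneg (abs_nonneg _) (abs_nonneg _)
  have hw : 0 ≤ w := integral_nonneg fun _ => mul_nonneg (abs_nonneg _) (abs_nonneg _)
  have hx := abs_nonneg (p x - p' x)
  have hy := abs_nonneg (p y - p' y)
  have hc : 0 ≤ A ^ 2 * (1 + 2 * A * (1 + I)) := by positivity
  have : A ^ 2 * (2 + 2 * A * (1 + I)) * (u + |p x - p' x| + |p y - p' y| + (v + w))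
      - (A * (A * u) + (A * (A * u) * (A + A * I) + A * (A * |p x - p' x| + A * (v + u)))
        + (A * (A * u) * (A + A * I) + A * (A * |p y - p' y| + A * w)))
      = A ^ 2 * (1 + 2 * A * (1 + I)) * (|p x - p' x| + |p y - p' y| + (v + w)) := by ring
  have h0 : 0 ≤ A ^ 2 * (1 + 2 * A * (1 + I)) * (|p x - p' x| + |p y - p' y| + (v + w)) :=
    mul_nonneg hc (by linarith)
  linarith

/-- Boundedness of the summands around the value of the functional at any `(f, g)`. -/
lemma abs_summand_sub_ph_le (hX : IsCompact X) (hp : IsBoundedMeasurable p)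
    (hq : IsBoundedMeasurable q) {f g : Euc d → ℝ} (hf : IsBoundedMeasurable f)
    (hg : IsBoundedMeasurable g)
    (hpI : ∫ x in X, |p x| ≤ I) (hqI : ∫ x in X, |q x| ≤ I) (hfI : ∫ x in X, |f x| ≤ I)
    (hgI : ∫ x in X, |g x| ≤ I) (x y : Euc d) :
    |P.summand X p q x y - P.ph (P.inner X f g)| ≤ A * (A * (4 * I)) + 2 * (A * (A + A * I)) := by
  have hA := P.nonneg
  have h1 := P.abs_influenceFst_le (q := q) hX hp hpI x
  have h2 := P.abs_influenceSnd_le (p := p) hX hq hqI y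
  have h3 : |P.ph (P.inner X p q) - P.ph (P.inner X f g)| ≤ A * (A * (4 * I)) := by
    refine (P.ph_lip _ _).trans (mul_le_mul_of_nonneg_left ?_ P.nonneg)
    refine (P.abs_inner_sub_le hX hp hf hq hg).trans (mul_le_mul_of_nonneg_left ?_ hA)
    calc ∫ x in X, (|p x - f x| + |q x - g x|)
        ≤ ∫ x in X, ((|p x| + |f x|) + (|q x| + |g x|)) :=
          integral_mono (((hp.sub hf).abs.add (hq.sub hg).abs).integrableOn hX)
            (((hp.abs.add hf.abs).add (hq.abs.add hg.abs)).integrableOn hX)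
            fun x => add_le_add (abs_sub _ _) (abs_sub _ _)
      _ ≤ 4 * I := by
          rw [integral_add ((hp.abs.add hf.abs).integrableOn hX) ((hq.abs.add hg.abs).integrableOn hX),
            integral_add (hp.abs.integrableOn hX) (hf.abs.integrableOn hX),
            integral_add (hq.abs.integrableOn hX) (hg.abs.integrableOn hX)]
          linarith
  have h4 : P.summand X p q x y - P.ph (P.inner X f g)
      = (P.ph (P.inner X p q) - P.ph (P.inner X f g)) + P.influenceFst X p q x
        + P.influenceSnd X p q y := by unfold summand; ring
  rw [h4]
  refine (abs_add_three _ _ _).trans ?_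
  linarith

lemma sq_setIntegral_le (hX : IsCompact X) {u : Euc d → ℝ} (hu : IsBoundedMeasurable u) :
    (∫ x in X, u x) ^ 2 ≤ volume.real X * ∫ x in X, u x ^ 2 := by
  have hfin : IsFiniteMeasure ((volume : Measure (Euc d)).restrict X) :=
    isFiniteMeasure_restrict.2 hX.measure_ne_top
  rcases eq_or_ne (volume X) 0 with h0 | h0
  · rw [setIntegral_measure_zero _ h0, setIntegral_measure_zero _ h0]; simp
  have hpos : 0 < volume.real X := ENNReal.toReal_pos h0 hX.measure_ne_top
  set J := ∫ x in X, u x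
  have hi := hu.integrableOn hX
  have hi2 : IntegrableOn (fun x => u x ^ 2) X :=
    ((hu.mul hu).integrableOn hX).congr (ae_of_all _ fun x => (pow_two _).symm)
  have h1 : ∫ x in X, (volume.real X * u x - J) ^ 2
      = volume.real X * (volume.real X * (∫ x in X, u x ^ 2) - J ^ 2) := by
    have : ∀ x, (volume.real X * u x - J) ^ 2
      = volume.real X ^ 2 * u x ^ 2 - 2 * volume.real X * J * u x + J ^ 2 := fun x => by ring
    simp_rw [this]
    have i3 : IntegrableOn (fun x => volume.real X ^ 2 * u x ^ 2 - 2 * volume.real X * J * u x) X :=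
      (hi2.const_mul _).sub (hi.const_mul _)
    rw [integral_add i3 (integrable_const _), integral_sub (hi2.const_mul _) (hi.const_mul _),
      integral_const_mul, integral_const_mul, setIntegral_const, smul_eq_mul]
    ring
  have h2 : 0 ≤ ∫ x in X, (volume.real X * u x - J) ^ 2 := integral_nonneg fun _ => sq_nonneg _
  rw [h1] at h2
  have := nonneg_of_mul_nonneg_right h2 hpos
  linarith

/-- The von Mises expansion: the error of the first-order expansion at `(p, q)` is bounded by the
squared distances. -/
lemma abs_expansion_sub_le {R J : Set ℝ} (hT : P.HasTaylor R J) (hX : IsCompact X)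
    (hp : IsBoundedMeasurable p) (hq : IsBoundedMeasurable q) {f g : Euc d → ℝ}
    (hf : IsBoundedMeasurable f) (hg : IsBoundedMeasurable g)
    (hpR : ∀ x ∈ X, p x ∈ R) (hqR : ∀ x ∈ X, q x ∈ R) (hfR : ∀ x ∈ X, f x ∈ R)
    (hgR : ∀ x ∈ X, g x ∈ R) (hpqJ : P.inner X p q ∈ J) (hfgJ : P.inner X f g ∈ J) :
    |P.ph (P.inner X p q) + P.dph (P.inner X p q)
        * (∫ x in X, (P.a (p x, q x) * (f x - p x) + P.b (p x, q x) * (g x - q x)))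
        - P.ph (P.inner X f g)|
      ≤ (2 * A ^ 3 * volume.real X + A ^ 2) * (sqDist X p f + sqDist X q g) := by
  have hA := P.nonneg
  set S := sqDist X p f + sqDist X q g with hS
  have hsq : ∀ {u w : Euc d → ℝ}, IsBoundedMeasurable u → IsBoundedMeasurable w →
      IntegrableOn (fun x => (u x - w x) ^ 2) X := fun hu hw =>
    (((hu.sub hw).mul (hu.sub hw)).integrableOn hX).congr (ae_of_all _ fun x => (pow_two _).symm)
  have hSeq : S = ∫ x in X, ((p x - f x) ^ 2 + (q x - g x) ^ 2) :=
    (integral_add (hsq hp hf) (hsq hq hg)).symm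
  -- the outer Taylor expansion
  have h1 : |P.inner X f g - P.inner X p q| ^ 2 ≤ A ^ 2 * (volume.real X * (2 * S)) := by
    have hle := P.abs_inner_sub_le hX hf hp hg hq
    have hb := (hf.sub hp).abs.add (hg.sub hq).abs
    refine (pow_le_pow_left₀ (abs_nonneg _) hle 2).trans ?_
    rw [mul_pow]
    refine mul_le_mul_of_nonneg_left ((sq_setIntegral_le hX hb).trans ?_) (by positivity)
    refine mul_le_mul_of_nonneg_left ?_ measureReal_nonneg
    rw [hSeq, ← integral_const_mul]
    refine integral_mono (((hb.mul hb).integrableOn hX).congr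
      (ae_of_all _ fun x => (pow_two _).symm)) (((hsq hp hf).add (hsq hq hg)).const_mul 2) fun x => ?_
    simp only
    refine add_sq_le.trans (le_of_eq ?_)
    rw [sq_abs, sq_abs, sub_sq_comm, sub_sq_comm (g x)]
  have h2 := hT.ph_taylor _ hpqJ _ hfgJ
  -- the inner Taylor expansion
  have ha := hp.comp_of_le P.measurable_a P.a_le hq
  have hb := hp.comp_of_le P.measurable_b P.b_le hq
  have hv1 := hp.comp_of_lip P.nonneg P.measurable_v P.v_lip hq
  have hv2 := hf.comp_of_lip P.nonneg P.measurable_v P.v_lip hg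
  have hlin := (ha.mul (hf.sub hp)).add (hb.mul (hg.sub hq))
  have h3 : |(P.inner X f g - P.inner X p q)
      - ∫ x in X, (P.a (p x, q x) * (f x - p x) + P.b (p x, q x) * (g x - q x))| ≤ A * S := by
    unfold inner
    rw [← integral_sub (hv2.integrableOn hX) (hv1.integrableOn hX),
      ← integral_sub ((hv2.sub hv1).integrableOn hX) (hlin.integrableOn hX), hSeq,
      ← integral_const_mul]
    rw [← Real.norm_eq_abs]
    refine norm_integral_le_of_norm_le (((hsq hp hf).add (hsq hq hg)).const_mul A) ?_
    refine (ae_restrict_iff' hX.measurableSet).2 (ae_of_all _ fun x hx => ?_)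
    have := hT.v_taylor (p x, q x) ⟨hpR x hx, hqR x hx⟩ (f x, g x) ⟨hfR x hx, hgR x hx⟩
    rw [sq_abs, sq_abs, sub_sq_comm, sub_sq_comm (g x), sub_sub] at this
    exact this
  set E := ∫ x in X, (P.a (p x, q x) * (f x - p x) + P.b (p x, q x) * (g x - q x))
  set V := P.inner X p q
  set V' := P.inner X f g
  have h4 : P.ph V + P.dph V * E - P.ph V'
      = -(P.ph V' - P.ph V - P.dph V * (V' - V)) - P.dph V * ((V' - V) - E) := by ring
  rw [h4]
  refine (abs_sub _ _).trans ?_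
  rw [abs_neg, abs_mul]
  have h5 : |P.dph V| * |V' - V - E| ≤ A * (A * S) :=
    mul_le_mul (P.dph_le _) h3 (abs_nonneg _) hA
  have h6 := mul_le_mul_of_nonneg_left h1 hA
  have e : A * (A ^ 2 * (volume.real X * (2 * S))) + A * (A * S)
    = (2 * A ^ 3 * volume.real X + A ^ 2) * S := by ring
  linarith

end PlugIn
end Pointwise

section Measurability
variable {d : ℕ} {X : Set (Euc d)} {A : ℝ} (P : PlugIn A) {Ω : Type*} [MeasurableSpace Ω]
  {p q : Ω → Euc d → ℝ}

lemma measurable_setIntegral_of_uncurry (X : Set (Euc d)) {F : Ω → Euc d → ℝ}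
    (hF : Measurable (Function.uncurry F)) : Measurable fun ω => ∫ t in X, F ω t :=
  (hF.stronglyMeasurable.integral_prod_right' (ν := volume.restrict X)).measurable

lemma PlugIn.measurable_inner (hp : Measurable (Function.uncurry p))
    (hq : Measurable (Function.uncurry q)) : Measurable fun ω => P.inner X (p ω) (q ω) := by
  refine measurable_setIntegral_of_uncurry X ?_
  exact P.measurable_v.comp (hp.prodMk hq)

lemma PlugIn.measurable_influenceFst (hX : MeasurableSet X) (hp : Measurable (Function.uncurry p))
    (hq : Measurable (Function.uncurry q)) {x : Ω → Euc d} (hx : Measurable x) :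
    Measurable fun ω => P.influenceFst X (p ω) (q ω) (x ω) := by
  have ha : Measurable fun z : Ω × Euc d => P.a (p z.1 z.2, q z.1 z.2) :=
    P.measurable_a.comp (hp.prodMk hq)
  have h1 : Measurable fun ω => P.dph (P.inner X (p ω) (q ω)) :=
    P.measurable_dph.comp (P.measurable_inner hp hq)
  have h2 : Measurable fun ω => ∫ t in X, P.a (p ω t, q ω t) * p ω t :=
    measurable_setIntegral_of_uncurry X (ha.mul hp)
  have h3 : Measurable fun ω => X.indicator (fun t => P.a (p ω t, q ω t)) (x ω) := by
    have h4 : Measurable fun ω => P.a (p ω (x ω), q ω (x ω)) :=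
      ha.comp (measurable_id.prodMk hx)
    exact h4.indicator (hx hX)
  exact h1.mul (h3.sub h2)

lemma PlugIn.measurable_influenceSnd (hX : MeasurableSet X) (hp : Measurable (Function.uncurry p))
    (hq : Measurable (Function.uncurry q)) {y : Ω → Euc d} (hy : Measurable y) :
    Measurable fun ω => P.influenceSnd X (p ω) (q ω) (y ω) :=
  P.swap.measurable_influenceFst hX hq hp hy

lemma PlugIn.measurable_summand (hX : MeasurableSet X) (hp : Measurable (Function.uncurry p))
    (hq : Measurable (Function.uncurry q)) {x y : Ω → Euc d} (hx : Measurable x)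
    (hy : Measurable y) : Measurable fun ω => P.summand X (p ω) (q ω) (x ω) (y ω) :=
  ((P.measurable_ph.comp (P.measurable_inner hp hq)).add
    (P.measurable_influenceFst hX hp hq hx)).add (P.measurable_influenceSnd hX hp hq hy)

end Measurability

/-! ### The mean of one summand of the estimator -/

section LooFacts
variable {d n : ℕ} {K : Euc d → ℝ} (k : EstimatorKind) {B' B : ℝ} {h : ℕ → ℝ}

lemma looDensity_update_self (x : Fin n → Euc d) (i : Fin n) (z : Euc d) :
    looDensity k B' B K h (Function.update x i z) i = looDensity k B' B K h x i := by
  ext t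
  simp only [looDensity, kde]
  congr 2
  refine Finset.sum_congr rfl fun j hj => ?_
  rw [Function.update_of_ne (Finset.ne_of_mem_erase hj)]

lemma isBoundedMeasurable_looDensity (hK : Measurable K) {M : ℝ} (hM : ∀ u, |K u| ≤ M)
    (hh : ∀ n, 0 < h n) (x : Fin n → Euc d) (i : Fin n) :
    IsBoundedMeasurable (looDensity k B' B K h x i) := by
  refine ⟨?_, _, fun t => abs_looDensity_le k hM hh x i t⟩
  have := measurable_looDensity (n := n) (h := h) (B' := B') (B := B) k hK i
  exact this.comp (g := fun p : (Fin n → Euc d) × Euc d => looDensity k B' B K h p.1 i p.2)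
    (f := fun t => (x, t)) (by fun_prop)

lemma integral_abs_kde_le (hKi : Integrable K) {h : ℝ} (hh : 0 < h) (S : Finset (Fin n))
    (x : Fin n → Euc d) : Integrable (kde K h S x) ∧ ∫ t, |kde K h S x t| ≤ ∫ u, |K u| := by
  have hi : ∀ j ∈ S, Integrable fun t => scaledKernel K h (t - x j) := fun j _ =>
    integrable_scaledKernel_sub_right hKi hh (x j)
  have he : kde K h S x = fun t => (S.card : ℝ)⁻¹ * ∑ j ∈ S, scaledKernel K h (t - x j) :=
    funext fun t => kde_eq_scaledKernel S x t
  have hint : Integrable (kde K h S x) := by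
    rw [he]; exact (integrable_finsetSum _ hi).const_mul _
  refine ⟨hint, ?_⟩
  calc ∫ t, |kde K h S x t|
      ≤ ∫ t, (S.card : ℝ)⁻¹ * ∑ j ∈ S, |scaledKernel K h (t - x j)| := by
        refine integral_mono hint.abs ((integrable_finsetSum _ fun j hj => (hi j hj).abs).const_mul _)
          fun t => ?_
        simp only
        rw [he, abs_mul, abs_of_nonneg (by positivity)]
        exact mul_le_mul_of_nonneg_left (Finset.abs_sum_le_sum_abs _ _) (by positivity)
    _ = (S.card : ℝ)⁻¹ * (S.card * ∫ u, |K u|) := by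
        rw [integral_const_mul, integral_finsetSum _ fun j hj => (hi j hj).abs,
          Finset.sum_congr rfl fun j _ => integral_abs_scaledKernel_sub_right hh (x j)]
        simp
    _ ≤ ∫ u, |K u| := by
        have h0 : 0 ≤ ∫ u, |K u| := integral_nonneg fun _ => abs_nonneg _
        rw [← mul_assoc]
        exact mul_le_of_le_one_left h0 (inv_mul_le_one)

lemma setIntegral_abs_looDensity_le {X : Set (Euc d)} (hX : IsCompact X) (hK : Measurable K)
    (hKi : Integrable K) {M : ℝ} (hM : ∀ u, |K u| ≤ M)
    (hh : ∀ n, 0 < h n) (x : Fin n → Euc d) (i : Fin n) :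
    ∫ t in X, |looDensity k B' B K h x i t| ≤ (|B'| + |B|) * volume.real X + ∫ u, |K u| := by
  have hfin : IsFiniteMeasure ((volume : Measure (Euc d)).restrict X) :=
    isFiniteMeasure_restrict.2 hX.measure_ne_top
  obtain ⟨hi, hle⟩ := integral_abs_kde_le hKi (hh (n - 1)) (Finset.univ.erase i) x
  calc ∫ t in X, |looDensity k B' B K h x i t|
      ≤ ∫ t in X, ((|B'| + |B|) + |kde K (h (n - 1)) (Finset.univ.erase i) x t|) :=
        integral_mono ((isBoundedMeasurable_looDensity k hK hM hh x i).abs.integrableOn hX)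
          ((integrable_const _).add hi.abs.integrableOn) fun t => k.abs_clip_le _
    _ = (|B'| + |B|) * volume.real X + ∫ t in X, |kde K (h (n - 1)) (Finset.univ.erase i) x t| := by
        rw [integral_add (integrable_const _) hi.abs.integrableOn, setIntegral_const, smul_eq_mul,
          mul_comm]
    _ ≤ _ := add_le_add le_rfl ((setIntegral_le_integral hi.abs
        (ae_of_all _ fun _ => abs_nonneg _)).trans hle)

end LooFacts

section Bias
variable {d : ℕ} {X : Set (Euc d)} {A : ℝ} (P : PlugIn A)

lemma lawOf_integral_influenceFst (hX : IsCompact X) {f : Euc d → ℝ} (hf : IsDensity f)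
    {p q : Euc d → ℝ} (hp : Measurable p) (hq : Measurable q) :
    ∫ z, P.influenceFst X p q z ∂(lawOf f)
      = P.dph (P.inner X p q) * ((∫ t in X, P.a (p t, q t) * f t) - ∫ t in X, P.a (p t, q t) * p t) := by
  rw [hf.integral_lawOf]
  exact FunctionalData.integral_mul_indicator_sub hX.measurableSet (fun _ => P.a_le _)
    (P.measurable_a.comp (hp.prodMk hq)) _ _ hf

/-- The observation at which the influence function is evaluated is independent of the density
estimates, so that its mean is an integral against the true density. -/
lemma integral_influenceFst (hX : IsCompact X) {n : ℕ} {Ω : Type*} [MeasurableSpace Ω]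
    (ρ : Measure Ω) [IsProbabilityMeasure ρ] {f : Euc d → ℝ} (hf : IsDensity f)
    {p : (Fin n → Euc d) → Euc d → ℝ} {q : Ω → Euc d → ℝ} (hp : Measurable (Function.uncurry p))
    (hq : Measurable (Function.uncurry q)) (hpb : ∀ x, IsBoundedMeasurable (p x))
    {I : ℝ} (hI : ∀ x, ∫ t in X, |p x t| ≤ I) (a : Fin n)
    (ha : ∀ x z, p (Function.update x a z) = p x) :
    ∫ w, P.influenceFst X (p w.1) (q w.2) (w.1 a) ∂((Measure.pi fun _ => lawOf f).prod ρ)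
      = ∫ w, P.dph (P.inner X (p w.1) (q w.2)) * ((∫ t in X, P.a (p w.1 t, q w.2 t) * f t)
          - ∫ t in X, P.a (p w.1 t, q w.2 t) * p w.1 t) ∂((Measure.pi fun _ => lawOf f).prod ρ) := by
  have := hf.isProbabilityMeasure
  have hp' : Measurable (Function.uncurry fun (w : (Fin n → Euc d) × Ω) t => p w.1 t) :=
    hp.comp (f := fun z : ((Fin n → Euc d) × Ω) × Euc d => (z.1.1, z.2)) (by fun_prop)
  have hq' : Measurable (Function.uncurry fun (w : (Fin n → Euc d) × Ω) t => q w.2 t) :=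
    hq.comp (f := fun z : ((Fin n → Euc d) × Ω) × Euc d => (z.1.2, z.2)) (by fun_prop)
  rw [integral_update_fst' (lawOf f) ρ a
    (P.measurable_influenceFst hX.measurableSet hp' hq' (by fun_prop))
    fun w => P.abs_influenceFst_le hX (hpb w.1) (hI w.1) _]
  congr 1 with w
  simp only [ha, Function.update_self]
  exact lawOf_integral_influenceFst P hX hf (hpb w.1).measurable (hq.of_uncurry_left (x := w.2))

/-- The mean of a summand differs from the functional by the mean squared errors of the two density
estimates: the first-order terms cancel. -/
lemma abs_integral_summand_sub_le {R J : Set ℝ} (hT : P.HasTaylor R J) (hX : IsCompact X)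
    {n m : ℕ} {f g : Euc d → ℝ} (hf : IsDensity f) (hg : IsDensity g)
    (hfb : IsBoundedMeasurable f) (hgb : IsBoundedMeasurable g)
    (hfR : ∀ x ∈ X, f x ∈ R) (hgR : ∀ x ∈ X, g x ∈ R)
    {p : (Fin n → Euc d) → Euc d → ℝ} {q : (Fin m → Euc d) → Euc d → ℝ}
    (hp : Measurable (Function.uncurry p)) (hq : Measurable (Function.uncurry q))
    (hpb : ∀ x, IsBoundedMeasurable (p x)) (hqb : ∀ y, IsBoundedMeasurable (q y))
    (hpR : ∀ x, ∀ t ∈ X, p x t ∈ R) (hqR : ∀ y, ∀ t ∈ X, q y t ∈ R)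
    (hpqJ : ∀ x y, P.inner X (p x) (q y) ∈ J) (hfgJ : P.inner X f g ∈ J)
    {I : ℝ} (hpI : ∀ x, ∫ t in X, |p x t| ≤ I) (hqI : ∀ y, ∫ t in X, |q y t| ≤ I)
    (hfI : ∫ t in X, |f t| ≤ I) (hgI : ∫ t in X, |g t| ≤ I)
    (a : Fin n) (b : Fin m)
    (ha : ∀ x z, p (Function.update x a z) = p x) (hb : ∀ y z, q (Function.update y b z) = q y)
    (hpi : Integrable (fun x => sqDist X (p x) f) (Measure.pi fun _ => lawOf f))
    (hqi : Integrable (fun y => sqDist X (q y) g) (Measure.pi fun _ => lawOf g)) :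
    |(∫ w, P.summand X (p w.1) (q w.2) (w.1 a) (w.2 b) ∂(sampleLaw f g n m)) - P.ph (P.inner X f g)|
      ≤ (2 * A ^ 3 * volume.real X + A ^ 2)
        * ((∫ x, sqDist X (p x) f ∂(Measure.pi fun _ => lawOf f))
          + ∫ y, sqDist X (q y) g ∂(Measure.pi fun _ => lawOf g)) := by
  have := hf.isProbabilityMeasure
  have := hg.isProbabilityMeasure
  unfold sampleLaw
  set μ := Measure.pi fun _ : Fin n => lawOf f
  set ρ := Measure.pi fun _ : Fin m => lawOf g
  have hp' : Measurable (Function.uncurry fun (w : (Fin n → Euc d) × (Fin m → Euc d)) t => p w.1 t) :=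
    hp.comp (f := fun z : ((Fin n → Euc d) × (Fin m → Euc d)) × Euc d => (z.1.1, z.2)) (by fun_prop)
  have hq' : Measurable (Function.uncurry fun (w : (Fin n → Euc d) × (Fin m → Euc d)) t => q w.2 t) :=
    hq.comp (f := fun z : ((Fin n → Euc d) × (Fin m → Euc d)) × Euc d => (z.1.2, z.2)) (by fun_prop)
  have hfm' : Measurable (Function.uncurry fun (_ : (Fin n → Euc d) × (Fin m → Euc d)) t => f t) :=
    hf.measurable.comp measurable_snd
  have hgm' : Measurable (Function.uncurry fun (_ : (Fin n → Euc d) × (Fin m → Euc d)) t => g t) :=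
    hg.measurable.comp measurable_snd
  set T := P.ph (P.inner X f g)
  have hA := P.nonneg
  -- integrability of the three parts of the summand
  have mF := P.measurable_influenceFst hX.measurableSet hp' hq'
    (x := fun w => w.1 a) (by fun_prop)
  have mS := P.measurable_influenceSnd hX.measurableSet hp' hq'
    (y := fun w => w.2 b) (by fun_prop)
  have m0 : Measurable fun w : (Fin n → Euc d) × (Fin m → Euc d) =>
      P.ph (P.inner X (p w.1) (q w.2)) - T :=
    (P.measurable_ph.comp (P.measurable_inner hp' hq')).sub_const _
  have bF : ∀ w : (Fin n → Euc d) × (Fin m → Euc d),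
      |P.influenceFst X (p w.1) (q w.2) (w.1 a)| ≤ A * (A + A * I) := fun w =>
    P.abs_influenceFst_le hX (hpb _) (hpI _) _
  have bS : ∀ w : (Fin n → Euc d) × (Fin m → Euc d),
      |P.influenceSnd X (p w.1) (q w.2) (w.2 b)| ≤ A * (A + A * I) := fun w =>
    P.abs_influenceSnd_le hX (hqb _) (hqI _) _
  have b0 : ∀ w : (Fin n → Euc d) × (Fin m → Euc d), |P.ph (P.inner X (p w.1) (q w.2)) - T|
      ≤ (A * (A * (4 * I)) + 2 * (A * (A + A * I))) + A * (A + A * I) + A * (A + A * I) := fun w => by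
    have h1 := P.abs_summand_sub_ph_le hX (hpb w.1) (hqb w.2) hfb hgb (hpI _) (hqI _) hfI hgI
      (w.1 a) (w.2 b)
    have h2 : P.ph (P.inner X (p w.1) (q w.2)) - T
        = (P.summand X (p w.1) (q w.2) (w.1 a) (w.2 b) - T)
          - P.influenceFst X (p w.1) (q w.2) (w.1 a) - P.influenceSnd X (p w.1) (q w.2) (w.2 b) := by
      unfold PlugIn.summand; ring
    rw [h2]
    exact (abs_sub _ _).trans (add_le_add ((abs_sub _ _).trans (add_le_add h1 (bF w))) (bS w))
  have iF : Integrable (fun w : (Fin n → Euc d) × (Fin m → Euc d) =>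
      P.influenceFst X (p w.1) (q w.2) (w.1 a)) (μ.prod ρ) := integrable_of_abs_le mF bF
  have iS : Integrable (fun w : (Fin n → Euc d) × (Fin m → Euc d) =>
      P.influenceSnd X (p w.1) (q w.2) (w.2 b)) (μ.prod ρ) := integrable_of_abs_le mS bS
  have i0 : Integrable (fun w : (Fin n → Euc d) × (Fin m → Euc d) =>
      P.ph (P.inner X (p w.1) (q w.2)) - T) (μ.prod ρ) := integrable_of_abs_le m0 b0
  -- the conditional means of the influence terms
  set GF : (Fin n → Euc d) × (Fin m → Euc d) → ℝ := fun w => P.dph (P.inner X (p w.1) (q w.2))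
    * ((∫ t in X, P.a (p w.1 t, q w.2 t) * f t) - ∫ t in X, P.a (p w.1 t, q w.2 t) * p w.1 t) with hGF
  set GS : (Fin n → Euc d) × (Fin m → Euc d) → ℝ := fun w => P.dph (P.inner X (p w.1) (q w.2))
    * ((∫ t in X, P.b (p w.1 t, q w.2 t) * g t) - ∫ t in X, P.b (p w.1 t, q w.2 t) * q w.2 t) with hGS
  have eF : ∫ w, P.influenceFst X (p w.1) (q w.2) (w.1 a) ∂(μ.prod ρ) = ∫ w, GF w ∂(μ.prod ρ) :=
    integral_influenceFst P hX ρ hf hp hq hpb hpI a ha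
  have eS : ∫ w, P.influenceSnd X (p w.1) (q w.2) (w.2 b) ∂(μ.prod ρ) = ∫ w, GS w ∂(μ.prod ρ) := by
    have h1 := integral_influenceFst P.swap hX μ hg hq hp hqb hqI b hb
    rw [← integral_prod_swap, ← integral_prod_swap (μ := μ)]
    exact h1
  have mdph := P.measurable_dph.comp (P.measurable_inner (X := X) hp' hq')
  have hga := P.measurable_a.comp (hp'.prodMk hq')
  have hgb' := P.measurable_b.comp (hp'.prodMk hq')
  have mGF : Measurable GF := mdph.mul
    ((measurable_setIntegral_of_uncurry X (hga.mul hfm')).sub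
      (measurable_setIntegral_of_uncurry X (hga.mul hp')))
  have mGS : Measurable GS := mdph.mul
    ((measurable_setIntegral_of_uncurry X (hgb'.mul hgm')).sub
      (measurable_setIntegral_of_uncurry X (hgb'.mul hq')))
  have bG : ∀ {e u v : ℝ}, |e| ≤ A → |u| ≤ A * I → |v| ≤ A * I → |e * (u - v)| ≤ A * (A * I + A * I) :=
    fun he hu hv => by
      rw [abs_mul]
      exact mul_le_mul he ((abs_sub _ _).trans (add_le_add hu hv)) (abs_nonneg _) hA
  have iGF : Integrable GF (μ.prod ρ) := integrable_of_abs_le mGF fun w => bG (P.dph_le _)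
    (PlugIn.abs_setIntegral_mul_le hX (fun _ => P.a_le _) hfb hfI hA)
    (PlugIn.abs_setIntegral_mul_le hX (fun _ => P.a_le _) (hpb _) (hpI _) hA)
  have iGS : Integrable GS (μ.prod ρ) := integrable_of_abs_le mGS fun w => bG (P.dph_le _)
    (PlugIn.abs_setIntegral_mul_le hX (fun _ => P.b_le _) hgb hgI hA)
    (PlugIn.abs_setIntegral_mul_le hX (fun _ => P.b_le _) (hqb _) (hqI _) hA)
  have hmain : (∫ w, P.summand X (p w.1) (q w.2) (w.1 a) (w.2 b) ∂(μ.prod ρ)) - T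
      = ∫ w, ((P.ph (P.inner X (p w.1) (q w.2)) - T) + GF w + GS w) ∂(μ.prod ρ) := by
    have h1 : ∀ w : (Fin n → Euc d) × (Fin m → Euc d),
        P.summand X (p w.1) (q w.2) (w.1 a) (w.2 b) = (P.ph (P.inner X (p w.1) (q w.2)) - T)
          + P.influenceFst X (p w.1) (q w.2) (w.1 a) + P.influenceSnd X (p w.1) (q w.2) (w.2 b)
          + T := fun w => by
      unfold PlugIn.summand; ring
    simp_rw [h1]
    have i1 : Integrable (fun w : (Fin n → Euc d) × (Fin m → Euc d) =>
        (P.ph (P.inner X (p w.1) (q w.2)) - T) + P.influenceFst X (p w.1) (q w.2) (w.1 a))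
        (μ.prod ρ) := i0.add iF
    have i2 : Integrable (fun w : (Fin n → Euc d) × (Fin m → Euc d) =>
        (P.ph (P.inner X (p w.1) (q w.2)) - T) + P.influenceFst X (p w.1) (q w.2) (w.1 a)
          + P.influenceSnd X (p w.1) (q w.2) (w.2 b)) (μ.prod ρ) := i1.add iS
    have i3 : Integrable (fun w : (Fin n → Euc d) × (Fin m → Euc d) =>
        (P.ph (P.inner X (p w.1) (q w.2)) - T) + GF w) (μ.prod ρ) := i0.add iGF
    rw [integral_add i2 (integrable_const _), integral_add i1 iS, integral_add i0 iF,
      integral_add i3 iGS, integral_add i0 iGF, eF, eS]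
    simp
  rw [hmain]
  have hpt : ∀ w : (Fin n → Euc d) × (Fin m → Euc d),
      |(P.ph (P.inner X (p w.1) (q w.2)) - T) + GF w + GS w|
        ≤ (2 * A ^ 3 * volume.real X + A ^ 2) * (sqDist X (p w.1) f + sqDist X (q w.2) g) := fun w => by
    have h1 := P.abs_expansion_sub_le hT hX (hpb w.1) (hqb w.2) hfb hgb (hpR _) (hqR _) hfR hgR
      (hpqJ _ _) hfgJ
    refine le_trans (le_of_eq ?_) h1
    have ha' := (hpb w.1).comp_of_le P.measurable_a P.a_le (hqb w.2)
    have hb' := (hpb w.1).comp_of_le P.measurable_b P.b_le (hqb w.2)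
    congr 1
    have h2 : ∫ x in X, (P.a (p w.1 x, q w.2 x) * (f x - p w.1 x)
          + P.b (p w.1 x, q w.2 x) * (g x - q w.2 x))
        = ((∫ t in X, P.a (p w.1 t, q w.2 t) * f t) - ∫ t in X, P.a (p w.1 t, q w.2 t) * p w.1 t)
        + ((∫ t in X, P.b (p w.1 t, q w.2 t) * g t)
          - ∫ t in X, P.b (p w.1 t, q w.2 t) * q w.2 t) := by
      rw [integral_add ((ha'.mul (hfb.sub (hpb _))).integrableOn hX)
        ((hb'.mul (hgb.sub (hqb _))).integrableOn hX),
        ← integral_sub ((ha'.mul hfb).integrableOn hX) ((ha'.mul (hpb _)).integrableOn hX),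
        ← integral_sub ((hb'.mul hgb).integrableOn hX) ((hb'.mul (hqb _)).integrableOn hX)]
      simp only [mul_sub]
    rw [h2, hGF, hGS]; ring
  have ip : Integrable (fun w : (Fin n → Euc d) × (Fin m → Euc d) => sqDist X (p w.1) f)
    (μ.prod ρ) := hpi.comp_fst ρ
  have iq : Integrable (fun w : (Fin n → Euc d) × (Fin m → Euc d) => sqDist X (q w.2) g)
    (μ.prod ρ) := hqi.comp_snd μ
  have ipq : Integrable (fun w : (Fin n → Euc d) × (Fin m → Euc d) =>
    sqDist X (p w.1) f + sqDist X (q w.2) g) (μ.prod ρ) := ip.add iq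
  rw [← Real.norm_eq_abs]
  refine (norm_integral_le_of_norm_le (ipq.const_mul _) (ae_of_all _ hpt)).trans (le_of_eq ?_)
  rw [integral_const_mul, integral_add ip iq, integral_fun_fst (f := fun x => sqDist X (p x) f),
    integral_fun_snd (f := fun x => sqDist X (q x) g)]
  simp

end Bias

/-! ### Cyclic sums -/

lemma sum_range_mul_ofNat {n : ℕ} [NeZero n] (u : Fin n → ℝ) (q : ℕ) :
    ∑ k ∈ Finset.range (n * q), u (Fin.ofNat n k) = q * ∑ a, u a := by
  induction q with
  | zero => simp
  | succ q ih =>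
    rw [Nat.mul_succ, Finset.sum_range_add, ih]
    have h1 : ∀ x : ℕ, Fin.ofNat n (n * q + x) = Fin.ofNat n x := fun x => by
      ext; simp [Fin.ofNat]
    have h2 : ∑ x ∈ Finset.range n, u (Fin.ofNat n x) = ∑ a, u a := by
      rw [Finset.sum_range]
      refine Finset.sum_congr rfl fun a _ => ?_
      congr 1
      ext; simp [Fin.ofNat, Nat.mod_eq_of_lt a.2]
    simp only [h1, h2]
    push_cast; ring

/-- Each index occurs at most `2 N / n` times among `N ≥ n` cyclic ones. -/
lemma sum_range_ofNat_le {n N : ℕ} [NeZero n] (hN : n ≤ N) {u : Fin n → ℝ} (hu : ∀ a, 0 ≤ u a) :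
    ∑ k ∈ Finset.range N, u (Fin.ofNat n k) ≤ N * (2 / n * ∑ a, u a) := by
  have hn : 0 < n := Nat.pos_of_ne_zero (NeZero.ne n)
  have hle : N ≤ n * (N / n + 1) := (Nat.lt_mul_div_succ N hn).le
  have hS : 0 ≤ ∑ a, u a := Finset.sum_nonneg fun a _ => hu a
  calc ∑ k ∈ Finset.range N, u (Fin.ofNat n k)
      ≤ ∑ k ∈ Finset.range (n * (N / n + 1)), u (Fin.ofNat n k) :=
        Finset.sum_le_sum_of_subset_of_nonneg (Finset.range_mono hle) fun _ _ _ => hu _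
    _ = ((N / n + 1 : ℕ) : ℝ) * ∑ a, u a := sum_range_mul_ofNat u _
    _ ≤ (N * (2 / n)) * ∑ a, u a := by
        refine mul_le_mul_of_nonneg_right ?_ hS
        have hn' : (0 : ℝ) < n := by exact_mod_cast hn
        have h1 : ((N / n : ℕ) : ℝ) ≤ N / n := Nat.cast_div_le
        have h2 : (1 : ℝ) ≤ N / n := by
          rw [le_div_iff₀ hn', one_mul]; exact_mod_cast hN
        push_cast
        have : (N : ℝ) * (2 / n) = N / n + N / n := by ring
        rw [this]; linarith
    _ = _ := by ring

/-! ### The effect of one observation on a density estimate -/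

section Stability
variable {d : ℕ} {K : Euc d → ℝ}

/-- A bound for the effect on `∑ⱼ K_h(t - xⱼ)`, `K_h` the kernel with bandwidth `h`, of moving one
observation from `z` to `x₀`. -/
noncomputable def kernelShift (K : Euc d → ℝ) (h : ℝ) (x₀ z t : Euc d) : ℝ :=
  |scaledKernel K h (t - z)| + |scaledKernel K h (t - x₀)|

/-- The contribution of another observation `t` to the bound for the effect of moving an observation
from `z` to `x₀`: the pointwise effect at `t`, and its integral over `X` against the kernel of
bandwidth `η` centred at `t`. -/
noncomputable def shiftWeight (X : Set (Euc d)) (K : Euc d → ℝ) (h η : ℝ) (x₀ z t : Euc d) : ℝ :=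
  kernelShift K h x₀ z t + ∫ τ in X, kernelShift K h x₀ z τ * |scaledKernel K η (τ - t)|

variable {h η : ℝ} {x₀ z : Euc d} {X : Set (Euc d)}

lemma kernelShift_nonneg (t : Euc d) : 0 ≤ kernelShift K h x₀ z t := by
  unfold kernelShift; positivity

lemma measurable_kernelShift (hK : Measurable K) : Measurable (kernelShift K h x₀ z) := by
  unfold kernelShift; fun_prop

lemma kernelShift_le {M : ℝ} (hM : ∀ u, |K u| ≤ M) (hh : 0 < h) (t : Euc d) :
    kernelShift K h x₀ z t ≤ 2 * (M / h ^ d) := by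
  unfold kernelShift
  linarith [abs_scaledKernel_le hM hh (t - z), abs_scaledKernel_le hM hh (t - x₀)]

lemma integrable_kernelShift (hKi : Integrable K) (hh : 0 < h) :
    Integrable (kernelShift K h x₀ z) :=
  (integrable_scaledKernel_sub_right hKi hh z).abs.add
    (integrable_scaledKernel_sub_right hKi hh x₀).abs

lemma integral_kernelShift (hKi : Integrable K) (hh : 0 < h) :
    ∫ t, kernelShift K h x₀ z t = 2 * ∫ u, |K u| := by
  unfold kernelShift
  rw [integral_add (integrable_scaledKernel_sub_right hKi hh z).abs
    (integrable_scaledKernel_sub_right hKi hh x₀).abs, integral_abs_scaledKernel_sub_right hh,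
    integral_abs_scaledKernel_sub_right hh, two_mul]

lemma setIntegral_kernelShift_le (hKi : Integrable K) (hh : 0 < h) :
    ∫ t in X, kernelShift K h x₀ z t ≤ 2 * ∫ u, |K u| :=
  (setIntegral_le_integral (integrable_kernelShift hKi hh)
    (ae_of_all _ fun _ => kernelShift_nonneg _)).trans (integral_kernelShift hKi hh).le

lemma shiftWeight_nonneg (t : Euc d) : 0 ≤ shiftWeight X K h η x₀ z t :=
  add_nonneg (kernelShift_nonneg _)
    (integral_nonneg fun _ => mul_nonneg (kernelShift_nonneg _) (abs_nonneg _))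

lemma measurable_kernelShift_mul (hK : Measurable K) :
    Measurable fun p : Euc d × Euc d =>
      kernelShift K h x₀ z p.2 * |scaledKernel K η (p.2 - p.1)| := by
  have h1 := measurable_kernelShift (h := h) (x₀ := x₀) (z := z) hK
  have h2 := measurable_scaledKernel (h := η) hK
  fun_prop

lemma measurable_shiftWeight (hK : Measurable K) : Measurable (shiftWeight X K h η x₀ z) :=
  (measurable_kernelShift hK).add
    (measurable_setIntegral_of_uncurry X (F := fun t τ =>
      kernelShift K h x₀ z τ * |scaledKernel K η (τ - t)|) (measurable_kernelShift_mul hK))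

lemma integrable_kernelShift_mul (hK : Measurable K) (hKi : Integrable K) {M : ℝ}
    (hM : ∀ u, |K u| ≤ M) (hh : 0 < h) (hη : 0 < η) (t : Euc d) :
    Integrable fun τ => kernelShift K h x₀ z τ * |scaledKernel K η (τ - t)| := by
  have h2 := measurable_scaledKernel (h := η) hK
  refine (integrable_kernelShift hKi hh).mul_bdd (c := M / η ^ d)
    (Measurable.aestronglyMeasurable (by fun_prop)) (ae_of_all _ fun τ => ?_)
  rw [Real.norm_eq_abs, abs_abs]
  exact abs_scaledKernel_le hM hη _

lemma shiftWeight_le (hK : Measurable K) (hKi : Integrable K) {M : ℝ} (hM : ∀ u, |K u| ≤ M)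
    (hh : 0 < h) (hη : 0 < η) (t : Euc d) :
    shiftWeight X K h η x₀ z t ≤ 2 * (M / h ^ d) * (1 + ∫ u, |K u|) := by
  have h1 := kernelShift_le (x₀ := x₀) (z := z) hM hh t
  have h2 : ∫ τ in X, kernelShift K h x₀ z τ * |scaledKernel K η (τ - t)|
      ≤ 2 * (M / h ^ d) * ∫ u, |K u| := by
    calc ∫ τ in X, kernelShift K h x₀ z τ * |scaledKernel K η (τ - t)|
        ≤ ∫ τ, kernelShift K h x₀ z τ * |scaledKernel K η (τ - t)| :=
          setIntegral_le_integral (integrable_kernelShift_mul hK hKi hM hh hη t)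
            (ae_of_all _ fun τ => mul_nonneg (kernelShift_nonneg _) (abs_nonneg _))
      _ ≤ ∫ τ, 2 * (M / h ^ d) * |scaledKernel K η (τ - t)| :=
          integral_mono (integrable_kernelShift_mul hK hKi hM hh hη t)
            ((integrable_scaledKernel_sub_right hKi hη t).abs.const_mul _) fun τ =>
            mul_le_mul_of_nonneg_right (kernelShift_le hM hh τ) (abs_nonneg _)
      _ = _ := by rw [integral_const_mul, integral_abs_scaledKernel_sub_right hη]
  unfold shiftWeight
  linarith

lemma integrable_shiftWeight (hK : Measurable K) (hKi : Integrable K) (hh : 0 < h) (hη : 0 < η) :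
    Integrable (shiftWeight X K h η x₀ z) ∧
      ∫ t, shiftWeight X K h η x₀ z t ≤ 2 * (∫ u, |K u|) * (1 + ∫ u, |K u|) := by
  have hκi := integrable_kernelShift (x₀ := x₀) (z := z) hKi hh
  have hκX : IntegrableOn (kernelShift K h x₀ z) X := hκi.integrableOn
  have hm : AEStronglyMeasurable (fun p : Euc d × Euc d =>
      kernelShift K h x₀ z p.2 * |scaledKernel K η (p.2 - p.1)|)
      (volume.prod (volume.restrict X)) := (measurable_kernelShift_mul hK).aestronglyMeasurable
  have hnorm : ∀ τ, ∫ t, ‖kernelShift K h x₀ z τ * |scaledKernel K η (τ - t)|‖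
      = kernelShift K h x₀ z τ * ∫ u, |K u| := fun τ => by
    simp_rw [norm_mul, Real.norm_eq_abs, abs_abs]
    rw [integral_const_mul, integral_abs_scaledKernel_sub_left hη, abs_of_nonneg (kernelShift_nonneg _)]
  have hi : Integrable (fun p : Euc d × Euc d =>
      kernelShift K h x₀ z p.2 * |scaledKernel K η (p.2 - p.1)|)
      (volume.prod (volume.restrict X)) := by
    have h1 : ∀ τ, Integrable fun t => kernelShift K h x₀ z τ * |scaledKernel K η (τ - t)| := fun τ =>
      (integrable_scaledKernel_sub_left hKi hη τ).abs.const_mul _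
    refine (integrable_prod_iff' hm).2 ⟨ae_of_all _ h1, ?_⟩
    simp_rw [hnorm]
    exact hκX.mul_const _
  have hi1 : Integrable (fun t => ∫ τ in X, kernelShift K h x₀ z τ * |scaledKernel K η (τ - t)|) :=
    hi.integral_prod_left
  refine ⟨hκi.add hi1, ?_⟩
  unfold shiftWeight
  rw [integral_add hκi hi1, integral_kernelShift hKi hh]
  have e : ∫ t, ∫ τ in X, kernelShift K h x₀ z τ * |scaledKernel K η (τ - t)|
      = (∫ τ in X, kernelShift K h x₀ z τ) * ∫ u, |K u| := by
    rw [integral_integral_swap hi, ← integral_mul_const]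
    congr 1 with τ
    rw [integral_const_mul, integral_abs_scaledKernel_sub_left hη]
  rw [e]
  have h0 : 0 ≤ ∫ u, |K u| := integral_nonneg fun _ => abs_nonneg _
  have h1 := mul_le_mul_of_nonneg_right
    (setIntegral_kernelShift_le (X := X) (x₀ := x₀) (z := z) hKi hh) h0
  linarith

end Stability

lemma inv_natCast_sub_one_le {n : ℕ} (hn : 2 ≤ n) : ((n - 1 : ℕ) : ℝ)⁻¹ ≤ 2 / n := by
  have hn1 : (0 : ℝ) < ((n - 1 : ℕ) : ℝ) := by exact_mod_cast (by omega : 0 < n - 1)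
  have hn0 : (0 : ℝ) < n := by exact_mod_cast (by omega : 0 < n)
  rw [inv_eq_one_div, div_le_div_iff₀ hn1 hn0]
  have : (2 : ℝ) ≤ n := by exact_mod_cast hn
  rw [Nat.cast_sub (by omega)]; push_cast; linarith

section LooStability
variable {d n : ℕ} {K : Euc d → ℝ} (k : EstimatorKind) {B' B : ℝ} {h : ℕ → ℝ}

/-- The effect on a leave-one-out density estimate of moving one of the observations used. -/
lemma abs_looDensity_sub_update_le (hn : 2 ≤ n) (x : Fin n → Euc d) (i a : Fin n)
    (x₀ t : Euc d) :
    |looDensity k B' B K h x a t - looDensity k B' B K h (Function.update x i x₀) a t|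
      ≤ 2 / n * kernelShift K (h (n - 1)) x₀ (x i) t := by
  have hinv := inv_natCast_sub_one_le hn
  refine (k.abs_clip_sub_le _ _).trans ?_
  rw [kde_eq_scaledKernel, kde_eq_scaledKernel, ← mul_sub, abs_mul, ← Finset.sum_sub_distrib,
    abs_of_nonneg (by positivity), Finset.card_erase_of_mem (Finset.mem_univ a), Finset.card_univ,
    Fintype.card_fin]
  refine mul_le_mul hinv ?_ (abs_nonneg _) (by positivity)
  refine (Finset.abs_sum_le_sum_abs _ _).trans ?_
  refine (Finset.sum_le_univ_sum_of_nonneg fun _ => abs_nonneg _).trans ?_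
  rw [Finset.sum_eq_single i]
  · rw [Function.update_self]
    exact abs_sub _ _
  · intro j _ hj
    rw [Function.update_of_ne hj, sub_self, abs_zero]
  · simp

lemma abs_looDensity_le_sum (hn : 2 ≤ n) (x : Fin n → Euc d) (a : Fin n) (t : Euc d) :
    |looDensity k B' B K h x a t|
      ≤ |B'| + |B| + 2 / n * ∑ j, |scaledKernel K (h (n - 1)) (t - x j)| := by
  have hinv := inv_natCast_sub_one_le hn
  refine (k.abs_clip_le _).trans (add_le_add le_rfl ?_)
  rw [kde_eq_scaledKernel, abs_mul, abs_of_nonneg (by positivity),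
    Finset.card_erase_of_mem (Finset.mem_univ a), Finset.card_univ, Fintype.card_fin]
  refine mul_le_mul hinv ((Finset.abs_sum_le_sum_abs _ _).trans
    (Finset.sum_le_univ_sum_of_nonneg fun _ => abs_nonneg _)) (abs_nonneg _) (by positivity)

end LooStability

/-! ### The effect of one observation on the estimator -/

/-- The assumptions on the kernel, the bandwidths and the domain that the stability and variance
bounds use, with a bound `M` for the kernel. -/
structure KernelSetup {d : ℕ} (X : Set (Euc d)) (K : Euc d → ℝ) (M : ℝ) (hf hg : ℕ → ℝ) :
    Prop where
  compact : IsCompact X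
  measurable : Measurable K
  integrable : Integrable K
  bound : ∀ u, |K u| ≤ M
  pos_fst : ∀ n, 0 < hf n
  pos_snd : ∀ n, 0 < hg n

lemma KernelSetup.swap {d : ℕ} {X : Set (Euc d)} {K : Euc d → ℝ} {M : ℝ} {hf hg : ℕ → ℝ}
    (h : KernelSetup X K M hf hg) : KernelSetup X K M hg hf :=
  ⟨h.compact, h.measurable, h.integrable, h.bound, h.pos_snd, h.pos_fst⟩

/-- The leave-one-out estimator with the influence functions given by their explicit formula. -/
noncomputable def plugInEstimator {d : ℕ} {A : ℝ} (P : PlugIn A) (X : Set (Euc d))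
    (k : EstimatorKind) (B' B : ℝ) (K : Euc d → ℝ) (hf hg : ℕ → ℝ) {n m : ℕ} [NeZero n] [NeZero m]
    (w : (Fin n → Euc d) × (Fin m → Euc d)) : ℝ :=
  looEstimator (fun p q => P.ph (P.inner X p q)) (P.influenceFst X) (P.influenceSnd X)
    (looDensity k B' B K hf) (looDensity k B' B K hg) w.1 w.2

section Estimator
variable {d : ℕ} {A : ℝ} (P : PlugIn A) {X : Set (Euc d)}
    (k : EstimatorKind) {B' B : ℝ} {K : Euc d → ℝ} {M : ℝ} {hf hg : ℕ → ℝ} {n m : ℕ}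

lemma plugInEstimator_eq [NeZero n] [NeZero m] (w : (Fin n → Euc d) × (Fin m → Euc d)) :
    plugInEstimator P X k B' B K hf hg w = 1 / ((max n m : ℕ) : ℝ) * ∑ i ∈ Finset.range (max n m),
      P.summand X (looDensity k B' B K hf w.1 (Fin.ofNat n i))
        (looDensity k B' B K hg w.2 (Fin.ofNat m i)) (w.1 (Fin.ofNat n i)) (w.2 (Fin.ofNat m i)) :=
  rfl

lemma plugInEstimator_swap [NeZero n] [NeZero m] (w : (Fin n → Euc d) × (Fin m → Euc d)) :
    plugInEstimator P.swap X k B' B K hg hf w.swap = plugInEstimator P X k B' B K hf hg w := by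
  simp only [plugInEstimator_eq, Prod.fst_swap, Prod.snd_swap, PlugIn.summand_swap, max_comm m n]

/-- A bound for the `L¹(X)` norms of the density estimates. -/
noncomputable def l1Bound (X : Set (Euc d)) (K : Euc d → ℝ) (B' B : ℝ) : ℝ :=
  (|B'| + |B|) * volume.real X + ∫ u, |K u|

lemma l1Bound_nonneg : 0 ≤ l1Bound X K B' B := by
  have : 0 ≤ ∫ u, |K u| := integral_nonneg fun _ => abs_nonneg _
  have h2 : 0 ≤ volume.real X := measureReal_nonneg
  unfold l1Bound; positivity

lemma KernelSetup.isBoundedMeasurable (H : KernelSetup X K M hf hg) (x : Fin n → Euc d)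
    (a : Fin n) : IsBoundedMeasurable (looDensity k B' B K hf x a) :=
  isBoundedMeasurable_looDensity k H.measurable H.bound H.pos_fst x a

lemma KernelSetup.setIntegral_abs_le (H : KernelSetup X K M hf hg) (x : Fin n → Euc d)
    (a : Fin n) : ∫ t in X, |looDensity k B' B K hf x a t| ≤ l1Bound X K B' B :=
  setIntegral_abs_looDensity_le k H.compact H.measurable H.integrable H.bound H.pos_fst x a

lemma setIntegral_mul_sum (H : KernelSetup X K M hf hg) {h η : ℝ} (hh : 0 < h) (hη : 0 < η)
    (x₀ z : Euc d) {N : ℕ} (S : Finset (Fin N)) (x : Fin N → Euc d) :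
    IntegrableOn (fun t => kernelShift K h x₀ z t * ∑ j ∈ S, |scaledKernel K η (t - x j)|) X ∧
    ∫ t in X, kernelShift K h x₀ z t * ∑ j ∈ S, |scaledKernel K η (t - x j)|
      = ∑ j ∈ S, ∫ t in X, kernelShift K h x₀ z t * |scaledKernel K η (t - x j)| := by
  have hi : ∀ j ∈ S, IntegrableOn
      (fun t => kernelShift K h x₀ z t * |scaledKernel K η (t - x j)|) X := fun j _ =>
    (integrable_kernelShift_mul H.measurable H.integrable H.bound hh hη (x j)).integrableOn
  simp_rw [Finset.mul_sum]
  exact ⟨integrable_finsetSum _ hi, integral_finsetSum _ hi⟩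

/-- The effect on a summand of moving an observation other than the one left out. -/
lemma abs_summand_sub_update_le (H : KernelSetup X K M hf hg) (hn : 2 ≤ n) (hm : 2 ≤ m)
    {M₁ : ℝ} (hM₁ : 2 / n * (M / hf (n - 1) ^ d) ≤ M₁)
    (x : Fin n → Euc d) (y : Fin m → Euc d) (i a : Fin n) (b : Fin m) (x₀ : Euc d) :
    |P.summand X (looDensity k B' B K hf x a) (looDensity k B' B K hg y b) (x a) (y b)
      - P.summand X (looDensity k B' B K hf (Function.update x i x₀) a)
          (looDensity k B' B K hg y b) (x a) (y b)|
      ≤ A ^ 2 * (2 + 2 * A * (1 + l1Bound X K B' B)) * (2 / n *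
        (2 * (∫ u, |K u|) * (1 + 2 * (|B'| + |B|) + M₁)
          + kernelShift K (hf (n - 1)) x₀ (x i) (x a) + kernelShift K (hf (n - 1)) x₀ (x i) (y b)
          + (2 / n * ∑ j ∈ Finset.univ.erase i, ∫ t in X,
              kernelShift K (hf (n - 1)) x₀ (x i) t * |scaledKernel K (hf (n - 1)) (t - x j)|)
          + 2 / m * ∑ j, ∫ t in X,
              kernelShift K (hf (n - 1)) x₀ (x i) t * |scaledKernel K (hg (m - 1)) (t - y j)|)) := by
  have hA := P.nonneg
  have hI0 : 0 ≤ l1Bound X K B' B := l1Bound_nonneg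
  set h := hf (n - 1) with hh
  set η := hg (m - 1) with hη
  have hh0 : 0 < h := H.pos_fst _
  have hη0 : 0 < η := H.pos_snd _
  set p := looDensity k B' B K hf x a with hp
  set p' := looDensity k B' B K hf (Function.update x i x₀) a with hp'
  set q := looDensity k B' B K hg y b with hq
  have bp : IsBoundedMeasurable p := H.isBoundedMeasurable k x a
  have bp' : IsBoundedMeasurable p' := H.isBoundedMeasurable k _ a
  have bq : IsBoundedMeasurable q := H.swap.isBoundedMeasurable k y b
  set κ : Euc d → ℝ := kernelShift K h x₀ (x i) with hκ
  have hδ : ∀ t, |p t - p' t| ≤ 2 / n * κ t := fun t =>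
    abs_looDensity_sub_update_le k hn x i a x₀ t
  have hκ0 : ∀ t, 0 ≤ κ t := fun t => kernelShift_nonneg t
  have hκi : IntegrableOn κ X := (integrable_kernelShift H.integrable hh0).integrableOn
  have hκI : ∫ t in X, κ t ≤ 2 * ∫ u, |K u| := setIntegral_kernelShift_le H.integrable hh0
  have hIK : 0 ≤ ∫ u, |K u| := integral_nonneg fun _ => abs_nonneg _
  have hn0 : (0 : ℝ) ≤ 2 / n := by positivity
  have hn0' : (0 : ℝ) ≤ 2 / m := by positivity
  -- the pointwise bound on the density estimates: the moved observation contributes at most `M₁`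
  have hpt : ∀ t, |p t| + |q t| ≤ (2 * (|B'| + |B|) + M₁)
      + 2 / n * (∑ j ∈ Finset.univ.erase i, |scaledKernel K h (t - x j)|)
      + 2 / m * ∑ j, |scaledKernel K η (t - y j)| := fun t => by
    have h1 := abs_looDensity_le_sum (K := K) (B' := B') (B := B) (h := hf) k hn x a t
    have h2 := abs_looDensity_le_sum (K := K) (B' := B') (B := B) (h := hg) k hm y b t
    rw [← Finset.add_sum_erase _ _ (Finset.mem_univ i), mul_add] at h1
    have h3 : 2 / (n : ℝ) * |scaledKernel K h (t - x i)| ≤ M₁ :=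
      (mul_le_mul_of_nonneg_left (abs_scaledKernel_le H.bound hh0 _) hn0).trans hM₁
    linarith
  have e1 := setIntegral_mul_sum H hh0 hh0 x₀ (x i) (Finset.univ.erase i) x
  have e2 := setIntegral_mul_sum H hh0 hη0 x₀ (x i) Finset.univ y
  have hw : ∫ t in X, |p t - p' t| * (|p t| + |q t|) ≤ 2 / n * ((2 * (|B'| + |B|) + M₁)
      * (2 * ∫ u, |K u|)
      + (2 / n * ∑ j ∈ Finset.univ.erase i, ∫ t in X, κ t * |scaledKernel K h (t - x j)|)
      + 2 / m * ∑ j, ∫ t in X, κ t * |scaledKernel K η (t - y j)|) := by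
    calc ∫ t in X, |p t - p' t| * (|p t| + |q t|)
        ≤ ∫ t in X, 2 / n * ((2 * (|B'| + |B|) + M₁) * κ t
          + 2 / n * (κ t * ∑ j ∈ Finset.univ.erase i, |scaledKernel K h (t - x j)|)
          + 2 / m * (κ t * ∑ j, |scaledKernel K η (t - y j)|)) := by
          refine integral_mono (((bp.sub bp').abs.mul (bp.abs.add bq.abs)).integrableOn H.compact)
            ((((hκi.const_mul _).add (e1.1.const_mul _)).add (e2.1.const_mul _)).const_mul _)
            fun t => ?_
          refine (mul_le_mul (hδ t) (hpt t) (by positivity)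
            (mul_nonneg hn0 (hκ0 t))).trans (le_of_eq ?_)
          ring
      _ = 2 / n * ((2 * (|B'| + |B|) + M₁) * (∫ t in X, κ t)
          + (2 / n * ∑ j ∈ Finset.univ.erase i, ∫ t in X, κ t * |scaledKernel K h (t - x j)|)
          + 2 / m * ∑ j, ∫ t in X, κ t * |scaledKernel K η (t - y j)|) := by
          have i1 : IntegrableOn (fun t => (2 * (|B'| + |B|) + M₁) * κ t
            + 2 / n * (κ t * ∑ j ∈ Finset.univ.erase i, |scaledKernel K h (t - x j)|)) X :=
            (hκi.const_mul _).add (e1.1.const_mul _)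
          rw [integral_const_mul, integral_add i1 (e2.1.const_mul _),
            integral_add (hκi.const_mul _) (e1.1.const_mul _), integral_const_mul,
            integral_const_mul, integral_const_mul, e1.2, e2.2]
      _ ≤ _ := by
          have hM1 : 0 ≤ M₁ := le_trans (mul_nonneg hn0 (div_nonneg
            ((abs_nonneg _).trans (H.bound 0)) (by positivity))) hM₁
          gcongr
  have hu : ∫ t in X, |p t - p' t| ≤ 2 / n * (2 * ∫ u, |K u|) := by
    refine (integral_mono ((bp.sub bp').abs.integrableOn H.compact) (hκi.const_mul _) hδ).trans ?_
    rw [integral_const_mul]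
    exact mul_le_mul_of_nonneg_left hκI hn0
  refine (P.abs_summand_sub_le H.compact bp bp' bq hI0 (H.setIntegral_abs_le k x a)
    (H.swap.setIntegral_abs_le k y b) (x a) (y b)).trans ?_
  refine mul_le_mul_of_nonneg_left ?_ (by positivity)
  have h1 := hδ (x a)
  have h2 := hδ (y b)
  linarith

/-- The constant part of the stability bound. -/
noncomputable def stabilityConst (A I IK M₀ M₁ : ℝ) : ℝ :=
  2 * A ^ 2 + A ^ 2 * (2 + 2 * A * (1 + I)) * (2 * IK * (1 + 2 * M₀ + M₁))

/-- The effect on the estimator of moving one observation. -/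
lemma abs_plugInEstimator_sub_update_le [NeZero n] [NeZero m]
    (H : KernelSetup X K M hf hg) (hn : 2 ≤ n) (hm : 2 ≤ m)
    {M₁ : ℝ} (hM₁ : 2 / n * (M / hf (n - 1) ^ d) ≤ M₁)
    (x : Fin n → Euc d) (y : Fin m → Euc d) (i : Fin n) (x₀ : Euc d) :
    |plugInEstimator P X k B' B K hf hg (x, y)
        - plugInEstimator P X k B' B K hf hg (Function.update x i x₀, y)|
      ≤ 2 / n * (stabilityConst A (l1Bound X K B' B) (∫ u, |K u|) (|B'| + |B|) M₁
        + A ^ 2 * (2 + 2 * A * (1 + l1Bound X K B' B)) *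
          ((2 / n * ∑ j ∈ Finset.univ.erase i,
              shiftWeight X K (hf (n - 1)) (hf (n - 1)) x₀ (x i) (x j))
            + 2 / m * ∑ j, shiftWeight X K (hf (n - 1)) (hg (m - 1)) x₀ (x i) (y j))) := by
  have hA := P.nonneg
  have hI0 : 0 ≤ l1Bound X K B' B := l1Bound_nonneg
  set C₀ := A ^ 2 * (2 + 2 * A * (1 + l1Bound X K B' B)) with hC₀
  have hC₀0 : 0 ≤ C₀ := by positivity
  have hIK : 0 ≤ ∫ u, |K u| := integral_nonneg fun _ => abs_nonneg _
  have hn0 : (0 : ℝ) ≤ 2 / n := by positivity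
  have hM1 : 0 ≤ M₁ := le_trans (mul_nonneg hn0 (div_nonneg
    ((abs_nonneg _).trans (H.bound 0)) (pow_nonneg (H.pos_fst _).le _))) hM₁
  set κ : Euc d → ℝ := kernelShift K (hf (n - 1)) x₀ (x i) with hκ
  have hκ0 : ∀ t, 0 ≤ κ t := fun t => kernelShift_nonneg t
  set c1 : Euc d → ℝ := fun s => ∫ t in X, κ t * |scaledKernel K (hf (n - 1)) (t - s)| with hc1
  set c2 : Euc d → ℝ := fun s => ∫ t in X, κ t * |scaledKernel K (hg (m - 1)) (t - s)| with hc2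
  have hc1n : ∀ s, 0 ≤ c1 s := fun s => integral_nonneg fun t => mul_nonneg (hκ0 t) (abs_nonneg _)
  have hc2n : ∀ s, 0 ≤ c2 s := fun s => integral_nonneg fun t => mul_nonneg (hκ0 t) (abs_nonneg _)
  have hs1 : 0 ≤ ∑ j ∈ Finset.univ.erase i, c1 (x j) := Finset.sum_nonneg fun _ _ => hc1n _
  have hs2 : 0 ≤ ∑ j, c2 (y j) := Finset.sum_nonneg fun _ _ => hc2n _
  set G : ℝ := 2 * (∫ u, |K u|) * (1 + 2 * (|B'| + |B|) + M₁)
    + (2 / n * ∑ j ∈ Finset.univ.erase i, c1 (x j)) + 2 / m * ∑ j, c2 (y j) with hG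
  have hG0 : 0 ≤ G := by positivity
  -- a bound of each summand by functions of the two indices
  set u1 : Fin n → ℝ := fun a => if a = i then 2 * A ^ 2 else C₀ * (2 / n) * κ (x a) with hu1
  set u2 : Fin m → ℝ := fun b => C₀ * (2 / n) * κ (y b) with hu2
  have hu1n : ∀ a, 0 ≤ u1 a := fun a => by
    simp only [hu1]; split_ifs
    · positivity
    · exact mul_nonneg (by positivity) (hκ0 _)
  have hu2n : ∀ b, 0 ≤ u2 b := fun b => mul_nonneg (by positivity) (hκ0 _)
  have hpair : ∀ (a : Fin n) (b : Fin m),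
      |P.summand X (looDensity k B' B K hf x a) (looDensity k B' B K hg y b) (x a) (y b)
      - P.summand X (looDensity k B' B K hf (Function.update x i x₀) a)
          (looDensity k B' B K hg y b) (Function.update x i x₀ a) (y b)|
      ≤ u1 a + u2 b + C₀ * (2 / n) * G := by
    intro a b
    by_cases hai : a = i
    · subst hai
      rw [looDensity_update_self, Function.update_self]
      refine (P.abs_summand_sub_point_le _ _ _).trans ?_
      have h1 : u1 a = 2 * A ^ 2 := by simp [hu1]
      have h2 : 0 ≤ C₀ * (2 / n) * G := by positivity
      linarith [hu2n b]
    · rw [Function.update_of_ne hai]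
      refine (abs_summand_sub_update_le P k H hn hm hM₁ x y i a b x₀).trans (le_of_eq ?_)
      have h1 : u1 a = C₀ * (2 / n) * κ (x a) := by simp [hu1, hai]
      rw [h1, hG]
      ring
  have hN1 : n ≤ max n m := le_max_left _ _
  have hN2 : m ≤ max n m := le_max_right _ _
  set N := max n m with hN
  have hN0 : (0 : ℝ) < N := by
    have : 0 < N := by omega
    exact_mod_cast this
  rw [plugInEstimator_eq, plugInEstimator_eq, ← hN, ← mul_sub, ← Finset.sum_sub_distrib, abs_mul,
    abs_of_pos (by positivity), one_div, inv_mul_le_iff₀ hN0]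
  refine (Finset.abs_sum_le_sum_abs _ _).trans ((Finset.sum_le_sum fun j _ => hpair _ _).trans ?_)
  rw [Finset.sum_add_distrib, Finset.sum_add_distrib, Finset.sum_const, Finset.card_range,
    nsmul_eq_mul]
  refine (add_le_add_left (add_le_add (sum_range_ofNat_le hN1 hu1n)
    (sum_range_ofNat_le hN2 hu2n)) _).trans ?_
  rw [← mul_add, ← mul_add]
  refine mul_le_mul_of_nonneg_left (le_of_eq ?_) hN0.le
  have e1 : ∑ a, u1 a = 2 * A ^ 2 + C₀ * (2 / n) * ∑ j ∈ Finset.univ.erase i, κ (x j) := by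
    rw [← Finset.add_sum_erase _ _ (Finset.mem_univ i), Finset.mul_sum]
    congr 1
    · simp [hu1]
    · exact Finset.sum_congr rfl fun j hj => by simp [hu1, Finset.ne_of_mem_erase hj]
  have e2 : ∑ b, u2 b = C₀ * (2 / n) * ∑ j, κ (y j) := by rw [Finset.mul_sum]
  have e3 : ∑ j ∈ Finset.univ.erase i, shiftWeight X K (hf (n - 1)) (hf (n - 1)) x₀ (x i) (x j)
      = (∑ j ∈ Finset.univ.erase i, κ (x j)) + ∑ j ∈ Finset.univ.erase i, c1 (x j) :=
    Finset.sum_add_distrib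
  have e4 : ∑ j, shiftWeight X K (hf (n - 1)) (hg (m - 1)) x₀ (x i) (y j)
      = (∑ j, κ (y j)) + ∑ j, c2 (y j) := Finset.sum_add_distrib
  rw [e1, e2, e3, e4, hG, stabilityConst]
  ring

end Estimator

/-! ### Variance of the estimator -/

section Variance
variable {d : ℕ} {A : ℝ} (P : PlugIn A) {X : Set (Euc d)}
    (k : EstimatorKind) {B' B : ℝ} {K : Euc d → ℝ} {M : ℝ} {hf hg : ℕ → ℝ} {n m : ℕ}
    {f g : Euc d → ℝ}

lemma measurable_uncurry_looDensity_comp {Ω : Type*} [MeasurableSpace Ω] (hK : Measurable K)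
    {x : Ω → Fin n → Euc d} (hx : Measurable x) (a : Fin n) :
    Measurable (Function.uncurry fun ω => looDensity k B' B K hf (x ω) a) :=
  (measurable_looDensity (n := n) (h := hf) (B' := B') (B := B) k hK a).comp
    (g := fun p : (Fin n → Euc d) × Euc d => looDensity k B' B K hf p.1 a p.2)
    (f := fun z : Ω × Euc d => (x z.1, z.2)) ((hx.comp measurable_fst).prodMk measurable_snd)

lemma measurable_plugInEstimator [NeZero n] [NeZero m] (H : KernelSetup X K M hf hg) :
    Measurable (plugInEstimator P X k B' B K hf hg (n := n) (m := m)) := by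
  have : plugInEstimator P X k B' B K hf hg (n := n) (m := m) = fun w => _ :=
    funext fun w => plugInEstimator_eq P k w
  rw [this]
  refine (Finset.measurable_fun_sum _ fun i _ => ?_).const_mul _
  exact P.measurable_summand H.compact.measurableSet
    (measurable_uncurry_looDensity_comp k H.measurable measurable_fst _)
    (measurable_uncurry_looDensity_comp k H.measurable measurable_snd _) (by fun_prop) (by fun_prop)

/-- A bound for the error of the estimator that holds for all samples. -/
noncomputable def errorBound (A I : ℝ) : ℝ := A * (A * (4 * I)) + 2 * (A * (A + A * I))

lemma abs_plugInEstimator_sub_le [NeZero n] [NeZero m] (H : KernelSetup X K M hf hg)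
    (bf : IsBoundedMeasurable f) (bg : IsBoundedMeasurable g)
    (hfI : ∫ x in X, |f x| ≤ l1Bound X K B' B) (hgI : ∫ x in X, |g x| ≤ l1Bound X K B' B)
    (w : (Fin n → Euc d) × (Fin m → Euc d)) :
    |plugInEstimator P X k B' B K hf hg w - P.ph (P.inner X f g)|
      ≤ errorBound A (l1Bound X K B' B) := by
  have hN0 : (0 : ℝ) < (max n m : ℕ) := by
    have : 0 < max n m := lt_max_of_lt_left (Nat.pos_of_ne_zero (NeZero.ne n))
    exact_mod_cast this
  have : plugInEstimator P X k B' B K hf hg w - P.ph (P.inner X f g)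
      = 1 / ((max n m : ℕ) : ℝ) * ∑ i ∈ Finset.range (max n m),
      (P.summand X (looDensity k B' B K hf w.1 (Fin.ofNat n i))
        (looDensity k B' B K hg w.2 (Fin.ofNat m i)) (w.1 (Fin.ofNat n i)) (w.2 (Fin.ofNat m i))
        - P.ph (P.inner X f g)) := by
    rw [plugInEstimator_eq, Finset.sum_sub_distrib, Finset.sum_const, Finset.card_range,
      nsmul_eq_mul]
    field_simp
  rw [this, abs_mul, abs_of_pos (by positivity), one_div, inv_mul_le_iff₀ hN0]
  refine (Finset.abs_sum_le_sum_abs _ _).trans ((Finset.sum_le_sum fun i _ =>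
    P.abs_summand_sub_ph_le H.compact (H.isBoundedMeasurable k _ _)
      (H.swap.isBoundedMeasurable k _ _) bf bg (H.setIntegral_abs_le k _ _)
      (H.swap.setIntegral_abs_le k _ _) hfI hgI _ _).trans ?_)
  rw [Finset.sum_const, Finset.card_range, nsmul_eq_mul, errorBound]

/-- A bound for the second moments of the averages of `shiftWeight` over a sample. -/
noncomputable def weightConst (B IK M₁ : ℝ) : ℝ :=
  4 * (M₁ * (1 + IK) * (B * (2 * IK * (1 + IK))) + (B * (2 * IK * (1 + IK))) ^ 2)

/-- The constant of the variance bound. -/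
noncomputable def varianceConst (A I IK M₀ M₁ B : ℝ) : ℝ :=
  12 * (stabilityConst A I IK M₀ M₁ ^ 2
    + 2 * (A ^ 2 * (2 + 2 * A * (1 + I))) ^ 2 * weightConst B IK M₁)

lemma integral_sq_avg_shiftWeight_le (H : KernelSetup X K M hf hg) {h η : ℝ} (hh : 0 < h)
    (hη : 0 < η) (hfd : IsDensity f) (hB : ∀ x, f x ≤ B) {N : ℕ} (hN : 0 < N) {M₁ : ℝ}
    (hM₁ : 2 / N * (M / h ^ d) ≤ M₁) (x₀ z : Euc d) (S : Finset (Fin N)) :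
    ∫ x : Fin N → Euc d, (2 / N * ∑ j ∈ S, shiftWeight X K h η x₀ z (x j)) ^ 2
        ∂(Measure.pi fun _ => lawOf f) ≤ weightConst B (∫ u, |K u|) M₁ := by
  have hIK : 0 ≤ ∫ u, |K u| := integral_nonneg fun _ => abs_nonneg _
  have hB0 : 0 ≤ B := (hfd.nonneg 0).trans (hB 0)
  have hw := integrable_shiftWeight (X := X) (x₀ := x₀) (z := z) H.measurable H.integrable hh hη
  have h1 := hfd.integral_sum_sq_le hB hB0
    (measurable_shiftWeight (X := X) (h := h) (η := η) (x₀ := x₀) (z := z) H.measurable)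
    (fun t => shiftWeight_nonneg t)
    (fun t => shiftWeight_le H.measurable H.integrable H.bound hh hη t) hw.1 hw.2 S
  have hN0 : (0 : ℝ) < N := by exact_mod_cast hN
  simp_rw [mul_pow]
  rw [integral_const_mul]
  refine (mul_le_mul_of_nonneg_left h1 (by positivity)).trans ?_
  set IK := ∫ u, |K u|
  have e : (2 / (N : ℝ)) ^ 2 * (N * (2 * (M / h ^ d) * (1 + IK) * (B * (2 * IK * (1 + IK))))
      + (N * (B * (2 * IK * (1 + IK)))) ^ 2)
      = 4 * ((2 / N * (M / h ^ d)) * (1 + IK) * (B * (2 * IK * (1 + IK)))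
        + (B * (2 * IK * (1 + IK))) ^ 2) := by
    field_simp
    try ring
  rw [e, weightConst]
  gcongr

/-- The contribution of one observation to the Efron–Stein bound is of order `n⁻²`. -/
lemma integral_sq_sub_update_le [NeZero n] [NeZero m] (H : KernelSetup X K M hf hg) (hn : 2 ≤ n)
    (hm : 2 ≤ m) (hfd : IsDensity f) (hgd : IsDensity g) (hfB : ∀ x, f x ≤ B)
    (hgB : ∀ x, g x ≤ B) {M₁ : ℝ} (hM₁ : 2 / n * (M / hf (n - 1) ^ d) ≤ M₁)
    (hM₁' : 2 / m * (M / hf (n - 1) ^ d) ≤ M₁)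
    {C : ℝ} (hC : ∀ w, |plugInEstimator P X k B' B K hf hg (n := n) (m := m) w| ≤ C) (i : Fin n)
    (x₀ : Euc d) :
    ∫ w, (plugInEstimator P X k B' B K hf hg w
        - plugInEstimator P X k B' B K hf hg (Function.update w.1 i x₀, w.2)) ^ 2
        ∂(sampleLaw f g n m)
      ≤ varianceConst A (l1Bound X K B' B) (∫ u, |K u|) (|B'| + |B|) M₁ B / n ^ 2 := by
  have := hfd.isProbabilityMeasure
  have := hgd.isProbabilityMeasure
  set F := plugInEstimator P X k B' B K hf hg (n := n) (m := m) with hF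
  have mF : Measurable F := measurable_plugInEstimator P k H
  set c₁ := stabilityConst A (l1Bound X K B' B) (∫ u, |K u|) (|B'| + |B|) M₁ with hc₁
  set c₂ := A ^ 2 * (2 + 2 * A * (1 + l1Bound X K B' B)) with hc₂
  set Q := weightConst B (∫ u, |K u|) M₁ with hQ
  have hIK : 0 ≤ ∫ u, |K u| := integral_nonneg fun _ => abs_nonneg _
  have hn0 : (0 : ℝ) ≤ 2 / n := by positivity
  have hM1 : 0 ≤ M₁ := le_trans (mul_nonneg hn0 (div_nonneg
    ((abs_nonneg _).trans (H.bound 0)) (pow_nonneg (H.pos_fst _).le _))) hM₁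
  have hc₁0 : 0 ≤ c₁ := by
    have := P.nonneg
    have hI0 : 0 ≤ l1Bound X K B' B := l1Bound_nonneg
    rw [hc₁, stabilityConst]; positivity
  have hc₂0 : 0 ≤ c₂ := by
    have := P.nonneg
    have hI0 : 0 ≤ l1Bound X K B' B := l1Bound_nonneg
    positivity
  have hh0 := H.pos_fst (n - 1)
  have hη0 := H.pos_snd (m - 1)
  have mu : Measurable fun w : (Fin n → Euc d) × (Fin m → Euc d) =>
      (Function.update w.1 i x₀, w.2) :=
    (measurable_update_left.comp measurable_fst).prodMk measurable_snd
  unfold sampleLaw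
  rw [integral_update_fst (F := fun w => (F w - F (Function.update w.1 i x₀, w.2)) ^ 2)
    (lawOf f) (Measure.pi fun _ => lawOf g) i ((mF.sub (mF.comp mu)).pow_const 2)
    (fun w => sq_bound ((abs_sub _ _).trans (add_le_add (hC _) (hC _))))]
  set μ := Measure.pi fun _ : Fin n => lawOf f
  set ρ := Measure.pi fun _ : Fin m => lawOf g
  -- the position `z` of the observation being fixed, the bound involves the other ones only
  have hz : ∀ z : Euc d, ∫ w, (F (Function.update w.1 i z, w.2)
      - F (Function.update (Function.update w.1 i z) i x₀, w.2)) ^ 2 ∂(μ.prod ρ)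
      ≤ (2 / n) ^ 2 * (3 * (c₁ ^ 2 + c₂ ^ 2 * Q + c₂ ^ 2 * Q)) := by
    intro z
    set U : (Fin n → Euc d) → ℝ := fun x => 2 / n * ∑ j ∈ Finset.univ.erase i,
              shiftWeight X K (hf (n - 1)) (hf (n - 1)) x₀ z (x j) with hU
    set W : (Fin m → Euc d) → ℝ := fun y => 2 / m * ∑ j,
              shiftWeight X K (hf (n - 1)) (hg (m - 1)) x₀ z (y j) with hW
    have m1 := measurable_shiftWeight (X := X) (h := hf (n - 1)) (η := hf (n - 1)) (x₀ := x₀)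
      (z := z) H.measurable
    have m2 := measurable_shiftWeight (X := X) (h := hf (n - 1)) (η := hg (m - 1)) (x₀ := x₀)
      (z := z) H.measurable
    have mU : Measurable U := by fun_prop
    have mW : Measurable W := by fun_prop
    have bsum : ∀ {N : ℕ} {ω : Euc d → ℝ} {b : ℝ} (S : Finset (Fin N)) (x : Fin N → Euc d),
        (∀ t, 0 ≤ ω t) → (∀ t, ω t ≤ b) → |2 / (N : ℝ) * ∑ j ∈ S, ω (x j)| ≤ 2 / N * (S.card * b) := by
      intro N ω b S x h0 h1
      rw [abs_of_nonneg (mul_nonneg (by positivity) (Finset.sum_nonneg fun _ _ => h0 _))]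
      refine mul_le_mul_of_nonneg_left ((Finset.sum_le_sum fun j _ => h1 (x j)).trans ?_)
        (by positivity)
      simp
    have bU := fun x => bsum (Finset.univ.erase i) x (fun t => shiftWeight_nonneg t)
      (fun t => shiftWeight_le (X := X) (x₀ := x₀) (z := z) H.measurable H.integrable H.bound
        hh0 hh0 t)
    have bW := fun y => bsum (Finset.univ : Finset (Fin m)) y (fun t => shiftWeight_nonneg t)
      (fun t => shiftWeight_le (X := X) (x₀ := x₀) (z := z) H.measurable H.integrable H.bound
        hh0 hη0 t)
    have iU : Integrable (fun w : (Fin n → Euc d) × (Fin m → Euc d) => U w.1 ^ 2) (μ.prod ρ) :=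
      integrable_of_abs_le (by fun_prop) fun w => sq_bound (bU w.1)
    have iW : Integrable (fun w : (Fin n → Euc d) × (Fin m → Euc d) => W w.2 ^ 2) (μ.prod ρ) :=
      integrable_of_abs_le (by fun_prop) fun w => sq_bound (bW w.2)
    have eU : ∫ w, U w.1 ^ 2 ∂(μ.prod ρ) ≤ Q := by
      rw [integral_fun_fst (f := fun x => U x ^ 2)]
      simp only [probReal_univ, one_smul]
      exact integral_sq_avg_shiftWeight_le H hh0 hh0 hfd hfB (by omega) hM₁ x₀ z _
    have eW : ∫ w, W w.2 ^ 2 ∂(μ.prod ρ) ≤ Q := by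
      rw [integral_fun_snd (f := fun y => W y ^ 2)]
      simp only [probReal_univ, one_smul]
      exact integral_sq_avg_shiftWeight_le H hh0 hη0 hgd hgB (by omega) hM₁' x₀ z _
    have hpt : ∀ w : (Fin n → Euc d) × (Fin m → Euc d), (F (Function.update w.1 i z, w.2)
        - F (Function.update (Function.update w.1 i z) i x₀, w.2)) ^ 2
        ≤ (2 / n) ^ 2 * (3 * (c₁ ^ 2 + c₂ ^ 2 * U w.1 ^ 2 + c₂ ^ 2 * W w.2 ^ 2)) := by
      intro w
      have h1 := abs_plugInEstimator_sub_update_le P k (B' := B') (B := B) H hn hm hM₁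
        (Function.update w.1 i z) w.2 i x₀
      have h2 : ∑ j ∈ Finset.univ.erase i, shiftWeight X K (hf (n - 1)) (hf (n - 1)) x₀ z
            (Function.update w.1 i z j)
          = ∑ j ∈ Finset.univ.erase i, shiftWeight X K (hf (n - 1)) (hf (n - 1)) x₀ z (w.1 j) :=
        Finset.sum_congr rfl fun j hj => by rw [Function.update_of_ne (Finset.ne_of_mem_erase hj)]
      rw [Function.update_self, h2] at h1
      have h3 : |F (Function.update w.1 i z, w.2)
        - F (Function.update (Function.update w.1 i z) i x₀, w.2)|
          ≤ 2 / n * (c₁ + c₂ * (U w.1 + W w.2)) := h1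
      rw [← sq_abs]
      refine (pow_le_pow_left₀ (abs_nonneg _) h3 2).trans ?_
      rw [mul_pow]
      refine mul_le_mul_of_nonneg_left ?_ (by positivity)
      nlinarith [sq_nonneg (c₁ - c₂ * U w.1), sq_nonneg (c₁ - c₂ * W w.2),
        sq_nonneg (c₂ * U w.1 - c₂ * W w.2)]
    have i1 : Integrable (fun w : (Fin n → Euc d) × (Fin m → Euc d) => c₁ ^ 2 + c₂ ^ 2 * U w.1 ^ 2)
        (μ.prod ρ) := (integrable_const _).add (iU.const_mul _)
    have i2 : Integrable (fun w : (Fin n → Euc d) × (Fin m → Euc d) =>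
        c₁ ^ 2 + c₂ ^ 2 * U w.1 ^ 2 + c₂ ^ 2 * W w.2 ^ 2) (μ.prod ρ) := i1.add (iW.const_mul _)
    refine (integral_mono_of_nonneg (ae_of_all _ fun w => sq_nonneg _)
      ((i2.const_mul 3).const_mul _) (ae_of_all _ hpt)).trans ?_
    rw [integral_const_mul, integral_const_mul, integral_add i1 (iW.const_mul _),
      integral_add (integrable_const _) (iU.const_mul _), integral_const_mul, integral_const_mul]
    simp only [integral_const, probReal_univ, one_smul]
    gcongr
  refine (integral_mono_of_nonneg (ae_of_all _ fun z => integral_nonneg fun w => sq_nonneg _)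
    (integrable_const _) (ae_of_all _ hz)).trans (le_of_eq ?_)
  simp only [integral_const, probReal_univ, one_smul]
  rw [varianceConst, ← hc₁, ← hc₂, ← hQ]
  ring

/-- The variance of the estimator, by the Efron–Stein inequality. The bounds for `1 / (n h ^ d)`
with mixed sample sizes and bandwidths come from the fact that both samples enter each summand. -/
lemma variance_plugInEstimator_le [NeZero n] [NeZero m] (H : KernelSetup X K M hf hg) (hn : 2 ≤ n)
    (hm : 2 ≤ m) (hfd : IsDensity f) (hgd : IsDensity g) (hfB : ∀ x, f x ≤ B)
    (hgB : ∀ x, g x ≤ B) {M₁ : ℝ} (hM₁ : 2 / n * (M / hf (n - 1) ^ d) ≤ M₁)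
    (hM₁' : 2 / m * (M / hf (n - 1) ^ d) ≤ M₁) (hM₂ : 2 / m * (M / hg (m - 1) ^ d) ≤ M₁)
    (hM₂' : 2 / n * (M / hg (m - 1) ^ d) ≤ M₁)
    {C : ℝ} (hC : ∀ w, |plugInEstimator P X k B' B K hf hg (n := n) (m := m) w| ≤ C) :
    ∫ w, (plugInEstimator P X k B' B K hf hg w
        - ∫ w', plugInEstimator P X k B' B K hf hg w' ∂(sampleLaw f g n m)) ^ 2 ∂(sampleLaw f g n m)
      ≤ varianceConst A (l1Bound X K B' B) (∫ u, |K u|) (|B'| + |B|) M₁ B * (1 / n + 1 / m) := by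
  have := hfd.isProbabilityMeasure
  have := hgd.isProbabilityMeasure
  set V := varianceConst A (l1Bound X K B' B) (∫ u, |K u|) (|B'| + |B|) M₁ B with hV
  have h1 : ∀ i, ∫ w, (plugInEstimator P X k B' B K hf hg w
        - plugInEstimator P X k B' B K hf hg (Function.update w.1 i 0, w.2)) ^ 2
        ∂(sampleLaw f g n m) ≤ V / n ^ 2 := fun i =>
    integral_sq_sub_update_le P k H hn hm hfd hgd hfB hgB hM₁ hM₁' hC i 0
  have hC' : ∀ w, |plugInEstimator P.swap X k B' B K hg hf (n := m) (m := n) w| ≤ C := fun w => by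
    rw [← Prod.swap_swap w, plugInEstimator_swap]; exact hC _
  -- moving an observation of the second sample: interchange the samples and the arguments of `ν`
  have h2 := fun j => integral_sq_sub_update_le P.swap k H.swap hm hn hgd hfd hgB hfB hM₂ hM₂' hC' j 0
  have h2' : ∀ j, ∫ w, (plugInEstimator P X k B' B K hf hg w
        - plugInEstimator P X k B' B K hf hg (w.1, Function.update w.2 j 0)) ^ 2
        ∂(sampleLaw f g n m) ≤ V / m ^ 2 := fun j => by
    refine le_trans (le_of_eq ?_) (h2 j)
    unfold sampleLaw
    rw [← integral_prod_swap]
    refine integral_congr_ae (ae_of_all _ fun w => ?_)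
    simp only
    rw [← plugInEstimator_swap P k w.swap, Prod.swap_swap,
      ← plugInEstimator_swap P k (w.swap.1, _)]
    rfl
  refine (efronStein_prod (lawOf f) (lawOf g) 0 0 n m (measurable_plugInEstimator P k H) hC).trans ?_
  refine (add_le_add (Finset.sum_le_sum fun i _ => h1 i) (Finset.sum_le_sum fun j _ => h2' j)).trans
    (le_of_eq ?_)
  have hn0 : (n : ℝ) ≠ 0 := by exact_mod_cast (by omega : n ≠ 0)
  have hm0 : (m : ℝ) ≠ 0 := by exact_mod_cast (by omega : m ≠ 0)
  simp only [Finset.sum_const, Finset.card_univ, Fintype.card_fin, nsmul_eq_mul]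
  field_simp

end Variance

/-! ### Mean squared error of the estimator -/

section MeanSquaredError
variable {d : ℕ} {A : ℝ} {P : PlugIn A} {X : Set (Euc d)} {ν : ℝ × ℝ → ℝ} {φ : ℝ → ℝ}
    {k : EstimatorKind} {s L B' B : ℝ} {K : Euc d → ℝ} {M : ℝ} {hf hg : ℕ → ℝ} {n m : ℕ}
    {f g : Euc d → ℝ}

lemma IsBoundedHolderDensity.isBoundedMeasurable (hfH : IsBoundedHolderDensity X s L B' B f) :
    IsBoundedMeasurable f :=
  ⟨hfH.density.measurable, B, fun x => by
    rw [abs_of_nonneg (hfH.density.nonneg x)]; exact (hfH.upper x).le⟩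

lemma IsBoundedHolderDensity.setIntegral_abs_le (hfH : IsBoundedHolderDensity X s L B' B f)
    (hK : IsSmoothingKernel s K) : ∫ x in X, |f x| ≤ l1Bound X K B' B := by
  have h1 : ∫ x in X, |f x| ≤ 1 := by
    rw [← hfH.density.integral_eq_one]
    simp_rw [abs_of_nonneg (hfH.density.nonneg _)]
    exact setIntegral_le_integral hfH.density.integrable (ae_of_all _ hfH.density.nonneg)
  have h2 : 1 ≤ ∫ u, |K u| := by
    have := abs_integral_le_integral_abs (f := K) (μ := volume)
    rwa [hK.integral_eq_one, abs_one] at this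
  have h3 : 0 ≤ (|B'| + |B|) * volume.real X := by positivity
  rw [l1Bound]; linarith

lemma KernelSetup.of_isSmoothingKernel (hX : IsCompact X) (hK : IsSmoothingKernel s K)
    (hM : ∀ u, |K u| ≤ M) (hf_pos : ∀ n, 0 < hf n) (hg_pos : ∀ n, 0 < hg n) :
    KernelSetup X K M hf hg :=
  ⟨hX, hK.measurable, hK.integrable, hM, hf_pos, hg_pos⟩

/-- The bias of the estimator is bounded by the mean integrated squared errors of the density
estimates. -/
lemma abs_integral_plugInEstimator_sub_le [NeZero n] [NeZero m]
    (D : FunctionalData X ν φ (k.range B' B) P)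
    (H : KernelSetup X K M hf hg) (hK : IsSmoothingKernel s K) (hB : B' < B)
    (hfH : IsBoundedHolderDensity X s L B' B f) (hgH : IsBoundedHolderDensity X s L B' B g)
    {E : ℝ} (hE : ∀ (a : Fin n) (b : Fin m),
      (∫ x, sqDist X (looDensity k B' B K hf x a) f ∂(Measure.pi fun _ => lawOf f))
        + ∫ y, sqDist X (looDensity k B' B K hg y b) g ∂(Measure.pi fun _ => lawOf g) ≤ E) :
    |(∫ w, plugInEstimator P X k B' B K hf hg w ∂(sampleLaw f g n m)) - P.ph (P.inner X f g)|
      ≤ (2 * A ^ 3 * volume.real X + A ^ 2) * E := by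
  have := hfH.density.isProbabilityMeasure
  have := hgH.density.isProbabilityMeasure
  have hprob : IsProbabilityMeasure (sampleLaw f g n m) := by unfold sampleLaw; infer_instance
  have hA := P.nonneg
  have hN0 : (0 : ℝ) < (max n m : ℕ) := by
    have : 0 < max n m := lt_max_of_lt_left (Nat.pos_of_ne_zero (NeZero.ne n))
    exact_mod_cast this
  set T := P.ph (P.inner X f g)
  have hadm := fun (x : Fin n → Euc d) a =>
    isAdmissible_looDensity k hB.le X H.measurable H.bound H.pos_fst x a
  have hadm' := fun (y : Fin m → Euc d) b =>
    isAdmissible_looDensity k hB.le X H.measurable H.bound H.pos_snd y b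
  have bf := hfH.isBoundedMeasurable
  have bg := hgH.isBoundedMeasurable
  have hfI := hfH.setIntegral_abs_le hK
  have hgI := hgH.setIntegral_abs_le hK
  have hint : ∀ (a : Fin n) (b : Fin m), Integrable (fun w => P.summand X
      (looDensity k B' B K hf w.1 a) (looDensity k B' B K hg w.2 b) (w.1 a) (w.2 b))
      (sampleLaw f g n m) := fun a b => by
    have hm : Measurable (fun w : (Fin n → Euc d) × (Fin m → Euc d) => P.summand X
      (looDensity k B' B K hf w.1 a) (looDensity k B' B K hg w.2 b) (w.1 a) (w.2 b)) :=
      P.measurable_summand H.compact.measurableSet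
        (measurable_uncurry_looDensity_comp k H.measurable measurable_fst _)
        (measurable_uncurry_looDensity_comp k H.measurable measurable_snd _)
        (by fun_prop) (by fun_prop)
    have h2 : Integrable (fun w => P.summand X (looDensity k B' B K hf w.1 a)
        (looDensity k B' B K hg w.2 b) (w.1 a) (w.2 b) - T) (sampleLaw f g n m) :=
      integrable_of_abs_le (hm.sub_const _) fun w =>
        P.abs_summand_sub_ph_le H.compact (H.isBoundedMeasurable k _ _)
          (H.swap.isBoundedMeasurable k _ _) bf bg (H.setIntegral_abs_le k _ _)
          (H.swap.setIntegral_abs_le k _ _) hfI hgI _ _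
    exact (h2.add (integrable_const T)).congr (ae_of_all _ fun w => sub_add_cancel _ _)
  have hsum : ∀ (a : Fin n) (b : Fin m), |(∫ w, P.summand X (looDensity k B' B K hf w.1 a)
      (looDensity k B' B K hg w.2 b) (w.1 a) (w.2 b) ∂(sampleLaw f g n m)) - T|
      ≤ (2 * A ^ 3 * volume.real X + A ^ 2) * E := fun a b => by
    refine (abs_integral_summand_sub_le P D.taylor H.compact hfH.density hgH.density bf bg
      (fun x hx => hfH.mem_range k hx) (fun x hx => hgH.mem_range k hx)
      (p := fun x => looDensity k B' B K hf x a) (q := fun y => looDensity k B' B K hg y b)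
      (measurable_uncurry_looDensity_comp k H.measurable measurable_id a)
      (measurable_uncurry_looDensity_comp k H.measurable measurable_id b)
      (fun x => H.isBoundedMeasurable k x a) (fun y => H.swap.isBoundedMeasurable k y b)
      (fun x => (hadm x a).mem) (fun y => (hadm' y b).mem)
      (fun x y => D.inner_mem (hadm x a) (hadm' y b))
      (D.inner_mem (hfH.isAdmissible k) (hgH.isAdmissible k))
      (fun x => H.setIntegral_abs_le k x a) (fun y => H.swap.setIntegral_abs_le k y b) hfI hgI a b
      (fun x z => looDensity_update_self k x a z) (fun y z => looDensity_update_self k y b z)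
      (integrable_sqDist_looDensity k H.compact hfH H.measurable H.bound H.pos_fst a)
      (integrable_sqDist_looDensity k H.compact hgH H.measurable H.bound H.pos_snd b)).trans ?_
    exact mul_le_mul_of_nonneg_left (hE a b) (by positivity)
  have he : (∫ w, plugInEstimator P X k B' B K hf hg w ∂(sampleLaw f g n m)) - T
      = 1 / ((max n m : ℕ) : ℝ) * ∑ i ∈ Finset.range (max n m),
        ((∫ w, P.summand X (looDensity k B' B K hf w.1 (Fin.ofNat n i))
          (looDensity k B' B K hg w.2 (Fin.ofNat m i)) (w.1 (Fin.ofNat n i))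
          (w.2 (Fin.ofNat m i)) ∂(sampleLaw f g n m)) - T) := by
    simp_rw [plugInEstimator_eq]
    rw [integral_const_mul, integral_finsetSum _ fun i _ => hint _ _, Finset.sum_sub_distrib,
      Finset.sum_const, Finset.card_range, nsmul_eq_mul]
    field_simp
  rw [he, abs_mul, abs_of_pos (by positivity), one_div, inv_mul_le_iff₀ hN0]
  refine (Finset.abs_sum_le_sum_abs _ _).trans
    ((Finset.sum_le_sum fun i _ => hsum _ _).trans (le_of_eq ?_))
  rw [Finset.sum_const, Finset.card_range, nsmul_eq_mul]

variable {ψf ψg : (Euc d → ℝ) → (Euc d → ℝ) → Euc d → ℝ}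

lemma influenceFst_looDensity_ae_eq (D : FunctionalData X ν φ (k.range B' B) P)
    (H : KernelSetup X K M hf hg) (hB : B' < B) (hfd : IsDensity f) (hgd : IsDensity g)
    (hψf : ∀ p q : Euc d → ℝ, IsAdmissible X (k.range B' B) p → IsAdmissible X (k.range B' B) q →
      IsInfluenceFst (functional X φ ν) p q (ψf p q)) (i : Fin n) (j : Fin m)
    (hm : Measurable fun xy : (Fin n → Euc d) × (Fin m → Euc d) =>
      ψf (looDensity k B' B K hf xy.1 i) (looDensity k B' B K hg xy.2 j) (xy.1 i)) :
    ∀ᵐ w ∂(sampleLaw f g n m),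
      ψf (looDensity k B' B K hf w.1 i) (looDensity k B' B K hg w.2 j) (w.1 i)
        = P.influenceFst X (looDensity k B' B K hf w.1 i) (looDensity k B' B K hg w.2 j)
          (w.1 i) := by
  have := hfd.isProbabilityMeasure
  have := hgd.isProbabilityMeasure
  refine ae_of_forall_ae_update_fst (lawOf f) _ i (measurableSet_eq_fun hm
    (P.measurable_influenceFst H.compact.measurableSet
      (measurable_uncurry_looDensity_comp k H.measurable measurable_fst _)
      (measurable_uncurry_looDensity_comp k H.measurable measurable_snd _) (by fun_prop)))
    fun w => ?_
  simp only [looDensity_update_self, Function.update_self]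
  have hp := isAdmissible_looDensity k hB.le X H.measurable H.bound H.pos_fst w.1 i
  have hq := isAdmissible_looDensity k hB.le X H.measurable H.bound H.pos_snd w.2 j
  exact lawOf_absolutelyContinuous.ae_le (D.influenceFst_ae_eq hp hq (hψf _ _ hp hq))

lemma influenceSnd_looDensity_ae_eq (D : FunctionalData X ν φ (k.range B' B) P)
    (H : KernelSetup X K M hf hg) (hB : B' < B) (hfd : IsDensity f) (hgd : IsDensity g)
    (hψg : ∀ p q : Euc d → ℝ, IsAdmissible X (k.range B' B) p → IsAdmissible X (k.range B' B) q →
      IsInfluenceSnd (functional X φ ν) p q (ψg p q)) (i : Fin n) (j : Fin m)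
    (hm : Measurable fun xy : (Fin n → Euc d) × (Fin m → Euc d) =>
      ψg (looDensity k B' B K hf xy.1 i) (looDensity k B' B K hg xy.2 j) (xy.2 j)) :
    ∀ᵐ w ∂(sampleLaw f g n m),
      ψg (looDensity k B' B K hf w.1 i) (looDensity k B' B K hg w.2 j) (w.2 j)
        = P.influenceSnd X (looDensity k B' B K hf w.1 i) (looDensity k B' B K hg w.2 j)
          (w.2 j) := by
  have := hfd.isProbabilityMeasure
  have := hgd.isProbabilityMeasure
  have hm' : Measurable fun w : (Fin m → Euc d) × (Fin n → Euc d) =>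
      ψg (looDensity k B' B K hf w.2 i) (looDensity k B' B K hg w.1 j) (w.1 j) :=
    hm.comp (g := fun xy : (Fin n → Euc d) × (Fin m → Euc d) =>
      ψg (looDensity k B' B K hf xy.1 i) (looDensity k B' B K hg xy.2 j) (xy.2 j))
      (f := Prod.swap) measurable_swap
  have key := ae_of_forall_ae_update_fst (lawOf g) (Measure.pi fun _ : Fin n => lawOf f) j
    (P := fun w : (Fin m → Euc d) × (Fin n → Euc d) =>
      ψg (looDensity k B' B K hf w.2 i) (looDensity k B' B K hg w.1 j) (w.1 j)
        = P.influenceSnd X (looDensity k B' B K hf w.2 i) (looDensity k B' B K hg w.1 j) (w.1 j))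
    (measurableSet_eq_fun hm'
      (P.measurable_influenceSnd H.compact.measurableSet
        (measurable_uncurry_looDensity_comp k H.measurable measurable_snd _)
        (measurable_uncurry_looDensity_comp k H.measurable measurable_fst _) (by fun_prop)))
    fun w => by
      simp only [looDensity_update_self, Function.update_self]
      have hp := isAdmissible_looDensity k hB.le X H.measurable H.bound H.pos_fst w.2 i
      have hq := isAdmissible_looDensity k hB.le X H.measurable H.bound H.pos_snd w.1 j
      exact lawOf_absolutelyContinuous.ae_le (D.influenceSnd_ae_eq hp hq (hψg _ _ hp hq))
  exact (Measure.measurePreserving_swap (μ := Measure.pi fun _ : Fin n => lawOf f)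
    (ν := Measure.pi fun _ : Fin m => lawOf g)).quasiMeasurePreserving.ae key

/-- The leave-one-out estimator does not depend, almost surely, on the choice of the influence
functions. -/
lemma looEstimator_ae_eq [NeZero n] [NeZero m] (D : FunctionalData X ν φ (k.range B' B) P)
    (H : KernelSetup X K M hf hg) (hB : B' < B) (hfd : IsDensity f) (hgd : IsDensity g)
    (hψf : ∀ p q : Euc d → ℝ, IsAdmissible X (k.range B' B) p → IsAdmissible X (k.range B' B) q →
      IsInfluenceFst (functional X φ ν) p q (ψf p q))
    (hψg : ∀ p q : Euc d → ℝ, IsAdmissible X (k.range B' B) p → IsAdmissible X (k.range B' B) q →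
      IsInfluenceSnd (functional X φ ν) p q (ψg p q))
    (hψf_meas : ∀ (i : Fin n) (j : Fin m),
      Measurable fun xy : (Fin n → Euc d) × (Fin m → Euc d) =>
        ψf (looDensity k B' B K hf xy.1 i) (looDensity k B' B K hg xy.2 j) (xy.1 i))
    (hψg_meas : ∀ (i : Fin n) (j : Fin m),
      Measurable fun xy : (Fin n → Euc d) × (Fin m → Euc d) =>
        ψg (looDensity k B' B K hf xy.1 i) (looDensity k B' B K hg xy.2 j) (xy.2 j)) :
    (fun w => looEstimator (functional X φ ν) ψf ψg (looDensity k B' B K hf)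
        (looDensity k B' B K hg) w.1 w.2)
      =ᵐ[sampleLaw f g n m] plugInEstimator P X k B' B K hf hg := by
  have h1 := fun i j => influenceFst_looDensity_ae_eq D H hB hfd hgd hψf i j (hψf_meas i j)
  have h2 := fun i j => influenceSnd_looDensity_ae_eq D H hB hfd hgd hψg i j (hψg_meas i j)
  have h1' := ae_all_iff.2 fun i => ae_all_iff.2 (h1 i)
  have h2' := ae_all_iff.2 fun i => ae_all_iff.2 (h2 i)
  filter_upwards [h1', h2'] with w e1 e2
  unfold plugInEstimator looEstimator
  congr 1
  refine Finset.sum_congr rfl fun i _ => ?_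
  rw [e1, e2, D.functional_eq (isAdmissible_looDensity k hB.le X H.measurable H.bound H.pos_fst _ _)
    (isAdmissible_looDensity k hB.le X H.measurable H.bound H.pos_snd _ _)]

/-- The bound for the mean squared error by the variance and the squared bias. -/
lemma integral_sq_looEstimator_sub_le [NeZero n] [NeZero m]
    (D : FunctionalData X ν φ (k.range B' B) P)
    (H : KernelSetup X K M hf hg) (hK : IsSmoothingKernel s K) (hB : B' < B)
    (hn : 2 ≤ n) (hm : 2 ≤ m)
    (hfH : IsBoundedHolderDensity X s L B' B f) (hgH : IsBoundedHolderDensity X s L B' B g)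
    (hψf : ∀ p q : Euc d → ℝ, IsAdmissible X (k.range B' B) p → IsAdmissible X (k.range B' B) q →
      IsInfluenceFst (functional X φ ν) p q (ψf p q))
    (hψg : ∀ p q : Euc d → ℝ, IsAdmissible X (k.range B' B) p → IsAdmissible X (k.range B' B) q →
      IsInfluenceSnd (functional X φ ν) p q (ψg p q))
    (hψf_meas : ∀ (i : Fin n) (j : Fin m),
      Measurable fun xy : (Fin n → Euc d) × (Fin m → Euc d) =>
        ψf (looDensity k B' B K hf xy.1 i) (looDensity k B' B K hg xy.2 j) (xy.1 i))
    (hψg_meas : ∀ (i : Fin n) (j : Fin m),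
      Measurable fun xy : (Fin n → Euc d) × (Fin m → Euc d) =>
        ψg (looDensity k B' B K hf xy.1 i) (looDensity k B' B K hg xy.2 j) (xy.2 j))
    {M₁ : ℝ} (hM₁ : 2 / n * (M / hf (n - 1) ^ d) ≤ M₁)
    (hM₁' : 2 / m * (M / hf (n - 1) ^ d) ≤ M₁) (hM₂ : 2 / m * (M / hg (m - 1) ^ d) ≤ M₁)
    (hM₂' : 2 / n * (M / hg (m - 1) ^ d) ≤ M₁)
    {E : ℝ} (hE : ∀ (a : Fin n) (b : Fin m),
      (∫ x, sqDist X (looDensity k B' B K hf x a) f ∂(Measure.pi fun _ => lawOf f))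
        + ∫ y, sqDist X (looDensity k B' B K hg y b) g ∂(Measure.pi fun _ => lawOf g) ≤ E) :
    Integrable (fun xy : (Fin n → Euc d) × (Fin m → Euc d) =>
        (looEstimator (functional X φ ν) ψf ψg (looDensity k B' B K hf)
          (looDensity k B' B K hg) xy.1 xy.2 - functional X φ ν f g) ^ 2) (sampleLaw f g n m) ∧
      ∫ xy, (looEstimator (functional X φ ν) ψf ψg (looDensity k B' B K hf)
          (looDensity k B' B K hg) xy.1 xy.2 - functional X φ ν f g) ^ 2 ∂(sampleLaw f g n m)
        ≤ varianceConst A (l1Bound X K B' B) (∫ u, |K u|) (|B'| + |B|) M₁ B * (1 / n + 1 / m)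
          + ((2 * A ^ 3 * volume.real X + A ^ 2) * E) ^ 2 := by
  have := hfH.density.isProbabilityMeasure
  have := hgH.density.isProbabilityMeasure
  have hprob : IsProbabilityMeasure (sampleLaw f g n m) := by unfold sampleLaw; infer_instance
  rw [D.functional_eq (hfH.isAdmissible k) (hgH.isAdmissible k)]
  set T := P.ph (P.inner X f g) with hT
  set F := plugInEstimator P X k B' B K hf hg (n := n) (m := m)
  have hae : (fun xy : (Fin n → Euc d) × (Fin m → Euc d) =>
      (looEstimator (functional X φ ν) ψf ψg (looDensity k B' B K hf)
        (looDensity k B' B K hg) xy.1 xy.2 - T) ^ 2) =ᵐ[sampleLaw f g n m] fun w => (F w - T) ^ 2 := by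
    filter_upwards [looEstimator_ae_eq D H hB hfH.density hgH.density hψf hψg hψf_meas hψg_meas]
      with w hw
    rw [hw]
  have mF : Measurable F := measurable_plugInEstimator P k H
  have hFT : ∀ w, |F w - T| ≤ errorBound A (l1Bound X K B' B) :=
    abs_plugInEstimator_sub_le P k H hfH.isBoundedMeasurable hgH.isBoundedMeasurable
      (hfH.setIntegral_abs_le hK) (hgH.setIntegral_abs_le hK)
  have hF : ∀ w, |F w| ≤ errorBound A (l1Bound X K B' B) + |T| := fun w => by
    have h1 := abs_add_le (F w - T) T
    rw [sub_add_cancel] at h1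
    linarith [hFT w]
  refine ⟨(integrable_congr hae).2 (integrable_of_abs_le ((mF.sub_const T).pow_const 2)
    fun w => sq_bound (hFT w)), ?_⟩
  rw [integral_congr_ae hae]
  have e1 := variance_eq_sq_sub (μ := sampleLaw f g n m) mF hF T
  have e2 := variance_eq_sq_sub (μ := sampleLaw f g n m) mF hF (∫ w, F w ∂(sampleLaw f g n m))
  have hvar := variance_plugInEstimator_le P k H hn hm hfH.density hgH.density
    (fun x => (hfH.upper x).le) (fun x => (hgH.upper x).le) hM₁ hM₁' hM₂ hM₂' hF
  have hbias := abs_integral_plugInEstimator_sub_le D H hK hB hfH hgH hE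
  have hbias2 := pow_le_pow_left₀ (abs_nonneg _) hbias 2
  rw [sq_abs] at hbias2
  have : ∫ w, (F w - T) ^ 2 ∂(sampleLaw f g n m)
      = (∫ w, (F w - ∫ w', F w' ∂(sampleLaw f g n m)) ^ 2 ∂(sampleLaw f g n m))
        + ((∫ w, F w ∂(sampleLaw f g n m)) - T) ^ 2 := by
    rw [e1, e2]; ring
  rw [this]
  exact add_le_add hvar hbias2

end MeanSquaredError

/-! ### Extensions of the functional for both kinds of estimators -/

section Construction
variable {d : ℕ} {X : Set (Euc d)} {ν : ℝ × ℝ → ℝ} {φ : ℝ → ℝ} {B' B : ℝ}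

lemma EstimatorKind.nonempty_interior_range (k : EstimatorKind) (hB : B' < B) :
    (interior (k.range B' B)).Nonempty := by
  cases k
  · exact ⟨0, by simp [EstimatorKind.range]⟩
  · simp only [EstimatorKind.range, interior_Icc]
    exact Set.nonempty_Ioo.2 hB

/-- The data exist for both kinds of estimators: `ν` is differentiable with bounded derivative near
`R × R`, since `R` is either the whole line or compact. -/
lemma exists_functionalData (hX : IsCompact X) (k : EstimatorKind) (hB : B' < B)
    (hν : IsLipschitzTwiceDiffOn ν (k.range B' B ×ˢ k.range B' B))
    (hφ : IsLipschitzTwiceDiffOn φ (integralRange X ν (k.range B' B))) :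
    ∃ (A : ℝ) (P : PlugIn A), FunctionalData X ν φ (k.range B' B) P := by
  have hR : Convex ℝ (k.range B' B) := k.convex_range
  have hi := k.nonempty_interior_range hB
  obtain ⟨A, P, hT, hP⟩ := exists_plugIn hR hi hν (ordConnected_integralRange hR hν) hφ
  refine ⟨A, P, hX, hR, hi.mono interior_subset, hν, hφ, ?_, hT, hP⟩
  cases k
  · obtain ⟨C, hC⟩ := hν.fderiv_bounded (hR.prod hR) (by
      rw [interior_prod_eq]; exact hi.prod hi)
    have hmem : ∀ w : ℝ × ℝ,
        w ∈ EstimatorKind.plain.range B' B ×ˢ EstimatorKind.plain.range B' B :=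
      fun w => ⟨trivial, trivial⟩
    exact ⟨1, one_pos, C, fun z _ w _ =>
      ⟨(hν.differentiable w (hmem w)).self_of_nhds, hC w (hmem w)⟩⟩
  · exact hν.exists_thickening (isCompact_Icc.prod isCompact_Icc)

end Construction

/-! ### Rates of convergence -/

section Rates
variable {d : ℕ} {s : ℝ}

lemma rpow_sub_one_le {θ : ℝ} (h0 : 0 ≤ θ) (h1 : θ ≤ 1) {n : ℕ} (hn : 2 ≤ n) :
    ((n - 1 : ℕ) : ℝ) ^ (-θ) ≤ 2 * (n : ℝ) ^ (-θ) := by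
  have hn' : (2 : ℝ) ≤ n := by exact_mod_cast hn
  have e : ((n - 1 : ℕ) : ℝ) = n - 1 := by rw [Nat.cast_sub (by omega)]; simp
  calc ((n - 1 : ℕ) : ℝ) ^ (-θ) ≤ (2⁻¹ * (n : ℝ)) ^ (-θ) :=
        Real.rpow_le_rpow_of_nonpos (by positivity) (by rw [e]; linarith) (by linarith)
    _ = 2 ^ θ * (n : ℝ) ^ (-θ) := by
        rw [Real.mul_rpow (by positivity) (by positivity), Real.inv_rpow (by positivity),
          Real.rpow_neg (by positivity), inv_inv]
    _ ≤ 2 * (n : ℝ) ^ (-θ) := by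
        refine mul_le_mul_of_nonneg_right ?_ (by positivity)
        simpa using Real.rpow_le_rpow_of_exponent_le (x := 2) (by norm_num) h1

/-- With bandwidths of the order `n ^ (-1 / (2 s + d))`, the variance term `1 / (n h ^ d)` and the
squared bias term `h ^ (2 s)` of the kernel density estimate are balanced. -/
lemma exists_bandwidth_bounds (hs : 0 < s) {h : ℕ → ℝ} (hh : ∀ n, 0 < h n)
    (hr : h =Θ[atTop] fun n : ℕ => (n : ℝ) ^ (-1 / (2 * s + d))) :
    ∃ (c : ℝ) (N : ℕ), 0 ≤ c ∧ ∀ n : ℕ, N ≤ n → 2 ≤ n ∧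
      1 / (((n - 1 : ℕ) : ℝ) * h (n - 1) ^ d) ≤ c * (n : ℝ) ^ (-(2 * s / (2 * s + d))) ∧
      (h (n - 1) ^ s) ^ 2 ≤ c * (n : ℝ) ^ (-(2 * s / (2 * s + d))) := by
  obtain ⟨c₂, hc₂, hu⟩ := hr.1.exists_pos
  obtain ⟨c₁, hc₁, hl⟩ := hr.2.exists_pos
  obtain ⟨N, hN⟩ := eventually_atTop.1 (hu.bound.and hl.bound)
  have hsd : 0 < 2 * s + (d : ℝ) := by positivity
  set θ := 2 * s / (2 * s + d) with hθ
  have hθ0 : 0 ≤ θ := by positivity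
  have hθ1 : θ ≤ 1 := by rw [hθ, div_le_one hsd]; linarith [Nat.cast_nonneg (α := ℝ) d]
  refine ⟨2 * c₁ ^ d + 2 * (c₂ ^ s) ^ 2, N + 2, by positivity, fun n hn => ?_⟩
  have hn2 : 2 ≤ n := by omega
  have hr0 : (0 : ℝ) < ((n - 1 : ℕ) : ℝ) := by exact_mod_cast (by omega : 0 < n - 1)
  have h3 := rpow_sub_one_le hθ0 hθ1 hn2
  obtain ⟨h1, h2⟩ := hN (n - 1) (by omega)
  set r := ((n - 1 : ℕ) : ℝ) with hr'
  have hx := hh (n - 1)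
  set x := h (n - 1) with hx'
  rw [Real.norm_of_nonneg hx.le, Real.norm_of_nonneg (by positivity)] at h1 h2
  have hnθ : 0 ≤ (n : ℝ) ^ (-θ) := by positivity
  refine ⟨hn2, ?_, ?_⟩
  · have e1 : r ^ (-1 / (2 * s + d)) * c₁⁻¹ ≤ x := by
      rw [mul_inv_le_iff₀ hc₁, mul_comm x]; exact h2
    have e2 : (r ^ (-1 / (2 * s + (d : ℝ)))) ^ d = r ^ (θ - 1) := by
      rw [← Real.rpow_natCast, ← Real.rpow_mul hr0.le]
      congr 1
      rw [hθ]; field_simp; ring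
    have e3 : r ^ θ * (c₁ ^ d)⁻¹ ≤ r * x ^ d := by
      have := pow_le_pow_left₀ (by positivity) e1 d
      rw [mul_pow, e2, inv_pow] at this
      calc r ^ θ * (c₁ ^ d)⁻¹ = r * (r ^ (θ - 1) * (c₁ ^ d)⁻¹) := by
            rw [Real.rpow_sub_one hr0.ne']; field_simp
        _ ≤ r * x ^ d := mul_le_mul_of_nonneg_left this hr0.le
    calc 1 / (r * x ^ d) ≤ 1 / (r ^ θ * (c₁ ^ d)⁻¹) := one_div_le_one_div_of_le (by positivity) e3
      _ = c₁ ^ d * r ^ (-θ) := by rw [Real.rpow_neg hr0.le]; field_simp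
      _ ≤ c₁ ^ d * (2 * (n : ℝ) ^ (-θ)) := mul_le_mul_of_nonneg_left h3 (by positivity)
      _ ≤ _ := by
        have : 0 ≤ 2 * (c₂ ^ s) ^ 2 * (n : ℝ) ^ (-θ) := by positivity
        linarith
  · have e2 : ((r ^ (-1 / (2 * s + (d : ℝ)))) ^ s) ^ 2 = r ^ (-θ) := by
      rw [← Real.rpow_natCast, ← Real.rpow_mul hr0.le, ← Real.rpow_mul hr0.le]
      congr 1
      rw [hθ]; push_cast; field_simp
    calc (x ^ s) ^ 2 ≤ ((c₂ * r ^ (-1 / (2 * s + (d : ℝ)))) ^ s) ^ 2 := by gcongr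
      _ = (c₂ ^ s) ^ 2 * r ^ (-θ) := by
        rw [Real.mul_rpow hc₂.le (by positivity), mul_pow, e2]
      _ ≤ (c₂ ^ s) ^ 2 * (2 * (n : ℝ) ^ (-θ)) := mul_le_mul_of_nonneg_left h3 (by positivity)
      _ ≤ _ := by
        have : 0 ≤ 2 * c₁ ^ d * (n : ℝ) ^ (-θ) := by positivity
        linarith

/-- The mean integrated squared error of the leave-one-out density estimates, uniformly over the
Hölder class, together with the bound for `1 / (n h ^ d)`. -/
lemma exists_integral_sqDist_looDensity_le (k : EstimatorKind) {X : Set (Euc d)} (hX : IsCompact X)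
    {K : Euc d → ℝ} (hK : IsSmoothingKernel s K) (hs : 0 < s) {L : ℝ} (hL : 0 ≤ L) (B' B : ℝ)
    {M : ℝ} (hM : ∀ u, |K u| ≤ M) {h : ℕ → ℝ} (hh : ∀ n, 0 < h n)
    (hr : h =Θ[atTop] fun n : ℕ => (n : ℝ) ^ (-1 / (2 * s + d))) :
    ∃ (C c : ℝ) (N : ℕ), 0 ≤ c ∧ ∀ n : ℕ, N ≤ n → 2 ≤ n ∧
      1 / ((n : ℝ) * h (n - 1) ^ d) ≤ c ∧
      ∀ f : Euc d → ℝ, IsBoundedHolderDensity X s L B' B f → ∀ i : Fin n,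
        ∫ x : Fin n → Euc d, sqDist X (looDensity k B' B K h x i) f ∂(Measure.pi fun _ => lawOf f)
          ≤ C * (n : ℝ) ^ (-(2 * s / (2 * s + d))) := by
  obtain ⟨c, N, hc, hN⟩ := exists_bandwidth_bounds (d := d) hs hh hr
  set IK := ∫ u, |K u|
  set D := (d : ℝ) ^ holderOrder s * L * ∫ u, ‖u‖ ^ s * |K u|
  refine ⟨(2 * (M * (B * IK) * c) + 2 * (D ^ 2 * c)) * volume.real X, c, N, hc,
    fun n hn => ?_⟩
  obtain ⟨hn2, h1, h2⟩ := hN n hn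
  have hn1 : (1 : ℝ) ≤ n := by exact_mod_cast (by omega : 1 ≤ n)
  have hr0 : (0 : ℝ) < ((n - 1 : ℕ) : ℝ) := by exact_mod_cast (by omega : 0 < n - 1)
  have hrn : ((n - 1 : ℕ) : ℝ) ≤ n := by exact_mod_cast Nat.sub_le _ _
  have hx := hh (n - 1)
  refine ⟨hn2, ?_, fun f hf i => ?_⟩
  · calc 1 / ((n : ℝ) * h (n - 1) ^ d) ≤ 1 / (((n - 1 : ℕ) : ℝ) * h (n - 1) ^ d) := by gcongr
      _ ≤ c * (n : ℝ) ^ (-(2 * s / (2 * s + d))) := h1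
      _ ≤ c := mul_le_of_le_one_right hc (Real.rpow_le_one_of_one_le_of_nonpos hn1
        (neg_nonpos.2 (by positivity)))
  · refine (integral_sqDist_looDensity_le k hX hK hs hL hf hM hh hn2 i).trans ?_
    have hB := hf.pos.le
    have hM0 : 0 ≤ M := (abs_nonneg _).trans (hM 0)
    have hIK : 0 ≤ IK := integral_nonneg fun _ => abs_nonneg _
    set ρ := (n : ℝ) ^ (-(2 * s / (2 * s + d)))
    calc (2 * ((M * (B * IK)) / (((n - 1 : ℕ) : ℝ) * h (n - 1) ^ d))
          + 2 * (D * h (n - 1) ^ s) ^ 2) * volume.real X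
        = (2 * (M * (B * IK) * (1 / (((n - 1 : ℕ) : ℝ) * h (n - 1) ^ d)))
          + 2 * (D ^ 2 * (h (n - 1) ^ s) ^ 2)) * volume.real X := by ring
      _ ≤ (2 * (M * (B * IK) * (c * ρ)) + 2 * (D ^ 2 * (c * ρ))) * volume.real X := by gcongr
      _ = _ := by ring

end Rates

theorem theorem3 {d : ℕ} (hd : 0 < d)
    -- the domain of integration and the Hölder class
    (X : Set (Euc d)) (hX : IsCompact X)
    (s L B' B : ℝ) (hs : 0 < s) (hL : 0 < L) (hB : B' < B)
    -- the density estimators: kernel, bandwidths, with or without truncation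
    (k : EstimatorKind) (K : Euc d → ℝ) (hK : IsSmoothingKernel s K)
    (hf hg : ℕ → ℝ) (hf_pos : ∀ n, 0 < hf n) (hg_pos : ∀ n, 0 < hg n)
    (hf_rate : hf =Θ[atTop] fun n : ℕ => (n : ℝ) ^ (-1 / (2 * s + d)))
    (hg_rate : hg =Θ[atTop] fun n : ℕ => (n : ℝ) ^ (-1 / (2 * s + d)))
    -- the functional `T(f, g) = φ(∫ ν(f, g))` and its influence functions
    (φ : ℝ → ℝ) (ν : ℝ × ℝ → ℝ)
    (hν : IsLipschitzTwiceDiffOn ν (k.range B' B ×ˢ k.range B' B))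
    (hφ : IsLipschitzTwiceDiffOn φ (integralRange X ν (k.range B' B)))
    (ψf ψg : (Euc d → ℝ) → (Euc d → ℝ) → Euc d → ℝ)
    (hψf : ∀ p q : Euc d → ℝ, IsAdmissible X (k.range B' B) p → IsAdmissible X (k.range B' B) q →
      IsInfluenceFst (functional X φ ν) p q (ψf p q))
    (hψg : ∀ p q : Euc d → ℝ, IsAdmissible X (k.range B' B) p → IsAdmissible X (k.range B' B) q →
      IsInfluenceSnd (functional X φ ν) p q (ψg p q))
    -- measurability of the summands of the estimator as functions of the two samples
    (hψf_meas : ∀ (n m : ℕ) (i : Fin n) (j : Fin m),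
      Measurable fun xy : (Fin n → Euc d) × (Fin m → Euc d) =>
        ψf (looDensity k B' B K hf xy.1 i) (looDensity k B' B K hg xy.2 j) (xy.1 i))
    (hψg_meas : ∀ (n m : ℕ) (i : Fin n) (j : Fin m),
      Measurable fun xy : (Fin n → Euc d) × (Fin m → Euc d) =>
        ψg (looDensity k B' B K hf xy.1 i) (looDensity k B' B K hg xy.2 j) (xy.2 j))
    -- the sample sizes are of the same order
    (ζl ζu : ℝ) (hζl : 0 < ζl) :
    ∃ (C : ℝ) (N : ℕ), ∀ f g : Euc d → ℝ,
      IsBoundedHolderDensity X s L B' B f → IsBoundedHolderDensity X s L B' B g →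
      InfluenceRegular X (k.range B' B) ψf f f g →
      InfluenceRegular X (k.range B' B) ψg g f g →
      ∀ (n m : ℕ) [NeZero n] [NeZero m], N ≤ n → N ≤ m →
        ζl ≤ (n : ℝ) / m → (n : ℝ) / m ≤ ζu →
        Integrable (fun xy : (Fin n → Euc d) × (Fin m → Euc d) =>
            (looEstimator (functional X φ ν) ψf ψg (looDensity k B' B K hf)
              (looDensity k B' B K hg) xy.1 xy.2 - functional X φ ν f g) ^ 2)
          (sampleLaw f g n m) ∧
        (s < (d : ℝ) / 2 →
          ∫ xy, (looEstimator (functional X φ ν) ψf ψg (looDensity k B' B K hf)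
              (looDensity k B' B K hg) xy.1 xy.2 - functional X φ ν f g) ^ 2
              ∂(sampleLaw f g n m)
            ≤ C * ((n : ℝ) ^ (-4 * s / (2 * s + d)) + (m : ℝ) ^ (-4 * s / (2 * s + d)))) ∧
        ((d : ℝ) / 2 ≤ s →
          ∫ xy, (looEstimator (functional X φ ν) ψf ψg (looDensity k B' B K hf)
              (looDensity k B' B K hg) xy.1 xy.2 - functional X φ ν f g) ^ 2
              ∂(sampleLaw f g n m)
            ≤ C * (1 / (n : ℝ) + 1 / (m : ℝ))) := by
  obtain ⟨M, hM⟩ := hK.bounded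
  have hM0 : 0 ≤ M := (abs_nonneg _).trans (hM 0)
  obtain ⟨A, P, D⟩ := exists_functionalData hX k hB hν hφ
  obtain ⟨C₁, c₁, N₁, hc₁, h₁⟩ :=
    exists_integral_sqDist_looDensity_le k hX hK hs hL.le B' B hM hf_pos hf_rate
  obtain ⟨C₂, c₂, N₂, hc₂, h₂⟩ :=
    exists_integral_sqDist_looDensity_le k hX hK hs hL.le B' B hM hg_pos hg_rate
  set c := c₁ + c₂ with hc
  set M₁ := 2 * M * c * (1 + |ζu| + ζl⁻¹) with hM₁
  set V := varianceConst A (l1Bound X K B' B) (∫ u, |K u|) (|B'| + |B|) M₁ B with hV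
  set b := (2 * A ^ 3 * volume.real X + A ^ 2) * (|C₁| + |C₂|) with hb
  refine ⟨|V| + 2 * b ^ 2, max N₁ N₂, fun f g hfH hgH _ _ n m _ _ hn hm hl hu => ?_⟩
  obtain ⟨hn2, hn3, hn4⟩ := h₁ n ((le_max_left _ _).trans hn)
  obtain ⟨hm2, hm3, hm4⟩ := h₂ m ((le_max_right _ _).trans hm)
  have hn0 : (0 : ℝ) < n := by exact_mod_cast (by omega : 0 < n)
  have hm0 : (0 : ℝ) < m := by exact_mod_cast (by omega : 0 < m)
  have hx := pow_pos (hf_pos (n - 1)) d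
  have hy := pow_pos (hg_pos (m - 1)) d
  have hnm : (m : ℝ) / n ≤ ζl⁻¹ := by
    rw [← inv_div]; exact inv_anti₀ hζl hl
  have hmn : (n : ℝ) / m ≤ |ζu| := hu.trans (le_abs_self _)
  have hc₁c : c₁ ≤ c := by linarith
  have hc₂c : c₂ ≤ c := by linarith
  have hc0 : 0 ≤ c := hc₁.trans hc₁c
  have hζ : 0 < ζl⁻¹ := inv_pos.2 hζl
  -- the ratio `t` of two sample sizes is bounded, and so is `u`, of the form `1 / (n * h ^ d)`
  have hw : ∀ {t u c' : ℝ}, 0 ≤ t → t ≤ 1 + |ζu| + ζl⁻¹ → u ≤ c' → c' ≤ c →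
      2 * M * (u * t) ≤ M₁ := fun {t u c'} ht0 ht hu hc' => by
    rw [hM₁, mul_assoc (2 * M)]
    refine mul_le_mul_of_nonneg_left ?_ (by positivity)
    exact mul_le_mul (hu.trans hc') ht ht0 hc0
  have q1 : 2 / (n : ℝ) * (M / hf (n - 1) ^ d) ≤ M₁ := by
    refine le_trans (le_of_eq ?_) (hw (t := 1) zero_le_one (by linarith [abs_nonneg ζu]) hn3 hc₁c)
    field_simp
  have q2 : 2 / (m : ℝ) * (M / hf (n - 1) ^ d) ≤ M₁ := by
    refine le_trans (le_of_eq ?_) (hw (t := n / m) (by positivity) (by linarith) hn3 hc₁c)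
    field_simp
  have q3 : 2 / (m : ℝ) * (M / hg (m - 1) ^ d) ≤ M₁ := by
    refine le_trans (le_of_eq ?_) (hw (t := 1) zero_le_one (by linarith [abs_nonneg ζu]) hm3 hc₂c)
    field_simp
  have q4 : 2 / (n : ℝ) * (M / hg (m - 1) ^ d) ≤ M₁ := by
    refine le_trans (le_of_eq ?_) (hw (t := m / n) (by positivity)
      (by linarith [abs_nonneg ζu]) hm3 hc₂c)
    field_simp
  set θ := 2 * s / (2 * s + d) with hθ
  set ρn := (n : ℝ) ^ (-θ) with hρn
  set ρm := (m : ℝ) ^ (-θ) with hρm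
  have hρn0 : 0 ≤ ρn := by positivity
  have hρm0 : 0 ≤ ρm := by positivity
  obtain ⟨hint, hmse⟩ := integral_sq_looEstimator_sub_le D
    (KernelSetup.of_isSmoothingKernel hX hK hM hf_pos hg_pos) hK hB hn2 hm2 hfH hgH hψf hψg
    (hψf_meas n m) (hψg_meas n m) q1 q2 q3 q4 (E := (|C₁| + |C₂|) * (ρn + ρm)) fun a b => by
      refine (add_le_add (hn4 f hfH a) (hm4 g hgH b)).trans ?_
      have e1 := mul_le_mul_of_nonneg_right (le_abs_self C₁) hρn0
      have e2 := mul_le_mul_of_nonneg_right (le_abs_self C₂) hρm0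
      have e3 := mul_nonneg (abs_nonneg C₁) hρm0
      have e4 := mul_nonneg (abs_nonneg C₂) hρn0
      linarith
  have hbias : ((2 * A ^ 3 * volume.real X + A ^ 2) * ((|C₁| + |C₂|) * (ρn + ρm))) ^ 2
      ≤ 2 * b ^ 2 * (ρn ^ 2 + ρm ^ 2) := by
    rw [← mul_assoc, ← hb, mul_pow, mul_comm 2, mul_assoc]
    exact mul_le_mul_of_nonneg_left add_sq_le (sq_nonneg b)
  have hsd : 0 < 2 * s + (d : ℝ) := by positivity
  have hsq : ∀ {N : ℝ}, 0 < N → (N ^ (-θ)) ^ 2 = N ^ (-4 * s / (2 * s + d)) := fun {N} hN => by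
    rw [← Real.rpow_natCast, ← Real.rpow_mul hN.le]
    congr 1
    rw [hθ]; push_cast; ring
  rw [hρn, hρm, hsq hn0, hsq hm0, ← hρn, ← hρm] at hbias
  have hmse' := hmse.trans (add_le_add (mul_le_mul_of_nonneg_right (le_abs_self V)
    (by positivity)) hbias)
  have hn1 : (1 : ℝ) ≤ n := by exact_mod_cast (by omega : 1 ≤ n)
  have hm1 : (1 : ℝ) ≤ m := by exact_mod_cast (by omega : 1 ≤ m)
  refine ⟨hint, fun hsd' => hmse'.trans ?_, fun hsd' => hmse'.trans ?_⟩
  · have key : ∀ {N : ℝ}, 1 ≤ N → 1 / N ≤ N ^ (-4 * s / (2 * s + d)) := fun {N} hN => by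
      rw [one_div, ← Real.rpow_neg_one]
      refine Real.rpow_le_rpow_of_exponent_le hN ?_
      rw [le_div_iff₀ hsd]; linarith
    rw [add_mul]
    exact add_le_add (mul_le_mul_of_nonneg_left (add_le_add (key hn1) (key hm1)) (abs_nonneg _))
      le_rfl
  · have key : ∀ {N : ℝ}, 1 ≤ N → N ^ (-4 * s / (2 * s + d)) ≤ 1 / N := fun {N} hN => by
      rw [one_div, ← Real.rpow_neg_one]
      refine Real.rpow_le_rpow_of_exponent_le hN ?_
      rw [div_le_iff₀ hsd]; linarith
    rw [add_mul]
    exact add_le_add le_rfl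
      (mul_le_mul_of_nonneg_left (add_le_add (key hn1) (key hm1)) (by positivity))
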